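/- **Setting.** Let $(X,\rho)$ be a finite metric space with $n$ points and a fixed ordering of $X$, used to break ties. For finite $S,T\subseteq X$ let $\rho(x,T)=\min_{y\in T}\rho(x,y)$ (with $\rho(x,\emptyset)=\infty$) and $R(S,T)=\sum_{x\in S}\rho(x,T)$. Let $\mathrm{OPT}\in\arg\min_{T\subseteq X,\,|T|\le k}R(X,T)$. Let $\mathrm{far}_r(S,T)$ be the $r$ points of $S$ that are furthest from $T$ (all of $S$ if $|S|<r$) and $R_r(S,T)=R(S\setminus \mathrm{far}_r(S,T),T)$. A $\beta$-approximation offline $k$-median algorithm ($\beta\ge 1$) is a map $\mathcal A$ that sends each $S\subseteq X$ and each integer $k\ge 2$ to a set $\mathcal A(S,k)\subseteq S$ of at most $k$ points with $R(S,\mathcal A(S,k))\le\beta\min_{T\subseteq S,\,|T|\le k}R(S,T)$. The points of $X$ arrive one by one, and when a point is observed it is decided, based only on the points observed so far, whether it is selected as a center. **Procedure** $\mathrm{SelectProc}(\mathcal A,\delta,k,n,\alpha,\gamma,M,\tau)$. Let $\phi_\alpha=150\ln(32k/\delta)/\alpha$ and $k_+=k+\lfloor 38\ln(32k/\delta)\rfloor$.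 Let $P_1$ be the first $\lfloor\alpha n\rfloor$ points of the stream, $P_2$ the following ones up to position $\lfloor 2\alpha n\rfloor$, and $P_3$ the following ones up to position $\lfloor(2\alpha+\gamma)n\rfloor$. Let $T_\alpha=\mathcal A(P_1,k_+)$ and $\psi=\frac1{3\alpha}R_r(P_2,T_\alpha)$ with $r=\lfloor 2\alpha(k+1)\phi_\alpha\rfloor$. Only points of $P_3$ are selected. A point $x\in P_3$ whose closest center in $T_\alpha$ is $c$ is selected if and only if (1) $\rho(x,c)>\psi/(k\tau)$, or (2) fewer than $M$ earlier points of $P_3$ have $c$ as their closest center, or (3) no point $y$ with closest center $c$ and $\rho(y,c)\le\psi/(k\tau)$ has been selected so far. (If $T_\alpha=\emptyset$, all points of $P_3$ are selected.) **Algorithm** $\mathrm{MUNSC}(\mathcal A,\delta,k,n)$. Let $\alpha_1=\delta/(4k)$, $I=\lfloor\log_2(1/(6\alpha_1))\rfloor$, $\alpha_{i+1}=2^i\alpha_1$ for $0\le i\le I$, and $\delta'=\delta/(I+1)$. Run in parallel on the stream $I+1$ copies of SelectProc with confidence parameter $\delta'$ (so that $\phi$ and $k_+$ are computed with $\delta'$)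 and $\tau=\phi_{\alpha_{I+1}}$: copy $i\le I$ with $\alpha=\alpha_i$, $\gamma=2\alpha_i$, $M=1$, and copy $I+1$ with $\alpha=\alpha_{I+1}$, $\gamma=1-2\alpha_{I+1}$, $M=\lceil\log_2(8k_+/\delta')\rceil$. A point is selected by MUNSC when it is observed if and only if at least one of the copies selects it. **Theorem.** There are universal constants $C_1,C>0$ such that the following holds for all integers $k\ge 2$ and $n\ge 0$, all $\delta\in(0,1)$, all metric spaces $(X,\rho)$ with $n$ points, all $\beta\ge 1$, and all $\beta$-approximation offline $k$-median algorithms $\mathcal A$ on $X$. MUNSC selects centers with no substitution: for every stream of distinct points and every prefix of it, the centers selected up to the end of the prefix are exactly the points of the prefix that belong to the final set of selected centers. If the stream is a uniformly random permutation of $X$, then with probability at least $1-\delta$ the set $T_{\mathrm{out}}$ of centers selected by MUNSC satisfies both 1. $|T_{\mathrm{out}}|\le C_1\,k\ln^2(k/\delta)$, and 2. $R(X,T_{\mathrm{out}})\le C\beta\cdot R(X,\mathrm{OPT})$. -/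

import Mathlib

namespace MUNSC

universe u

/-! ### The `k`-median problem -/

section KMedian

variable {X : Type u} [MetricSpace X]

/-- The distance `ρ(x, T) = min_{y ∈ T} ρ(x, y)` from a point to a finite set of centers. It takes
values in `[0, ∞]`; the distance to the empty set is `∞`. -/
noncomputable def setDist (x : X) (T : Finset X) : ENNReal :=
  T.inf (fun y => edist x y)

/-- The `k`-median risk `R(S, T) = ∑_{x ∈ S} ρ(x, T)`. -/
noncomputable def risk (S T : Finset X) : ENNReal :=
  ∑ x ∈ S, setDist x T

/-- `O` is an optimal solution with at most `k` centers, all taken from `S`, for the point set `S`,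
i.e. `O ∈ argmin_{T ⊆ S, |T| ≤ k} R(S, T)`. -/
def IsOptimal (S : Finset X) (k : ℕ) (O : Finset X) : Prop :=
  O ⊆ S ∧ O.card ≤ k ∧ ∀ T : Finset X, T ⊆ S → T.card ≤ k → risk S O ≤ risk S T

/-- The offline algorithm `A`, which maps a finite point set `S` and a number of centers `k ≥ 2` to
a set of at most `k` points of `S`, is a `β`-approximation offline `k`-median algorithm. -/
def IsOfflineApprox (A : Finset X → ℕ → Finset X) (β : ℝ) : Prop :=
  ∀ (S : Finset X) (k : ℕ), 2 ≤ k →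
    A S k ⊆ S ∧ (A S k).card ≤ k ∧
      ∀ O : Finset X, IsOptimal S k O → risk S (A S k) ≤ ENNReal.ofReal β * risk S O

variable [LinearOrder X]

open Classical in
/-- The center in `T` that is closest to `x`, with ties broken by the fixed ordering of the points.
It is `⊤` (no center) exactly when `T` is empty. -/
noncomputable def nearest (T : Finset X) (x : X) : WithTop X :=
  (T.filter (fun c => ∀ c' ∈ T, edist x c ≤ edist x c')).min

open Classical in
/-- `far_r(S, T)`: the `r` points of `S` that are furthest from `T`, with ties broken by the fixed
ordering of the points; all of `S` if `|S| < r`. A point belongs to this set iff fewer than `r`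
points of `S` come before it in the order of decreasing distance from `T`. -/
noncomputable def far (r : ℕ) (S T : Finset X) : Finset X :=
  S.filter (fun x =>
    (S.filter (fun y =>
      setDist x T < setDist y T ∨ (setDist x T = setDist y T ∧ y < x))).card < r)

/-- `R_r(S, T) = R(S \ far_r(S, T), T)`: the risk after discounting the `r` furthest points. -/
noncomputable def truncRisk (r : ℕ) (S T : Finset X) : ENNReal :=
  risk (S \ far r S T) T

end KMedian

/-! ### The sequential no-substitution setting -/

/-- An algorithm in the sequential no-substitution setting, given by its decisions:
`S.selects past chosen x` says that the current point `x` is selected as a center, where `past` is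
the list of the points observed before `x` and `chosen` is the set of centers selected before `x`
is observed. -/
structure OnlineSelector (X : Type u) where
  selects : List X → Finset X → X → Prop

namespace OnlineSelector

variable {X : Type u} [DecidableEq X]

open Classical in
/-- Processing one point of the stream: the decision is made immediately, nothing is removed. -/
noncomputable def step (S : OnlineSelector X) (s : List X × Finset X) (x : X) :
    List X × Finset X :=
  (s.1 ++ [x], if S.selects s.1 s.2 x then insert x s.2 else s.2)

/-- The set of centers selected after reading the stream `l`. -/
noncomputable def run (S : OnlineSelector X) (l : List X) : Finset X :=
  (l.foldl S.step ([], ∅)).2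

/-- No substitution: for every stream of distinct points and every prefix of it, the centers selected
up to the end of the prefix are final; that is, they are exactly the points of the prefix that
belong to the set of centers selected from the whole stream. -/
def NoSubstitution (S : OnlineSelector X) : Prop :=
  ∀ l₁ l₂ : List X, (l₁ ++ l₂).Nodup →
    (S.run (l₁ ++ l₂)).filter (fun x => x ∈ l₁) = S.run l₁

end OnlineSelector

/-! ### The procedure `SelectProc` -/

/-- `φ_α = 150 log(32 k / δ) / α`. -/
noncomputable def phi (k : ℕ) (δ α : ℝ) : ℝ :=
  150 * Real.log (32 * k / δ) / α

/-- `k₊ = k + 38 log(32 k / δ)`, rounded down to an integer. -/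
noncomputable def kPlus (k : ℕ) (δ : ℝ) : ℕ :=
  k + ⌊38 * Real.log (32 * k / δ)⌋₊

section SelectProc

variable {X : Type u} [MetricSpace X] [LinearOrder X]

/-- The points `P₁` of the first phase: the first `α n` points of the stream. -/
noncomputable def phaseOne (n : ℕ) (α : ℝ) (past : List X) : Finset X :=
  (past.take ⌊α * n⌋₊).toFinset

/-- The points `P₂` of the second phase: the next `α n` points of the stream. -/
noncomputable def phaseTwo (n : ℕ) (α : ℝ) (past : List X) : Finset X :=
  ((past.take ⌊2 * α * n⌋₊).drop ⌊α * n⌋₊).toFinset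

/-- The reference clustering `T_α = A(P₁, k₊)`. -/
noncomputable def refClustering (A : Finset X → ℕ → Finset X) (δ : ℝ) (k n : ℕ) (α : ℝ)
    (past : List X) : Finset X :=
  A (phaseOne n α past) (kPlus k δ)

/-- The risk estimate `ψ = R_{2 α (k + 1) φ_α}(P₂, T_α) / (3 α)`. -/
noncomputable def psi (A : Finset X → ℕ → Finset X) (δ : ℝ) (k n : ℕ) (α : ℝ)
    (past : List X) : ENNReal :=
  truncRisk ⌊2 * α * (k + 1) * phi k δ α⌋₊ (phaseTwo n α past) (refClustering A δ k n α past)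
    / ENNReal.ofReal (3 * α)

/-- The procedure `SelectProc` with black box `A` and parameters `δ, k, n, α, γ, M, τ`.
Points are selected only in the third phase, which ends after `(2 α + γ) n` points. A point `x` of
the third phase whose closest center in the reference clustering `T_α` is `c` is selected iff

* its distance from `c` is more than `ψ / (k τ)`, or
* fewer than `M` earlier points of the third phase have `c` as their closest center, or
* no point at distance at most `ψ / (k τ)` from its closest center `c` has been selected so far.

If `T_α` is empty (the first phase is empty), then the first condition holds. -/
noncomputable def selectProc (A : Finset X → ℕ → Finset X) (δ : ℝ) (k n : ℕ) (α γ : ℝ) (M : ℕ)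
    (τ : ℝ) : OnlineSelector X where
  selects past chosen x :=
    let T := refClustering A δ k n α past
    let threshold := psi A δ k n α past / ENNReal.ofReal (k * τ)
    ⌊2 * α * n⌋₊ ≤ past.length ∧ past.length < ⌊(2 * α + γ) * n⌋₊ ∧
      (threshold < setDist x T ∨
        ((past.drop ⌊2 * α * n⌋₊).toFinset.filter
          (fun y => nearest T y = nearest T x)).card < M ∨
        ¬ ∃ y ∈ chosen, nearest T y = nearest T x ∧ setDist y T ≤ threshold)

end SelectProc

/-! ### The algorithm `MUNSC` -/

/-- `α_{i+1} = 2^i δ / (4 k)`, for `i = 0, 1, …`. -/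
noncomputable def scale (δ : ℝ) (k : ℕ) (i : ℕ) : ℝ :=
  2 ^ i * (δ / (4 * k))

/-- `I = ⌊log₂(1 / (6 α₁))⌋`, so that `α_{I+1} ∈ (1/12, 1/6]`. -/
noncomputable def lastIndex (δ : ℝ) (k : ℕ) : ℕ :=
  ⌊Real.logb 2 (1 / (6 * scale δ k 0))⌋₊

/-- The confidence parameter `δ' = δ / (I + 1)` of the copies of `SelectProc`. -/
noncomputable def confidence (δ : ℝ) (k : ℕ) : ℝ :=
  δ / (lastIndex δ k + 1)

section Algorithm

variable {X : Type u} [MetricSpace X] [LinearOrder X]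

/-- The copies of `SelectProc` run by `MUNSC`, indexed by `i = 0, …, I`. All copies use the
threshold parameter `τ = φ_{α_{I+1}}`. Every copy but the last has `γ = 2 α` and `M = 1`; the last
one has `γ = 1 - 2 α` and `M = ⌈log₂(8 k₊ / δ')⌉`. -/
noncomputable def copy (A : Finset X → ℕ → Finset X) (δ : ℝ) (k n : ℕ) (i : ℕ) :
    OnlineSelector X :=
  let I := lastIndex δ k
  let δ' := confidence δ k
  let α := scale δ k i
  let τ := phi k δ' (scale δ k I)
  if i = I then
    selectProc A δ' k n α (1 - 2 * α) ⌈Real.logb 2 (8 * kPlus k δ' / δ')⌉₊ τ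
  else
    selectProc A δ' k n α (2 * α) 1 τ

/-- The algorithm `MUNSC`: every point is fed to all copies of `SelectProc`, each of which keeps its
own set of selected centers, and it is selected iff at least one of the copies selects it. -/
noncomputable def munsc (A : Finset X → ℕ → Finset X) (δ : ℝ) (k n : ℕ) : OnlineSelector X where
  selects past _ x :=
    ∃ i ≤ lastIndex δ k, (copy A δ k n i).selects past ((copy A δ k n i).run past) x

end Algorithm

/-! ### Random order -/

open Classical in
/-- The probability of an event under a uniformly random order of the `n` points of `X`. -/
noncomputable def orderProb {X : Type u} [Fintype X] (n : ℕ) (E : (Fin n ≃ X) → Prop) : ℝ :=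
  ((Finset.univ.filter E).card : ℝ) / (Fintype.card (Fin n ≃ X) : ℝ)

end MUNSC

/-!
Fix a copy of `SelectProc` with sampling rate `α`, write `L = log (32 k / δ')`, and call an optimal
cluster large if it has at least `φ = 150 L / α` points. Each tail bound below fails with probability
at most `exp (-L) = δ' / (32 k)`, so that they can be combined over clusters and copies.

*The reference clustering.* Apart from the `19 L / α` points that are furthest from the optimal
centers, the first phase has risk at most `2 α · OPT`; it contains at most `38 L` of the points left
out, and these can be served by the additional centers of the offline solution. Hence the risk of
the reference clustering `T` on the sample is `O(α β · OPT)` (`risk_offline_le`), and since the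
sample contains a proportional part of each large cluster, the risk of `T` on the large clusters is
`O(β · OPT)` (`risk_largePart_le`, `orderProb_risk_largePart_le`).

*The risk estimate.* The points discarded from the second phase include all points of small
clusters and the outliers of the large ones, so `ψ ≤ R(large, T)` (`orderProb_estimate_le`).
Conversely the second phase contains enough of the `30 k φ` points that are furthest from `T` for
`ψ / (k τ)` to be at least the distance of all later points (`orderProb_beyond_subset`; if `n` is
below `40 k φ`, there are few points anyway). So few points are selected for being far away; the two
other rules select at most `M + 1` points per center (`card_selectProc_run_le`).

*The risk of the output.* An optimal center that arrives in the third phase of a copy is selected or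
lies within `2 ψ / (k τ)` of a selected point. All optimal centers arrive after the first
`δ / (2 k)` part of the stream with probability `1 - δ / 2`, and the small clusters of the last copy
have at most `k τ` points in total, so they cost `O(β · OPT)`. The points of large clusters in the
third phase of the last copy are charged to the cells of its reference clustering. In a cell that is
not selected entirely, the first `M` points are selected; if half of the cell is close to the center,
so is one of these (`orderProb_cell_le`). Otherwise at least a quarter of the cell belongs to small
clusters, and the cost `2 ψ / (k τ)` of a point is charged to those (`risk_unselected_le`). Finally
each large cluster has a fixed fraction of its points in this phase.

The probabilistic input is elementary. A random permutation maps `S` into `D` with probability at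
most `(|D| / n) ^ |S|` (`card_perm_mapsTo_le`), so exponential moments of sums over a sample without
replacement are dominated by those of independent sampling (`sum_perm_prod_le`). This gives the
upper tail, and the lower tail of a count by passing to the complement of the sample. Conditioning
on a prefix of the stream is done by averaging over the permutations of the remaining positions
(`orderProb_le_of_shuffle`).
-/

namespace MUNSC

open Finset

/-! ### Random permutations of a finite type -/

section Counting

open Classical in
/-- In a finite set with a strict total order exactly `r` elements have fewer than `r` predecessors,
unless there are fewer than `r` elements in total. -/
theorem card_filter_rank_lt {α : Type*} (S : Finset α) (lt : α → α → Prop)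
    (irr : ∀ x, ¬ lt x x) (tr : ∀ x y z, lt x y → lt y z → lt x z)
    (tot : ∀ x y, x ≠ y → lt x y ∨ lt y x) (r : ℕ) :
    (S.filter (fun x => (S.filter (fun y => lt y x)).card < r)).card = min r S.card := by
  set rk : α → ℕ := fun x => (S.filter (fun y => lt y x)).card with hrk
  have hmono : ∀ x ∈ S, ∀ y, lt x y → rk x < rk y := by
    intro x hx y hxy
    refine card_lt_card ⟨fun z hz => ?_, fun h => ?_⟩
    · rw [mem_filter] at hz ⊢
      exact ⟨hz.1, tr _ _ _ hz.2 hxy⟩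
    · have := h (mem_filter.2 ⟨hx, hxy⟩)
      exact irr x (mem_filter.1 this).2
  have hinj : Set.InjOn rk (S : Set α) := by
    intro x hx y hy h
    by_contra hne
    rcases tot x y hne with h' | h'
    · exact absurd h (hmono x hx y h').ne
    · exact absurd h (hmono y hy x h').ne'
  have himg : S.image rk = range S.card := by
    refine eq_of_subset_of_card_le (fun j hj => ?_) ?_
    · obtain ⟨x, hx, rfl⟩ := mem_image.1 hj
      rw [mem_range]
      refine card_lt_card ⟨filter_subset _ _, fun h => ?_⟩
      exact irr x (mem_filter.1 (h hx)).2
    · rw [card_image_of_injOn hinj, card_range]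
  have h1 : ((S.filter (fun x => rk x < r)).image rk).card = (S.filter (fun x => rk x < r)).card :=
    card_image_of_injOn (hinj.mono (by intro x hx; exact (mem_filter.1 hx).1))
  have h2 : (S.filter (fun x => rk x < r)).image rk = range (min r S.card) := by
    ext j
    have := congrArg (fun s => j ∈ s) himg
    simp only [mem_image, mem_range, eq_iff_iff] at this
    simp only [mem_image, mem_filter, mem_range, lt_min_iff]
    rw [← this]
    constructor
    · rintro ⟨x, ⟨hx, hr⟩, rfl⟩; exact ⟨hr, x, hx, rfl⟩
    · rintro ⟨hr, x, hx, rfl⟩; exact ⟨x, ⟨hx, hr⟩, rfl⟩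
  rw [← h1, h2, card_range]

/-- Averaging over the orbits of a finite family of bijections. -/
theorem card_filter_le_of_orbits {Ω G : Type*} [Fintype Ω] [Fintype G] [Nonempty G]
    (act : G → Ω → Ω) (hact : ∀ g, Function.Injective (act g))
    (E : Ω → Prop) [DecidablePred E] (q : ℝ)
    (h : ∀ ω, ((univ.filter (fun g => E (act g ω))).card : ℝ) ≤ q * Fintype.card G) :
    ((univ.filter E).card : ℝ) ≤ q * Fintype.card Ω := by
  have hG : (0 : ℝ) < Fintype.card G := by exact_mod_cast Fintype.card_pos
  have key : (Fintype.card G : ℝ) * (univ.filter E).card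
      = ∑ ω : Ω, ((univ.filter (fun g => E (act g ω))).card : ℝ) := by
    have : ∀ ω : Ω, ((univ.filter (fun g => E (act g ω))).card : ℝ)
        = ∑ g : G, if E (act g ω) then (1 : ℝ) else 0 := by
      intro ω; rw [Finset.sum_boole]
    simp_rw [this]
    rw [sum_comm]
    have : ∀ g : G, ∑ ω : Ω, (if E (act g ω) then (1 : ℝ) else 0) = (univ.filter E).card := by
      intro g
      rw [((Finite.injective_iff_bijective.1 (hact g))).sum_comp
        (fun ω => if E ω then (1 : ℝ) else 0), Finset.sum_boole]
    simp_rw [this]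
    simp
  have h2 : ∑ ω : Ω, ((univ.filter (fun g => E (act g ω))).card : ℝ)
      ≤ ∑ ω : Ω, q * Fintype.card G := sum_le_sum fun ω _ => h ω
  rw [← key] at h2
  simp only [sum_const, card_univ, nsmul_eq_mul] at h2
  have : (Fintype.card G : ℝ) * (univ.filter E).card
      ≤ Fintype.card G * (q * Fintype.card Ω) := by linarith
  exact le_of_mul_le_mul_left this hG

variable {ι : Type*} [Fintype ι] [DecidableEq ι]

/-- A uniformly random permutation maps `S` into `D` with probability at most
`(|D| / |ι|) ^ |S|`. -/
theorem card_perm_mapsTo_le (S D : Finset ι) :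
    ((univ.filter (fun π : Equiv.Perm ι => ∀ i ∈ S, π i ∈ D)).card : ℝ)
      ≤ ((D.card : ℝ) / Fintype.card ι) ^ S.card * Fintype.card (Equiv.Perm ι) := by
  induction S using Finset.induction_on with
  | empty => simp
  | insert a S ha ih =>
    set f : ℝ := ((univ.filter (fun π : Equiv.Perm ι => ∀ i ∈ S, π i ∈ D)).card : ℝ) with hf
    set f' : ℝ := ((univ.filter (fun π : Equiv.Perm ι => ∀ i ∈ insert a S, π i ∈ D)).card : ℝ)
      with hf'
    have hn : (0 : ℝ) < Fintype.card ι := by exact_mod_cast Fintype.card_pos_iff.2 ⟨a⟩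
    have hsn : (S.card : ℝ) < Fintype.card ι := by
      exact_mod_cast (card_lt_univ_of_notMem ha)
    have hdn : (D.card : ℝ) ≤ Fintype.card ι := by exact_mod_cast card_le_univ D
    have hsc : ((Sᶜ).card : ℝ) = Fintype.card ι - S.card := by
      rw [card_compl, Nat.cast_sub (card_le_univ S)]
    -- resample the value at `a` by composing with a random swap of `a` with a point outside `S`
    have key : ((Sᶜ).card : ℝ) * f' ≤ (D.card - S.card) * f := by
      have e1 : ∑ π : Equiv.Perm ι, ∑ b ∈ Sᶜ,
          (if ∀ i ∈ insert a S, (π * Equiv.swap a b) i ∈ D then (1 : ℝ) else 0)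
          = (Sᶜ).card * f' := by
        rw [sum_comm]
        have : ∀ b ∈ Sᶜ, ∑ π : Equiv.Perm ι,
            (if ∀ i ∈ insert a S, (π * Equiv.swap a b) i ∈ D then (1 : ℝ) else 0) = f' := by
          intro b _
          refine (_root_.Equiv.sum_comp (Equiv.mulRight (Equiv.swap a b))
            (fun π : Equiv.Perm ι => if ∀ i ∈ insert a S, π i ∈ D then (1 : ℝ) else 0)).trans ?_
          rw [Finset.sum_boole]
        rw [sum_congr rfl this]
        simp
      rw [← e1]
      have e2 : (D.card - S.card) * f = ∑ π : Equiv.Perm ι,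
          (if ∀ i ∈ S, π i ∈ D then ((D.card : ℝ) - S.card) else 0) := by
        rw [← sum_filter, sum_const, nsmul_eq_mul, mul_comm]
      rw [e2]
      refine sum_le_sum fun π _ => ?_
      have hS : ∀ b ∈ Sᶜ, ((∀ i ∈ insert a S, (π * Equiv.swap a b) i ∈ D) ↔
          ((∀ i ∈ S, π i ∈ D) ∧ π b ∈ D)) := by
        intro b hb
        rw [mem_compl] at hb
        have hi : ∀ i ∈ S, (π * Equiv.swap a b) i = π i := by
          intro i hi
          rw [Equiv.Perm.mul_apply, Equiv.swap_apply_of_ne_of_ne]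
          · rintro rfl; exact ha hi
          · rintro rfl; exact hb hi
        rw [forall_mem_insert, and_comm]
        refine and_congr (forall₂_congr fun i h => by rw [hi i h]) ?_
        simp
      by_cases hπ : ∀ i ∈ S, π i ∈ D
      · rw [if_pos hπ]
        rw [sum_congr rfl (fun b hb => if_congr ((hS b hb).trans (and_iff_right hπ)) rfl rfl)]
        rw [Finset.sum_boole]
        have e3 : (Sᶜ.filter (fun b => π b ∈ D)) = (univ.filter (fun b => π b ∈ D)) \ S := by
          ext b; simp [and_comm]
        have e4 : (univ.filter (fun b => π b ∈ D)).card = D.card := by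
          refine card_bij (fun b _ => π b) (by simp) (by simp) ?_
          intro c hc; exact ⟨π.symm c, by simpa using hc, by simp⟩
        have e5 : S ⊆ univ.filter (fun b => π b ∈ D) := by
          intro i hi; simpa using hπ i hi
        rw [e3, card_sdiff_of_subset e5, Nat.cast_sub (card_le_card e5), e4]
      · rw [if_neg hπ]
        refine le_of_eq (sum_eq_zero fun b hb => if_neg ?_)
        rw [hS b hb]; tauto
    rw [hsc] at key
    have hf0 : 0 ≤ f := by positivity
    have hns : (0 : ℝ) < Fintype.card ι - S.card := by linarith
    have step : f' ≤ D.card / Fintype.card ι * f := by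
      rw [div_mul_eq_mul_div, le_div_iff₀ hn]
      have : (Fintype.card ι - S.card : ℝ) * (f' * Fintype.card ι)
          ≤ (Fintype.card ι - S.card : ℝ) * (D.card * f) := by
        have h1 : (Fintype.card ι - S.card : ℝ) * (f' * Fintype.card ι)
          ≤ ((D.card - S.card) * f) * Fintype.card ι := by nlinarith
        have h2 : 0 ≤ (S.card : ℝ) * f * (Fintype.card ι - D.card) :=
          mul_nonneg (by positivity) (by linarith)
        nlinarith
      exact le_of_mul_le_mul_left this hns
    rw [card_insert_of_notMem ha, pow_succ]
    calc f' ≤ D.card / Fintype.card ι * f := step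
      _ ≤ D.card / Fintype.card ι * ((D.card / Fintype.card ι : ℝ) ^ S.card *
          Fintype.card (Equiv.Perm ι)) := by gcongr
      _ = _ := by ring

/-- Sampling without replacement: the exponential moments are dominated by those of independent
sampling with the same inclusion probability. -/
theorem sum_perm_prod_le (D : Finset ι) (b : ι → ℝ) (hb : ∀ i, 0 ≤ b i) :
    ∑ π : Equiv.Perm ι, ∏ i ∈ D, (1 + b (π i))
      ≤ (∏ i, (1 + (D.card : ℝ) / Fintype.card ι * b i)) * Fintype.card (Equiv.Perm ι) := by
  have e1 : ∀ π : Equiv.Perm ι, ∏ i ∈ D, (1 + b (π i))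
      = ∑ S : Finset ι, if (∀ x ∈ S, π⁻¹ x ∈ D) then ∏ x ∈ S, b x else 0 := by
    intro π
    have : ∏ i ∈ D, (1 + b (π i)) = ∏ x ∈ D.map π.toEmbedding, (1 + b x) := by
      rw [prod_map]; rfl
    rw [this, prod_one_add, ← sum_filter]
    refine sum_congr ?_ (fun _ _ => rfl)
    ext S
    simp only [mem_powerset, mem_filter, mem_univ, true_and]
    refine forall₂_congr fun x _ => ?_
    rw [mem_map_equiv]; rfl
  simp_rw [e1]
  rw [sum_comm, prod_one_add, sum_mul]
  have : (univ : Finset ι).powerset = (univ : Finset (Finset ι)) := powerset_univ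
  rw [this]
  refine sum_le_sum fun S _ => ?_
  rw [prod_mul_distrib, prod_const, ← sum_filter, sum_const, nsmul_eq_mul]
  have e2 : (univ.filter (fun π : Equiv.Perm ι => ∀ x ∈ S, π⁻¹ x ∈ D)).card
      = (univ.filter (fun π : Equiv.Perm ι => ∀ x ∈ S, π x ∈ D)).card := by
    refine card_bij (fun π _ => π⁻¹) (by simp) (by simp) ?_
    intro π hπ
    refine ⟨π⁻¹, ?_, inv_inv π⟩
    rw [mem_filter] at hπ ⊢
    exact ⟨mem_univ _, fun x hx => by rw [inv_inv]; exact hπ.2 x hx⟩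
  rw [e2]
  have h0 : 0 ≤ ∏ x ∈ S, b x := prod_nonneg fun x _ => hb x
  nlinarith [card_perm_mapsTo_le S D]

/-- Chernoff's bound for the total weight of a random sample of size `|D|`. The base `2` of the
exponential moment is chosen because `2 ^ w ≤ 1 + w` for `w ∈ [0, 1]`. -/
theorem perm_upper_tail (D : Finset ι) (w : ι → ℝ) (h0 : ∀ i, 0 ≤ w i) (h1 : ∀ i, w i ≤ 1)
    (Y B : ℝ) (hB : (D.card : ℝ) / Fintype.card ι * ∑ i, w i - Y * Real.log 2 ≤ -B) :
    ((univ.filter (fun π : Equiv.Perm ι => Y ≤ ∑ i ∈ D, w (π i))).card : ℝ)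
      ≤ Real.exp (-B) * Fintype.card (Equiv.Perm ι) := by
  set p : ℝ := (D.card : ℝ) / Fintype.card ι with hp
  have hp0 : 0 ≤ p := by positivity
  have hl : 0 < Real.log 2 := Real.log_pos (by norm_num)
  set b : ι → ℝ := fun i => Real.exp (w i * Real.log 2) - 1 with hbd
  have hb0 : ∀ i, 0 ≤ b i := fun i => by
    have := Real.add_one_le_exp (w i * Real.log 2)
    have := mul_nonneg (h0 i) hl.le
    simp only [hbd]; linarith
  have hb1 : ∀ i, b i ≤ w i := fun i => by
    -- convexity of the exponential on `[0, log 2]`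
    have hc := convexOn_exp.2
    have := hc (Set.mem_univ (0 : ℝ)) (Set.mem_univ (Real.log 2))
      (sub_nonneg.2 (h1 i)) (h0 i) (by ring)
    simp only [smul_eq_mul, mul_zero, zero_add, Real.exp_zero, mul_one,
      Real.exp_log (by norm_num : (0 : ℝ) < 2)] at this
    simp only [hbd]; linarith
  have hm := sum_perm_prod_le D b hb0
  have hprod : ∏ i, (1 + p * b i) ≤ Real.exp (p * ∑ i, w i) := by
    rw [mul_sum, Real.exp_sum]
    refine prod_le_prod (fun i _ => by have := mul_nonneg hp0 (hb0 i); linarith) fun i _ => ?_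
    have := Real.add_one_le_exp (p * w i)
    have := mul_le_mul_of_nonneg_left (hb1 i) hp0
    linarith
  have hlow : ((univ.filter (fun π : Equiv.Perm ι => Y ≤ ∑ i ∈ D, w (π i))).card : ℝ)
      * Real.exp (Y * Real.log 2) ≤ ∑ π : Equiv.Perm ι, ∏ i ∈ D, (1 + b (π i)) := by
    rw [← nsmul_eq_mul, ← sum_const, sum_filter]
    refine sum_le_sum fun π _ => ?_
    have : ∏ i ∈ D, (1 + b (π i)) = Real.exp ((∑ i ∈ D, w (π i)) * Real.log 2) := by
      rw [sum_mul, Real.exp_sum]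
      exact prod_congr rfl fun i _ => by simp [hbd]
    rw [this]
    split_ifs with h
    · exact Real.exp_le_exp.2 (mul_le_mul_of_nonneg_right h hl.le)
    · positivity
  have hN : (0 : ℝ) ≤ Fintype.card (Equiv.Perm ι) := by positivity
  have h3 := hlow.trans (hm.trans (mul_le_mul_of_nonneg_right hprod hN))
  have h4 : Real.exp (p * ∑ i, w i) ≤ Real.exp (-B) * Real.exp (Y * Real.log 2) := by
    rw [← Real.exp_add]; exact Real.exp_le_exp.2 (by linarith)
  have h5 := h3.trans (mul_le_mul_of_nonneg_right h4 hN)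
  refine le_of_mul_le_mul_right (a := Real.exp (Y * Real.log 2)) ?_ (Real.exp_pos _)
  linarith

/-- Lower tail for the number of points of `N` in a random sample of size `|D|`. -/
theorem perm_lower_tail (D N : Finset ι) (Y B : ℝ)
    (hB : Y * Real.log 2 - (D.card : ℝ) / Fintype.card ι * N.card / 2 ≤ -B) :
    ((univ.filter (fun π : Equiv.Perm ι => ((D.filter (fun i => π i ∈ N)).card : ℝ) ≤ Y)).card : ℝ)
      ≤ Real.exp (-B) * Fintype.card (Equiv.Perm ι) := by
  set p : ℝ := (D.card : ℝ) / Fintype.card ι with hp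
  have hl : 0 < Real.log 2 := Real.log_pos (by norm_num)
  have hN : (0 : ℝ) ≤ Fintype.card (Equiv.Perm ι) := by positivity
  rcases isEmpty_or_nonempty ι with hι | hι
  · have hNe : N = ∅ := by ext x; exact hι.elim x
    have hDe : D = ∅ := by ext x; exact hι.elim x
    subst hNe hDe
    simp only [card_empty, Nat.cast_zero, mul_zero, zero_div, sub_zero] at hB
    simp only [filter_empty, card_empty, Nat.cast_zero]
    by_cases hY : 0 ≤ Y
    · have : (1 : ℝ) ≤ Real.exp (-B) := Real.one_le_exp (by nlinarith)
      simp only [hY, filter_true, card_univ]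
      nlinarith
    · simp only [hY, filter_false, card_empty, Nat.cast_zero]
      positivity
  have hn : (0 : ℝ) < Fintype.card ι := by exact_mod_cast Fintype.card_pos
  -- the complement of a random sample is a random sample
  set b : ι → ℝ := fun i => if i ∈ N then 1 else 0 with hbd
  have hm := sum_perm_prod_le Dᶜ b (fun i => by simp only [hbd]; split_ifs <;> norm_num)
  have hpc : ((Dᶜ.card : ℝ) / Fintype.card ι) = 1 - p := by
    rw [card_compl, Nat.cast_sub (card_le_univ D), sub_div, div_self hn.ne']
  rw [hpc] at hm
  have hp1 : p ≤ 1 := by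
    rw [hp, div_le_one hn]; exact_mod_cast card_le_univ D
  have hprod : ∏ i, (1 + (1 - p) * b i) ≤ Real.exp (N.card * (Real.log 2 - p / 2)) := by
    have : ∏ i, (1 + (1 - p) * b i) = (2 - p) ^ N.card := by
      have e : ∀ i, (1 + (1 - p) * b i) = if i ∈ N then (2 - p) else 1 := by
        intro i; simp only [hbd]; split_ifs <;> ring
      simp_rw [e]
      rw [prod_ite_mem, univ_inter, prod_const]
    rw [this, Real.exp_nat_mul]
    refine pow_le_pow_left₀ (by linarith) ?_ _
    rw [Real.exp_sub, Real.exp_log (by norm_num), le_div_iff₀ (Real.exp_pos _)]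
    have h1 := Real.add_one_le_exp (-(p / 2))
    have h2 : Real.exp (-(p / 2)) * Real.exp (p / 2) = 1 := by rw [← Real.exp_add]; simp
    nlinarith [Real.exp_pos (p / 2)]
  have hlow : ((univ.filter
      (fun π : Equiv.Perm ι => ((D.filter (fun i => π i ∈ N)).card : ℝ) ≤ Y)).card : ℝ)
      * Real.exp ((N.card - Y) * Real.log 2) ≤ ∑ π : Equiv.Perm ι, ∏ i ∈ Dᶜ, (1 + b (π i)) := by
    rw [← nsmul_eq_mul, ← sum_const, sum_filter]
    refine sum_le_sum fun π _ => ?_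
    have e1 : ∏ i ∈ Dᶜ, (1 + b (π i)) = 2 ^ (Dᶜ.filter (fun i => π i ∈ N)).card := by
      rw [card_filter, ← prod_pow_eq_pow_sum]
      refine prod_congr rfl fun i _ => ?_
      simp only [hbd]; split_ifs <;> norm_num
    have e2 : (D.filter (fun i => π i ∈ N)).card + (Dᶜ.filter (fun i => π i ∈ N)).card
        = N.card := by
      rw [← card_union_of_disjoint (disjoint_filter_filter disjoint_compl_right),
        ← filter_union, union_compl]
      refine card_bij (fun b _ => π b) (by simp) (by simp) ?_
      intro c hc; exact ⟨π.symm c, by simpa using hc, by simp⟩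
    have e3 : (2 : ℝ) ^ (Dᶜ.filter (fun i => π i ∈ N)).card
        = Real.exp ((Dᶜ.filter (fun i => π i ∈ N)).card * Real.log 2) := by
      rw [Real.exp_nat_mul, Real.exp_log (by norm_num)]
    rw [e1, e3]
    have e4 : ((D.filter (fun i => π i ∈ N)).card : ℝ) + (Dᶜ.filter (fun i => π i ∈ N)).card
        = N.card := by exact_mod_cast e2
    split_ifs with h
    · refine Real.exp_le_exp.2 (mul_le_mul_of_nonneg_right ?_ hl.le)
      linarith
    · positivity
  have h3 := hlow.trans (hm.trans (mul_le_mul_of_nonneg_right hprod hN))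
  have h4 : Real.exp (N.card * (Real.log 2 - p / 2))
      ≤ Real.exp (-B) * Real.exp ((N.card - Y) * Real.log 2) := by
    rw [← Real.exp_add]; exact Real.exp_le_exp.2 (by nlinarith)
  have h5 := h3.trans (mul_le_mul_of_nonneg_right h4 hN)
  refine le_of_mul_le_mul_right (a := Real.exp ((N.card - Y) * Real.log 2)) ?_ (Real.exp_pos _)
  linarith

/-- In a random arrangement of a linear order, the first `M` members of `Q` all lie in a
subset containing at most half of `Q` with probability at most `2 ^ (-M)`. -/
theorem perm_first_hits [LinearOrder ι] (Q B : Finset ι) (M : ℕ) (hM : M ≤ Q.card)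
    (hBQ : 2 * (B ∩ Q).card ≤ Q.card) :
    ((univ.filter (fun π : Equiv.Perm ι => ∀ i, π i ∈ Q →
      (univ.filter (fun j => π j ∈ Q ∧ j < i)).card < M → π i ∈ B)).card : ℝ)
      ≤ (1 / 2) ^ M * Fintype.card (Equiv.Perm ι) := by
  classical
  -- permuting the values inside `Q` does not change the positions occupied by `Q`
  refine card_filter_le_of_orbits (G := Equiv.Perm {i // i ∈ Q})
    (fun ρ π => Equiv.Perm.ofSubtype ρ * π) (fun ρ => mul_right_injective _) _ _ ?_
  intro π
  have hρ : ∀ (ρ : Equiv.Perm {i // i ∈ Q}) (i : ι),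
      (Equiv.Perm.ofSubtype ρ) i ∈ Q ↔ i ∈ Q := by
    intro ρ i
    by_cases hi : i ∈ Q
    · simp only [hi, iff_true]
      rw [Equiv.Perm.ofSubtype_apply_of_mem ρ hi]; exact (ρ _).2
    · rw [Equiv.Perm.ofSubtype_apply_of_not_mem ρ hi]
  set U : Finset ι := univ.filter (fun i => π i ∈ Q) with hU
  set U' : Finset ι := U.filter (fun i => (U.filter (fun j => j < i)).card < M) with hU'
  have hUc : U.card = Q.card := by
    refine card_bij (fun b _ => π b) (by simp [hU]) (by simp) ?_
    intro c hc; exact ⟨π.symm c, by simpa [hU] using hc, by simp⟩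
  have hU'c : U'.card = M := by
    have := card_filter_rank_lt U (fun x y => x < y) (fun x => lt_irrefl x)
      (fun x y z => lt_trans) (fun x y h => lt_or_gt_of_ne h) M
    rw [hUc, min_eq_left hM] at this
    rw [← this]
    congr!
  set S : Finset {i // i ∈ Q} := univ.filter (fun x => π.symm x ∈ U') with hS
  set B' : Finset {i // i ∈ Q} := univ.filter (fun x => (x : ι) ∈ B) with hB'
  have hSc : S.card = M := by
    rw [← hU'c]
    refine card_bij (fun x _ => π.symm x) (by simp [hS]) ?_ ?_
    · intro x _ y _ h; exact Subtype.ext (π.symm.injective h)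
    · intro i hi
      have : π i ∈ Q := by simpa [hU] using (mem_filter.1 hi).1
      exact ⟨⟨π i, this⟩, by simpa [hS] using hi, by simp⟩
  have hB'c : B'.card = (B ∩ Q).card := by
    refine card_bij (fun x _ => (x : ι)) ?_ ?_ ?_
    · intro x hx; simp only [hB', mem_filter, mem_univ, true_and] at hx
      exact mem_inter.2 ⟨hx, x.2⟩
    · intro x _ y _ h; exact Subtype.ext h
    · intro i hi; rw [mem_inter] at hi
      exact ⟨⟨i, hi.2⟩, by simpa [hB'] using hi.1, rfl⟩
  have hcount := card_perm_mapsTo_le S B'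
  rw [hSc] at hcount
  have hfrac : ((B'.card : ℝ) / Fintype.card {i // i ∈ Q}) ≤ 1 / 2 := by
    rw [hB'c, Fintype.card_coe]
    rcases Nat.eq_zero_or_pos Q.card with h | h
    · rw [h]; simp
    · rw [div_le_iff₀ (by exact_mod_cast h)]
      have : (2 : ℝ) * (B ∩ Q).card ≤ Q.card := by exact_mod_cast hBQ
      linarith
  refine le_trans ?_ (hcount.trans ?_)
  · norm_cast
    refine card_le_card fun ρ hρ' => ?_
    simp only [mem_filter, mem_univ, true_and, Equiv.Perm.mul_apply, hρ] at hρ' ⊢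
    intro x hx
    have hx' : π.symm x ∈ U' := by simpa [hS] using hx
    have hx2 := (mem_filter.1 hx').2
    have := hρ' (π.symm x) (by simp) (by
      rw [hU, filter_filter] at hx2
      exact hx2)
    rw [Equiv.apply_symm_apply, Equiv.Perm.ofSubtype_apply_coe] at this
    simpa [hB'] using this
  · gcongr

end Counting

/-! ### Random orders and their blocks -/

section RandomOrder

variable {X : Type*} {n : ℕ}

/-- The set of points that a random order places at the positions `a ≤ i < b`. -/
def block (σ : Fin n ≃ X) (a b : ℕ) : Finset X :=
  (univ.filter (fun i : Fin n => a ≤ i.val ∧ i.val < b)).map σ.toEmbedding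

theorem mem_block {σ : Fin n ≃ X} {a b : ℕ} {x : X} :
    x ∈ block σ a b ↔ a ≤ (σ.symm x).val ∧ (σ.symm x).val < b := by
  simp only [block, mem_map_equiv, mem_filter, mem_univ, true_and]

theorem apply_mem_block {σ : Fin n ≃ X} {a b : ℕ} {i : Fin n} :
    σ i ∈ block σ a b ↔ a ≤ i.val ∧ i.val < b := by
  rw [mem_block, Equiv.symm_apply_apply]

theorem block_congr {σ σ' : Fin n ≃ X} {a b c : ℕ} (hb : b ≤ c)
    (h : ∀ i : Fin n, i.val < c → σ i = σ' i) : block σ a b = block σ' a b := by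
  ext x
  constructor
  · intro hx
    rw [mem_block] at hx
    have h1 := h (σ.symm x) (by omega)
    rw [Equiv.apply_symm_apply] at h1
    rw [h1, apply_mem_block]; exact hx
  · intro hx
    rw [mem_block] at hx
    have h1 := h (σ'.symm x) (by omega)
    rw [Equiv.apply_symm_apply] at h1
    rw [← h1, apply_mem_block]; exact hx

theorem card_block (σ : Fin n ≃ X) {a b : ℕ} (hb : b ≤ n) : (block σ a b).card = b - a := by
  rw [block, card_map, ← Nat.card_Ico a b]
  refine card_bij (fun i _ => i.val) (by simp) (fun i _ j _ h => Fin.ext h) ?_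
  intro j hj
  rw [mem_Ico] at hj
  exact ⟨⟨j, by omega⟩, by simpa using hj, rfl⟩

theorem card_block_le (σ : Fin n ≃ X) (a b : ℕ) : (block σ a b).card ≤ b - a := by
  rw [block, card_map, ← Nat.card_Ico a b]
  exact card_le_card_of_injOn (fun i => i.val) (by intro i; simp) (fun i _ j _ h => Fin.ext h)

theorem block_disjoint (σ : Fin n ≃ X) {a b c d : ℕ} (h : b ≤ c) :
    Disjoint (block σ a b) (block σ c d) := by
  rw [disjoint_left]
  intro x hx hx'
  rw [mem_block] at hx hx'
  omega

theorem orderProb_le_of_card [Fintype X] {E : (Fin n ≃ X) → Prop} {q : ℝ} (hq : 0 ≤ q)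
    (h : letI := Classical.decPred E; letI := Classical.decEq X
      ((univ.filter E).card : ℝ) ≤ q * Fintype.card (Fin n ≃ X)) : orderProb n E ≤ q := by
  classical
  unfold orderProb
  refine div_le_of_le_mul₀ (by positivity) hq ?_
  convert h

theorem orderProb_mono [Fintype X] {E E' : (Fin n ≃ X) → Prop} (h : ∀ σ, E σ → E' σ) :
    orderProb n E ≤ orderProb n E' := by
  classical
  unfold orderProb
  refine div_le_div_of_nonneg_right (Nat.cast_le.2 (card_le_card fun σ hσ => ?_)) (by positivity)
  rw [mem_filter] at hσ ⊢
  exact ⟨hσ.1, h σ hσ.2⟩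

theorem orderProb_or_le [Fintype X] (E E' : (Fin n ≃ X) → Prop) :
    orderProb n (fun σ => E σ ∨ E' σ) ≤ orderProb n E + orderProb n E' := by
  classical
  unfold orderProb
  rw [← add_div]
  refine div_le_div_of_nonneg_right ?_ (by positivity)
  norm_cast
  refine le_trans (card_le_card fun σ hσ => ?_) (card_union_le _ _)
  simpa only [mem_filter, mem_univ, true_and, mem_union] using hσ

theorem orderProb_exists_le [Fintype X] {κ : Type*} (S : Finset κ) (E : κ → (Fin n ≃ X) → Prop) :
    orderProb n (fun σ => ∃ c ∈ S, E c σ) ≤ ∑ c ∈ S, orderProb n (E c) := by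
  classical
  induction S using Finset.induction_on with
  | empty => simp [orderProb]
  | insert a S ha ih =>
    rw [sum_insert ha]
    refine le_trans (orderProb_mono (E' := fun σ => E a σ ∨ ∃ c ∈ S, E c σ) ?_)
      ((orderProb_or_le _ _).trans (by linarith))
    intro σ hσ
    simpa using hσ

theorem one_sub_le_orderProb [Fintype X] (hn : Fintype.card X = n) (E : (Fin n ≃ X) → Prop) {q : ℝ}
    (h : orderProb n (fun σ => ¬ E σ) ≤ q) : 1 - q ≤ orderProb n E := by
  classical
  have h1 := orderProb_or_le (X := X) (n := n) E (fun σ => ¬ E σ)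
  have h2 : orderProb n (fun σ : Fin n ≃ X => E σ ∨ ¬ E σ) = 1 := by
    unfold orderProb
    have : Nonempty (Fin n ≃ X) := ⟨(Fintype.equivFinOfCardEq hn).symm⟩
    have h3 : (Fintype.card (Fin n ≃ X) : ℝ) ≠ 0 := by exact_mod_cast Fintype.card_ne_zero
    simp only [Classical.em, filter_true, card_univ]
    exact div_self h3
  linarith

theorem orderProb_eq_zero [Fintype X] {E : (Fin n ≃ X) → Prop} (h : ∀ σ, ¬ E σ) :
    orderProb n E = 0 := by
  classical
  unfold orderProb
  rw [filter_false_of_mem (fun σ _ => h σ)]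
  simp

/-- Rearranging the positions from `a` on. -/
def shuffle (a : ℕ) (π : Equiv.Perm {i : Fin n // a ≤ i.val}) (σ : Fin n ≃ X) : Fin n ≃ X :=
  (Equiv.Perm.ofSubtype π).trans σ

theorem shuffle_injective (a : ℕ) (π : Equiv.Perm {i : Fin n // a ≤ i.val}) :
    Function.Injective (shuffle (X := X) a π) := by
  intro σ σ' h
  ext i
  have := congrArg (fun e => e ((Equiv.Perm.ofSubtype π).symm i)) h
  simpa [shuffle] using this

theorem shuffle_apply_of_lt {a : ℕ} (π : Equiv.Perm {i : Fin n // a ≤ i.val}) (σ : Fin n ≃ X)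
    {i : Fin n} (hi : i.val < a) : shuffle a π σ i = σ i := by
  unfold shuffle
  rw [Equiv.trans_apply, Equiv.Perm.ofSubtype_apply_of_not_mem π (by simpa using hi)]

theorem shuffle_apply_coe {a : ℕ} (π : Equiv.Perm {i : Fin n // a ≤ i.val}) (σ : Fin n ≃ X)
    (i : {i : Fin n // a ≤ i.val}) : shuffle a π σ i.val = σ (π i).val := by
  unfold shuffle
  rw [Equiv.trans_apply, Equiv.Perm.ofSubtype_apply_coe]

/-- Conditioning on the first `a` points of the order. -/
theorem orderProb_le_of_shuffle [Fintype X] (a : ℕ) {E : (Fin n ≃ X) → Prop} {q : ℝ} (hq : 0 ≤ q)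
    (h : ∀ σ, letI := Classical.decPred E
      ((univ.filter (fun π : Equiv.Perm {i : Fin n // a ≤ i.val} => E (shuffle a π σ))).card : ℝ)
        ≤ q * Fintype.card (Equiv.Perm {i : Fin n // a ≤ i.val})) :
    orderProb n E ≤ q := by
  classical
  refine orderProb_le_of_card hq ?_
  have := card_filter_le_of_orbits (shuffle (X := X) (n := n) a) (shuffle_injective a) E q
    (fun σ => by convert h σ)
  convert this

theorem card_suffix (a : ℕ) : Fintype.card {i : Fin n // a ≤ i.val} = n - a := by
  rw [Fintype.card_subtype]
  have := card_block (Equiv.refl (Fin n)) (a := a) le_rfl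
  rw [block, card_map] at this
  rw [← this]
  congr 1
  ext i; simp

/-- The positions of a block, as positions of the suffix that starts at `a`. -/
def suffixBlock (n a b c : ℕ) : Finset {i : Fin n // a ≤ i.val} :=
  univ.filter (fun i => b ≤ i.val.val ∧ i.val.val < c)

theorem card_suffixBlock {a b c : ℕ} (hab : a ≤ b) (hc : c ≤ n) :
    (suffixBlock n a b c).card = c - b := by
  rw [suffixBlock, ← Nat.card_Ico b c]
  refine card_bij (fun i _ => i.val.val) (by simp)
    (fun i _ j _ h => Subtype.ext (Fin.ext h)) ?_
  intro j hj
  rw [mem_Ico] at hj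
  exact ⟨⟨⟨j, by omega⟩, by simp; omega⟩, by simpa using hj, rfl⟩

theorem block_shuffle {a b c : ℕ} (hab : a ≤ b) (π : Equiv.Perm {i : Fin n // a ≤ i.val})
    (σ : Fin n ≃ X) : block (shuffle a π σ) b c = (suffixBlock n a b c).map
      ⟨fun i => σ (π i).val, fun _ _ h => π.injective (Subtype.ext (σ.injective h))⟩ := by
  ext x
  simp only [block, suffixBlock, mem_map, mem_filter, mem_univ, true_and,
    Function.Embedding.coeFn_mk]
  constructor
  · rintro ⟨i, hi, rfl⟩
    exact ⟨⟨i, hab.trans hi.1⟩, hi, (shuffle_apply_coe π σ ⟨i, hab.trans hi.1⟩).symm⟩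
  · rintro ⟨i, hi, rfl⟩
    exact ⟨i.val, hi, shuffle_apply_coe π σ i⟩

/-- Upper tail for the total weight of a block, where the weights may depend on the points that
come before position `a`. -/
theorem orderProb_le_of_upper_tail [Fintype X] {a b c : ℕ} (hab : a ≤ b) (hbc : b ≤ c) (hc : c ≤ n)
    {E : (Fin n ≃ X) → Prop} {B : ℝ}
    (H : ∀ σ₀ : Fin n ≃ X, ∃ (w : X → ℝ) (Y : ℝ), (∀ x, 0 ≤ w x ∧ w x ≤ 1) ∧
      ((c : ℝ) - b) / ((n : ℝ) - a) * ∑ x, w x - Y * Real.log 2 ≤ -B ∧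
      ∀ σ : Fin n ≃ X, (∀ i : Fin n, i.val < a → σ i = σ₀ i) → E σ →
        Y ≤ ∑ x ∈ block σ b c, w x) :
    orderProb n E ≤ Real.exp (-B) := by
  classical
  refine orderProb_le_of_shuffle a (Real.exp_pos _).le fun σ₀ => ?_
  obtain ⟨w, Y, hw, hB, hE⟩ := H σ₀
  have hsum : ∑ i : {i : Fin n // a ≤ i.val}, w (σ₀ i.val) ≤ ∑ x, w x := by
    rw [← Equiv.sum_comp σ₀ w]
    rw [← Finset.sum_subtype (univ.filter (fun i : Fin n => a ≤ i.val)) (by simp)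
      (fun i => w (σ₀ i))]
    exact sum_le_sum_of_subset_of_nonneg (filter_subset _ _) fun i _ _ => (hw _).1
  have hcb : (0 : ℝ) ≤ (c : ℝ) - b := by simpa using hbc
  have hna : (0 : ℝ) ≤ (n : ℝ) - a := by
    have : a ≤ n := by omega
    simpa using this
  have ht := perm_upper_tail (suffixBlock n a b c) (fun i => w (σ₀ i.val)) (fun i => (hw _).1)
    (fun i => (hw _).2) Y B (by
      rw [card_suffixBlock hab hc, card_suffix, Nat.cast_sub hbc, Nat.cast_sub (by omega)]
      have := mul_le_mul_of_nonneg_left hsum (div_nonneg hcb hna)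
      linarith)
  refine le_trans ?_ ht
  norm_cast
  refine card_le_card fun π hπ => ?_
  simp only [mem_filter, mem_univ, true_and] at hπ ⊢
  have := hE _ (fun i hi => shuffle_apply_of_lt π σ₀ hi) hπ
  rwa [block_shuffle hab, sum_map] at this

/-- Lower tail for the number of points of a block that belong to a set, which may depend on the
points that come before position `a`. -/
theorem orderProb_le_of_lower_tail [Fintype X] {a b c : ℕ} (hab : a ≤ b) (hbc : b ≤ c) (hc : c ≤ n)
    {E : (Fin n ≃ X) → Prop} {B : ℝ} [DecidableEq X]
    (H : ∀ σ₀ : Fin n ≃ X, ∃ (N : Finset X) (Y : ℝ), Disjoint N (block σ₀ 0 a) ∧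
      Y * Real.log 2 - ((c : ℝ) - b) / ((n : ℝ) - a) * N.card / 2 ≤ -B ∧
      ∀ σ : Fin n ≃ X, (∀ i : Fin n, i.val < a → σ i = σ₀ i) → E σ →
        ((block σ b c ∩ N).card : ℝ) ≤ Y) :
    orderProb n E ≤ Real.exp (-B) := by
  classical
  refine orderProb_le_of_shuffle a (Real.exp_pos _).le fun σ₀ => ?_
  obtain ⟨N, Y, hN, hB, hE⟩ := H σ₀
  set N' : Finset {i : Fin n // a ≤ i.val} := univ.filter (fun i => σ₀ i.val ∈ N) with hN'
  have hcard : N'.card = N.card := by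
    refine card_bij (fun i _ => σ₀ i.val) (by simp [hN'])
      (fun i _ j _ h => Subtype.ext (σ₀.injective h)) ?_
    intro x hx
    have : x ∉ block σ₀ 0 a := disjoint_left.1 hN hx
    rw [mem_block] at this
    exact ⟨⟨σ₀.symm x, by omega⟩, by simpa [hN'] using hx, by simp⟩
  have ht := perm_lower_tail (suffixBlock n a b c) N' Y B (by
      rw [card_suffixBlock hab hc, card_suffix, Nat.cast_sub hbc, Nat.cast_sub (by omega), hcard]
      exact hB)
  refine le_trans ?_ ht
  norm_cast
  refine card_le_card fun π hπ => ?_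
  simp only [mem_filter, mem_univ, true_and] at hπ ⊢
  have := hE _ (fun i hi => shuffle_apply_of_lt π σ₀ hi) hπ
  rw [block_shuffle hab, ← filter_mem_eq_inter, filter_map, card_map] at this
  convert this using 4
  simp only [hN', mem_filter, mem_univ, true_and]
  rfl

/-- Given the first `a` points of the order, let `Q c`, for at most `K` indices `c`, be sets of
later points, at least half of which are good. The probability that for some `c` the first `M`
points of `Q c` are all bad is at most `K / 2 ^ M`. -/
theorem orderProb_le_of_first_hits [Fintype X] {κ : Type*} [DecidableEq X] {a : ℕ} (K M : ℕ)
    {E : (Fin n ≃ X) → Prop}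
    (H : ∀ σ₀ : Fin n ≃ X, ∃ (T : Finset κ) (Q G : κ → Finset X), T.card ≤ K ∧
      (∀ c ∈ T, Disjoint (Q c) (block σ₀ 0 a) ∧ (Q c).card ≤ 2 * (Q c ∩ G c).card) ∧
      ∀ σ : Fin n ≃ X, (∀ i : Fin n, i.val < a → σ i = σ₀ i) → E σ →
        ∃ c ∈ T, M ≤ (Q c).card ∧ ∀ t : Fin n, σ t ∈ Q c → (block σ a t ∩ Q c).card < M →
          σ t ∉ G c) :
    orderProb n E ≤ K * (1 / 2) ^ M := by
  classical
  refine orderProb_le_of_shuffle a (by positivity) fun σ₀ => ?_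
  obtain ⟨T, Q, G, hT, hQ, hE⟩ := H σ₀
  set Q' : κ → Finset {i : Fin n // a ≤ i.val} := fun c => univ.filter (fun i => σ₀ i.val ∈ Q c)
    with hQ'
  set B' : κ → Finset {i : Fin n // a ≤ i.val} := fun c => univ.filter (fun i => σ₀ i.val ∉ G c)
    with hB'
  have hex : ∀ c ∈ T, ∀ x ∈ Q c, ∃ i : {i : Fin n // a ≤ i.val}, σ₀ i.val = x := by
    intro c hc x hx
    have : x ∉ block σ₀ 0 a := disjoint_left.1 (hQ c hc).1 hx
    rw [mem_block] at this
    exact ⟨⟨σ₀.symm x, by omega⟩, by simp⟩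
  have hcard : ∀ c ∈ T, (Q' c).card = (Q c).card := by
    intro c hc
    refine card_bij (fun i _ => σ₀ i.val) (by simp [hQ'])
      (fun i _ j _ h => Subtype.ext (σ₀.injective h)) ?_
    intro x hx
    obtain ⟨i, rfl⟩ := hex c hc x hx
    exact ⟨i, by simpa [hQ'] using hx, rfl⟩
  have hcard2 : ∀ c ∈ T, (B' c ∩ Q' c).card + (Q c ∩ G c).card = (Q c).card := by
    intro c hc
    have : (B' c ∩ Q' c).card = (Q c \ G c).card := by
      refine card_bij (fun i _ => σ₀ i.val) (by simp [hQ', hB']; tauto)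
        (fun i _ j _ h => Subtype.ext (σ₀.injective h)) ?_
      intro x hx
      rw [mem_sdiff] at hx
      obtain ⟨i, rfl⟩ := hex c hc x hx.1
      exact ⟨i, by simpa [hQ', hB'] using hx.symm, rfl⟩
    rw [this, card_sdiff_add_card_inter]
  set F : κ → Finset (Equiv.Perm {i : Fin n // a ≤ i.val}) := fun c =>
    univ.filter (fun π => ∀ i, π i ∈ Q' c →
      (univ.filter (fun j => π j ∈ Q' c ∧ j < i)).card < M → π i ∈ B' c) with hF
  set T' := T.filter (fun c => M ≤ (Q c).card) with hT'
  have hFc : ∀ c ∈ T', ((F c).card : ℝ) ≤ (1 / 2) ^ M *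
      Fintype.card (Equiv.Perm {i : Fin n // a ≤ i.val}) := by
    intro c hc
    rw [hT', mem_filter] at hc
    have h2 := hcard2 c hc.1
    have h3 := (hQ c hc.1).2
    have := perm_first_hits (Q' c) (B' c) M (by rw [hcard c hc.1]; exact hc.2)
      (by rw [hcard c hc.1]; omega)
    convert this
  have hsub : (univ.filter
      (fun π : Equiv.Perm {i : Fin n // a ≤ i.val} => E (shuffle a π σ₀))) ⊆ T'.biUnion F := by
    intro π hπ
    simp only [mem_filter, mem_univ, true_and] at hπ
    obtain ⟨c, hc, hM, hbad⟩ := hE _ (fun i hi => shuffle_apply_of_lt π σ₀ hi) hπ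
    rw [mem_biUnion]
    refine ⟨c, mem_filter.2 ⟨hc, hM⟩, ?_⟩
    simp only [hF, hQ', hB', mem_filter, mem_univ, true_and]
    intro i hi hlt
    have h1 := hbad i.val (by rw [shuffle_apply_coe]; exact hi) (by
      refine lt_of_le_of_lt (le_of_eq ?_) hlt
      rw [block_shuffle le_rfl, ← filter_mem_eq_inter, filter_map, card_map, suffixBlock,
        filter_filter]
      congr 1
      ext j
      simp only [mem_filter, mem_univ, true_and, Function.comp]
      constructor
      · rintro ⟨⟨_, h⟩, h'⟩; exact ⟨h', h⟩
      · rintro ⟨h', h⟩; exact ⟨⟨j.2, h⟩, h'⟩)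
    rwa [shuffle_apply_coe] at h1
  calc _ ≤ ((T'.biUnion F).card : ℝ) := by
        have := card_le_card hsub
        refine le_trans (le_of_eq ?_) (Nat.cast_le.2 this)
        congr!
    _ ≤ ∑ c ∈ T', ((F c).card : ℝ) := by exact_mod_cast card_biUnion_le
    _ ≤ ∑ c ∈ T', (1 / 2) ^ M * (Fintype.card (Equiv.Perm {i : Fin n // a ≤ i.val}) : ℝ) :=
        sum_le_sum hFc
    _ = T'.card * ((1 / 2) ^ M * (Fintype.card (Equiv.Perm {i : Fin n // a ≤ i.val}) : ℝ)) := by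
        rw [sum_const, nsmul_eq_mul]
    _ ≤ K * ((1 / 2) ^ M * (Fintype.card (Equiv.Perm {i : Fin n // a ≤ i.val}) : ℝ)) := by
        gcongr
        exact (card_filter_le _ _).trans hT
    _ = _ := by ring

/-- A given point is among the first `a` points with probability at most `a / n`. -/
theorem orderProb_mem_prefix_le [Fintype X] (hn : Fintype.card X = n) {a : ℕ} (ha : a ≤ n) (x : X) :
    orderProb n (fun σ => x ∈ block σ 0 a) ≤ (a : ℝ) / n := by
  classical
  refine orderProb_le_of_card (by positivity) ?_
  let e : Fin n ≃ X := (Fintype.equivFinOfCardEq hn).symm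
  have := card_perm_mapsTo_le {e.symm x} (univ.filter (fun i : Fin n => i.val < a))
  have h1 : (univ.filter (fun i : Fin n => i.val < a)).card = a := by
    have := card_block (Equiv.refl (Fin n)) (a := 0) ha
    rw [block, card_map] at this
    simpa using this
  rw [h1, card_singleton, pow_one, Fintype.card_fin] at this
  have h2 : Fintype.card (Fin n ≃ X) = Fintype.card (Equiv.Perm (Fin n)) :=
    Fintype.card_congr (Equiv.equivCongr (Equiv.refl _) e.symm)
  rw [h2]
  refine le_trans (le_of_eq ?_) this
  norm_cast
  refine card_bij (fun σ _ => e.trans σ.symm) ?_ ?_ ?_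
  · intro σ hσ
    simp only [mem_filter, mem_univ, true_and, mem_block, Nat.zero_le] at hσ ⊢
    simpa using hσ
  · intro σ _ σ' _ h
    have : σ.symm = σ'.symm := by
      ext y
      have := congrArg (fun f => f (e.symm y)) h
      simpa using congrArg Fin.val this
    simpa using congrArg Equiv.symm this
  · intro π hπ
    refine ⟨π.symm.trans e, ?_, ?_⟩
    · simp only [mem_filter, mem_univ, true_and, mem_block, Nat.zero_le] at hπ ⊢
      simpa using hπ
    · ext y; simp

end RandomOrder

/-! ### Distances, nearest centers and furthest points -/

section Metric

variable {X : Type*} [MetricSpace X]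

theorem setDist_le {x c : X} {T : Finset X} (h : c ∈ T) : setDist x T ≤ edist x c :=
  Finset.inf_le h

theorem exists_setDist_eq (x : X) {T : Finset X} (h : T.Nonempty) :
    ∃ c ∈ T, setDist x T = edist x c :=
  Finset.exists_mem_eq_inf T h _

theorem setDist_empty (x : X) : setDist x ∅ = ⊤ := Finset.inf_empty

theorem setDist_anti (x : X) {T T' : Finset X} (h : T ⊆ T') : setDist x T' ≤ setDist x T :=
  Finset.inf_mono h

theorem setDist_eq_zero_of_mem {x : X} {T : Finset X} (h : x ∈ T) : setDist x T = 0 :=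
  le_antisymm ((setDist_le h).trans (edist_self x).le) zero_le

theorem setDist_le_edist_add (x y : X) (T : Finset X) :
    setDist x T ≤ edist x y + setDist y T := by
  rcases T.eq_empty_or_nonempty with rfl | h
  · simp [setDist_empty]
  · obtain ⟨c, hc, e⟩ := exists_setDist_eq y h
    rw [e]
    exact (setDist_le hc).trans (edist_triangle _ _ _)

theorem risk_mono_left {S S' T : Finset X} (h : S ⊆ S') : risk S T ≤ risk S' T :=
  sum_le_sum_of_subset h

theorem risk_anti_right (S : Finset X) {T T' : Finset X} (h : T ⊆ T') : risk S T' ≤ risk S T :=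
  sum_le_sum fun x _ => setDist_anti x h

/-- If a fraction `1 / κ` of a cluster with center `o` is close to `T`, then so is the whole
cluster. -/
theorem risk_cluster_le (C N T : Finset X) (o : X) {κ : ENNReal}
    (hκ : (C.card : ENNReal) ≤ κ * N.card) :
    risk C T ≤ ∑ x ∈ C, edist x o + κ * ∑ x ∈ N, (edist x o + setDist x T) := by
  have h1 : risk C T ≤ ∑ x ∈ C, edist x o + C.card * setDist o T := by
    unfold risk
    rw [← nsmul_eq_mul, ← sum_const, ← sum_add_distrib]
    exact sum_le_sum fun x _ => setDist_le_edist_add x o T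
  have h2 : (N.card : ENNReal) * setDist o T ≤ ∑ x ∈ N, (edist x o + setDist x T) := by
    rw [← nsmul_eq_mul, ← sum_const]
    refine sum_le_sum fun x _ => ?_
    rw [edist_comm x o]
    exact setDist_le_edist_add o x T
  calc risk C T ≤ ∑ x ∈ C, edist x o + C.card * setDist o T := h1
    _ ≤ ∑ x ∈ C, edist x o + κ * N.card * setDist o T := by gcongr
    _ ≤ _ := by rw [mul_assoc]; gcongr

variable [LinearOrder X]

theorem exists_nearest_eq (x : X) {T : Finset X} (h : T.Nonempty) :
    ∃ c ∈ T, nearest T x = (c : WithTop X) ∧ setDist x T = edist x c := by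
  classical
  obtain ⟨c, hc, e⟩ := exists_setDist_eq x h
  have hne : (T.filter (fun c => ∀ c' ∈ T, edist x c ≤ edist x c')).Nonempty :=
    ⟨c, mem_filter.2 ⟨hc, fun c' hc' => e ▸ setDist_le hc'⟩⟩
  obtain ⟨m, hm⟩ := min_of_nonempty hne
  have hm' := mem_of_min hm
  rw [mem_filter] at hm'
  refine ⟨m, hm'.1, ?_, le_antisymm (setDist_le hm'.1) ?_⟩
  · rw [← hm]; unfold nearest; congr!
  · rw [e]; exact hm'.2 c hc

theorem edist_le_of_nearest_eq {x y : X} {T : Finset X} (h : nearest T x = nearest T y) :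
    edist x y ≤ setDist x T + setDist y T := by
  rcases T.eq_empty_or_nonempty with rfl | hT
  · simp [setDist_empty]
  · obtain ⟨c, -, hc, ex⟩ := exists_nearest_eq x hT
    obtain ⟨c', -, hc', ey⟩ := exists_nearest_eq y hT
    rw [hc, hc'] at h
    rw [ex, ey, WithTop.coe_injective h, edist_comm y c']
    exact edist_triangle _ _ _

theorem nearest_mem (T : Finset X) (x : X) :
    nearest T x ∈ insert ⊤ (T.map ⟨((↑) : X → WithTop X), WithTop.coe_injective⟩) := by
  rcases T.eq_empty_or_nonempty with rfl | hT
  · refine mem_insert.2 (Or.inl ?_)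
    simp [nearest]
  · obtain ⟨c, hc, e, -⟩ := exists_nearest_eq x hT
    rw [e]
    exact mem_insert_of_mem (mem_map_of_mem _ hc)

theorem far_subset (r : ℕ) (S T : Finset X) : far r S T ⊆ S := filter_subset _ _

theorem card_far (r : ℕ) (S T : Finset X) : (far r S T).card = min r S.card := by
  classical
  have := card_filter_rank_lt S
    (fun y x => setDist x T < setDist y T ∨ (setDist x T = setDist y T ∧ y < x))
    (by simp) (by
      rintro x y z (h | ⟨h, h'⟩) (g | ⟨g, g'⟩)
      · exact Or.inl (g.trans h)
      · exact Or.inl (g ▸ h)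
      · exact Or.inl (h ▸ g)
      · exact Or.inr ⟨g.trans h, h'.trans g'⟩) (by
      intro x y hne
      rcases lt_trichotomy (setDist x T) (setDist y T) with h | h | h
      · exact Or.inr (Or.inl h)
      · rcases lt_or_gt_of_ne hne with h' | h'
        · exact Or.inl (Or.inr ⟨h.symm, h'⟩)
        · exact Or.inr (Or.inr ⟨h, h'⟩)
      · exact Or.inl (Or.inl h)) r
  rw [← this]
  unfold far
  congr!

theorem card_far_le (r : ℕ) (S T : Finset X) : (far r S T).card ≤ r :=
  (card_far r S T).trans_le (min_le_left _ _)

theorem far_eq_of_card_le {r : ℕ} {S : Finset X} (T : Finset X) (h : S.card ≤ r) :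
    far r S T = S :=
  eq_of_subset_of_card_le (far_subset r S T) (by rw [card_far, min_eq_right h])

theorem setDist_le_of_mem_far {r : ℕ} {S T : Finset X} {x y : X} (hx : x ∈ far r S T)
    (hy : y ∈ S) (hy' : y ∉ far r S T) : setDist y T ≤ setDist x T := by
  classical
  by_contra! hlt
  refine hy' ?_
  simp only [far, mem_filter] at hx ⊢
  refine ⟨hy, lt_of_le_of_lt (card_le_card fun z hz => ?_) hx.2⟩
  rw [mem_filter] at hz ⊢
  refine ⟨hz.1, Or.inl ?_⟩
  rcases hz.2 with h | h
  · exact hlt.trans h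
  · exact h.1 ▸ hlt

/-- Discarding the `r` furthest points is the best way to discard `r` points. -/
theorem truncRisk_le {r : ℕ} {S G : Finset X} (T : Finset X) (h : (S ∩ G).card ≤ r) :
    truncRisk r S T ≤ risk (S \ G) T := by
  unfold truncRisk
  rcases le_total S.card r with hr | hr
  · rw [far_eq_of_card_le T hr, Finset.sdiff_self]; simp [risk]
  set F := far r S T with hF
  have hFc : F.card = r := by rw [hF, card_far, min_eq_left hr]
  have hFS : F ⊆ S := far_subset r S T
  -- compare the points of `G \ F` with those of `F \ G`, which are further and at least as many
  have hcard : ((S ∩ G) \ F).card ≤ (F \ G).card := by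
    have h1 : (F \ G).card + (F ∩ G).card = r := by rw [card_sdiff_add_card_inter, hFc]
    have h2 : ((S ∩ G) \ F).card + ((S ∩ G) ∩ F).card = (S ∩ G).card :=
      card_sdiff_add_card_inter _ _
    have h3 : (S ∩ G) ∩ F = F ∩ G := by
      ext x; simp only [mem_inter]
      exact ⟨fun h => ⟨h.2, h.1.2⟩, fun h => ⟨⟨hFS h.1, h.2⟩, h.1⟩⟩
    rw [h3] at h2
    omega
  have hsum : risk ((S ∩ G) \ F) T ≤ risk (F \ G) T := by
    rcases ((S ∩ G) \ F).eq_empty_or_nonempty with he | hne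
    · rw [he]; simp [risk]
    · have hd : ∀ y ∈ (S ∩ G) \ F, ∀ x ∈ F \ G, setDist y T ≤ setDist x T := by
        intro y hy x hx
        rw [mem_sdiff, mem_inter] at hy
        exact setDist_le_of_mem_far (mem_sdiff.1 hx).1 hy.1.1 hy.2
      obtain ⟨m, hm, hmax⟩ := exists_max_image _ (fun y => setDist y T) hne
      calc risk ((S ∩ G) \ F) T ≤ ((S ∩ G) \ F).card • setDist m T :=
            sum_le_card_nsmul _ _ _ hmax
        _ ≤ (F \ G).card • setDist m T := nsmul_le_nsmul_left zero_le hcard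
        _ ≤ risk (F \ G) T := card_nsmul_le_sum _ _ _ (fun x hx => hd m hm x hx)
  have e1 : S \ F = ((S \ G) \ F) ∪ ((S ∩ G) \ F) := by
    ext x; simp only [mem_sdiff, mem_union, mem_inter]; tauto
  have e2 : S \ G = ((S \ G) \ F) ∪ (F \ G) := by
    ext x; simp only [mem_sdiff, mem_union]
    have := @hFS x; tauto
  have d1 : Disjoint ((S \ G) \ F) ((S ∩ G) \ F) := by
    rw [disjoint_left]; intro x; simp only [mem_sdiff, mem_inter]; tauto
  have d2 : Disjoint ((S \ G) \ F) (F \ G) := by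
    rw [disjoint_left]; intro x; simp only [mem_sdiff]; tauto
  have e1' : risk (S \ F) T = risk ((S \ G) \ F) T + risk ((S ∩ G) \ F) T := by
    rw [e1]; exact sum_union d1
  have e2' : risk (S \ G) T = risk ((S \ G) \ F) T + risk (F \ G) T := by
    conv_lhs => rw [e2]
    exact sum_union d2
  rw [e1', e2']
  gcongr

theorem truncRisk_eq_zero {r : ℕ} {S : Finset X} (T : Finset X) (h : S.card ≤ r) :
    truncRisk r S T = 0 := by
  unfold truncRisk
  rw [far_eq_of_card_le T h, Finset.sdiff_self]; simp [risk]

theorem le_truncRisk {r : ℕ} {S N T : Finset X} (hN : N ⊆ S) {d : ENNReal}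
    (hd : ∀ x ∈ N, d ≤ setDist x T) : ((N.card - r : ℕ) : ENNReal) * d ≤ truncRisk r S T := by
  have h1 : N.card - r ≤ (N \ far r S T).card := by
    have := le_card_sdiff (far r S T) N
    have := card_far_le r S T
    omega
  calc ((N.card - r : ℕ) : ENNReal) * d ≤ ((N \ far r S T).card : ENNReal) * d := by gcongr
    _ ≤ risk (N \ far r S T) T := by
        rw [← nsmul_eq_mul]
        exact card_nsmul_le_sum _ _ _ fun x hx => hd x (mem_sdiff.1 hx).1
    _ ≤ _ := risk_mono_left (sdiff_subset_sdiff hN (Subset.refl _))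

end Metric

/-- Once the `f` largest terms of a sum over `S` are removed, the remaining terms are at most a
fraction `1 / f` of the sum; scaled by this bound, they are weights in `[0, 1]` to which the upper
tail bound applies. -/
theorem exists_truncated_weights {X : Type*} [Fintype X] [DecidableEq X] (d : X → ENNReal)
    {S F : Finset X} (hFS : F ⊆ S) {f : ℕ} (hf : F.card = f ∨ F = S)
    (hord : ∀ x ∈ F, ∀ y ∈ S \ F, d y ≤ d x) {p κ B : ℝ} (hp : 0 ≤ p) (hκ : 0 < κ)
    (hB : B ≤ (κ * Real.log 2 - p) * f) :
    ∃ (w : X → ℝ) (Y : ℝ), (∀ x, 0 ≤ w x ∧ w x ≤ 1) ∧ p * ∑ x, w x - Y * Real.log 2 ≤ -B ∧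
      ∀ P : Finset X, ENNReal.ofReal κ * ∑ x ∈ S, d x < ∑ x ∈ P ∩ (S \ F), d x →
        Y ≤ ∑ x ∈ P, w x := by
  have hl : 0 < Real.log 2 := Real.log_pos (by norm_num)
  have hsub : ∀ P : Finset X, ∑ x ∈ P ∩ (S \ F), d x ≤ ∑ x ∈ S, d x := fun P =>
    sum_le_sum_of_subset (inter_subset_right.trans sdiff_subset)
  by_cases htriv : F = S ∨ ∑ x ∈ S, d x = 0 ∨ ∑ x ∈ S, d x = ⊤
  · refine ⟨fun _ => 0, B / Real.log 2, by simp, ?_, ?_⟩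
    · simp only [sum_const_zero, mul_zero, zero_sub]
      rw [div_mul_cancel₀ _ hl.ne']
    · intro P hP
      exfalso
      rcases htriv with h | h | h
      · rw [h, Finset.sdiff_self, inter_empty, sum_empty] at hP
        exact not_lt_zero hP
      · have := hsub P
        rw [h] at this hP
        exact absurd (hP.trans_le this) not_lt_zero
      · rw [h, ENNReal.mul_top (by simpa using hκ)] at hP
        exact not_top_lt hP
  push Not at htriv
  obtain ⟨hne, h0, htop⟩ := htriv
  have hf' : F.card = f := hf.resolve_right hne
  set W := ∑ x ∈ S, d x with hW
  have hWr : 0 < W.toReal := ENNReal.toReal_pos h0 htop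
  have hdS : ∀ x ∈ S, d x ≠ ⊤ := fun x hx => (ENNReal.sum_ne_top.1 htop) x hx
  have hle : ∀ x ∈ S \ F, (d x).toReal * f ≤ W.toReal := by
    intro x hx
    have h1 : (f : ENNReal) * d x ≤ W := by
      rw [← hf', ← nsmul_eq_mul]
      exact (card_nsmul_le_sum _ _ _ fun y hy => hord y hy x hx).trans
        (sum_le_sum_of_subset hFS)
    have := ENNReal.toReal_mono htop h1
    rw [ENNReal.toReal_mul, ENNReal.toReal_natCast] at this
    linarith
  refine ⟨fun x => if x ∈ S \ F then (d x).toReal * f / W.toReal else 0, κ * f, ?_, ?_, ?_⟩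
  · intro x
    dsimp only
    split_ifs with h
    · exact ⟨by positivity, (div_le_one hWr).2 (hle x h)⟩
    · exact ⟨le_rfl, zero_le_one⟩
  · have : ∑ x, (if x ∈ S \ F then (d x).toReal * f / W.toReal else 0) ≤ f := by
      rw [sum_ite_mem, univ_inter, ← sum_div, ← sum_mul, div_le_iff₀ hWr, mul_comm]
      refine mul_le_mul_of_nonneg_left ?_ (by positivity)
      rw [← ENNReal.toReal_sum (fun x hx => hdS x (mem_sdiff.1 hx).1)]
      exact ENNReal.toReal_mono htop (sum_le_sum_of_subset sdiff_subset)
    have := mul_le_mul_of_nonneg_left this hp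
    linarith
  · intro P hP
    rw [sum_ite_mem, ← sum_div, ← sum_mul, le_div_iff₀ hWr]
    have hfin : ∑ x ∈ P ∩ (S \ F), d x ≠ ⊤ := ne_top_of_le_ne_top htop (hsub P)
    have := ENNReal.toReal_mono hfin hP.le
    rw [ENNReal.toReal_mul, ENNReal.toReal_ofReal hκ.le, ENNReal.toReal_sum
      (fun x hx => hdS x (mem_sdiff.1 (mem_inter.1 hx).2).1)] at this
    have h2 := mul_le_mul_of_nonneg_right this (Nat.cast_nonneg (α := ℝ) f)
    linarith

/-! ### Online selection in terms of the order -/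

namespace OnlineSelector

variable {X : Type*} [DecidableEq X]

theorem foldl_step_fst (S : OnlineSelector X) (l : List X) :
    (l.foldl S.step ([], ∅)).1 = l := by
  induction l using List.reverseRecOn with
  | nil => rfl
  | append_singleton l x ih =>
    rw [List.foldl_append, List.foldl_cons, List.foldl_nil]
    simp only [step, ih]

open Classical in
theorem run_append_singleton (S : OnlineSelector X) (l : List X) (x : X) :
    S.run (l ++ [x]) = if S.selects l (S.run l) x then insert x (S.run l) else S.run l := by
  unfold run
  rw [List.foldl_append, List.foldl_cons, List.foldl_nil]
  simp only [step, foldl_step_fst]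

theorem run_subset (S : OnlineSelector X) (l : List X) : S.run l ⊆ l.toFinset := by
  induction l using List.reverseRecOn with
  | nil => simp [run]
  | append_singleton l x ih =>
    rw [run_append_singleton]
    intro y hy
    rw [List.toFinset_append, mem_union]
    split_ifs at hy
    · rcases mem_insert.1 hy with rfl | h
      · right; simp
      · exact Or.inl (ih h)
    · exact Or.inl (ih hy)

theorem noSubstitution (S : OnlineSelector X) : S.NoSubstitution := by
  intro l₁ l₂
  induction l₂ using List.reverseRecOn with
  | nil =>
    intro _
    rw [List.append_nil, filter_true_of_mem]
    intro x hx
    exact List.mem_toFinset.1 (S.run_subset l₁ hx)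
  | append_singleton l x ih =>
    intro h
    rw [← List.append_assoc] at h ⊢
    have hx : x ∉ l₁ := by
      intro hx
      have := List.disjoint_of_nodup_append h (List.mem_append_left l hx)
      simp at this
    rw [run_append_singleton, ← ih h.of_append_left]
    split_ifs
    · rw [filter_insert, if_neg hx]
    · rfl

theorem mem_run_take_iff {n : ℕ} (S : OnlineSelector X) (σ : Fin n ≃ X) (t : ℕ) (x : X) :
    x ∈ S.run ((List.ofFn σ).take t) ↔ ∃ i : Fin n, i.val < t ∧ σ i = x ∧
      S.selects ((List.ofFn σ).take i) (S.run ((List.ofFn σ).take i)) (σ i) := by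
  induction t with
  | zero => simp [run]
  | succ t ih =>
    by_cases ht : t < n
    · have e : (List.ofFn σ).take (t + 1) = (List.ofFn σ).take t ++ [σ ⟨t, ht⟩] := by
        rw [List.take_succ_eq_append_getElem (by simpa using ht)]
        simp
      rw [e, run_append_singleton]
      constructor
      · intro h
        split_ifs at h with hs
        · rcases mem_insert.1 h with rfl | h
          · exact ⟨⟨t, ht⟩, Nat.lt_succ_self t, rfl, hs⟩
          · obtain ⟨i, hi, h⟩ := ih.1 h
            exact ⟨i, hi.trans (Nat.lt_succ_self t), h⟩
        · obtain ⟨i, hi, h⟩ := ih.1 h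
          exact ⟨i, hi.trans (Nat.lt_succ_self t), h⟩
      · rintro ⟨i, hi, rfl, h⟩
        rcases Nat.lt_succ_iff_lt_or_eq.1 hi with hi | hi
        · have := ih.2 ⟨i, hi, rfl, h⟩
          split_ifs
          · exact mem_insert_of_mem this
          · exact this
        · have : i = ⟨t, ht⟩ := Fin.ext hi
          subst this
          rw [if_pos h]
          exact mem_insert_self _ _
    · rw [List.take_of_length_le (by simp; omega)]
      rw [List.take_of_length_le (by simp; omega)] at ih
      rw [ih]
      exact exists_congr fun i => by
        have := i.2
        constructor <;> rintro ⟨-, h⟩ <;> exact ⟨by omega, h⟩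

theorem mem_run_iff {n : ℕ} (S : OnlineSelector X) (σ : Fin n ≃ X) (x : X) :
    x ∈ S.run (List.ofFn σ) ↔ ∃ i : Fin n, σ i = x ∧
      S.selects ((List.ofFn σ).take i) (S.run ((List.ofFn σ).take i)) (σ i) := by
  have := S.mem_run_take_iff σ n x
  rw [List.take_of_length_le (by simp)] at this
  rw [this]
  exact exists_congr fun i => by simp [i.2]

end OnlineSelector

section Stream

theorem toFinset_drop_take {X : Type*} [DecidableEq X] {n : ℕ} (σ : Fin n ≃ X) (a t : ℕ) :
    (((List.ofFn σ).take t).drop a).toFinset = block σ a t := by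
  ext x
  rw [List.mem_toFinset, List.mem_iff_getElem, mem_block]
  constructor
  · rintro ⟨i, hi, rfl⟩
    simp only [List.length_drop, List.length_take, List.length_ofFn] at hi
    simp only [List.getElem_drop, List.getElem_take, List.getElem_ofFn, Equiv.symm_apply_apply]
    omega
  · intro h
    have := (σ.symm x).2
    refine ⟨(σ.symm x).val - a, ?_, ?_⟩
    · simp only [List.length_drop, List.length_take, List.length_ofFn]; omega
    · simp only [List.getElem_drop, List.getElem_take, List.getElem_ofFn]
      refine (congrArg σ (Fin.ext ?_)).trans (σ.apply_symm_apply x)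
      simp only
      omega

variable {X : Type*} {n : ℕ}

/-- The reference clustering of `SelectProc`, for the stream in the order `σ`. -/
noncomputable def refSet (A : Finset X → ℕ → Finset X) (δ : ℝ) (k : ℕ) (α : ℝ)
    (σ : Fin n ≃ X) : Finset X :=
  A (block σ 0 ⌊α * n⌋₊) (kPlus k δ)

theorem refSet_congr {A : Finset X → ℕ → Finset X} {δ : ℝ} {k : ℕ} {α : ℝ} {σ σ' : Fin n ≃ X}
    (h : ∀ i : Fin n, i.val < ⌊α * n⌋₊ → σ i = σ' i) :
    refSet A δ k α σ = refSet A δ k α σ' := by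
  unfold refSet
  rw [block_congr le_rfl h]

variable [LinearOrder X]

theorem refClustering_take (A : Finset X → ℕ → Finset X) (δ : ℝ) (k : ℕ) {α : ℝ} (hα : 0 ≤ α)
    (σ : Fin n ≃ X) {t : ℕ} (ht : ⌊2 * α * n⌋₊ ≤ t) :
    refClustering A δ k n α ((List.ofFn σ).take t) = refSet A δ k α σ := by
  have h1 : ⌊α * n⌋₊ ≤ ⌊2 * α * n⌋₊ := by
    apply Nat.floor_le_floor; nlinarith [mul_nonneg hα (Nat.cast_nonneg (α := ℝ) n)]
  unfold refClustering refSet phaseOne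
  rw [List.take_take, min_eq_left (h1.trans ht)]
  have := toFinset_drop_take σ 0 ⌊α * n⌋₊
  rw [List.drop_zero] at this
  rw [this]

variable [MetricSpace X]

/-- The number `r` of furthest points that are discarded in the risk estimate. -/
noncomputable def numOutliers (δ : ℝ) (k : ℕ) (α : ℝ) : ℕ :=
  ⌊2 * α * (k + 1) * phi k δ α⌋₊

/-- The risk estimate `ψ` of `SelectProc`, for the stream in the order `σ`. -/
noncomputable def estimate (A : Finset X → ℕ → Finset X) (δ : ℝ) (k : ℕ) (α : ℝ)
    (σ : Fin n ≃ X) : ENNReal :=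
  truncRisk (numOutliers δ k α) (block σ ⌊α * n⌋₊ ⌊2 * α * n⌋₊) (refSet A δ k α σ)
    / ENNReal.ofReal (3 * α)

theorem psi_take (A : Finset X → ℕ → Finset X) (δ : ℝ) (k : ℕ) {α : ℝ} (hα : 0 ≤ α)
    (σ : Fin n ≃ X) {t : ℕ} (ht : ⌊2 * α * n⌋₊ ≤ t) :
    psi A δ k n α ((List.ofFn σ).take t) = estimate A δ k α σ := by
  unfold psi estimate phaseTwo
  rw [refClustering_take A δ k hα σ ht, List.take_take, min_eq_left ht, toFinset_drop_take]
  rfl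

variable {A : Finset X → ℕ → Finset X} {δ : ℝ} {k : ℕ} {α γ : ℝ} {M : ℕ} {τ : ℝ}

theorem selectProc_selects_iff (hα : 0 ≤ α) (σ : Fin n ≃ X) (i : Fin n) (chosen : Finset X) :
    (selectProc A δ k n α γ M τ).selects ((List.ofFn σ).take i) chosen (σ i) ↔
      ⌊2 * α * n⌋₊ ≤ i.val ∧ i.val < ⌊(2 * α + γ) * n⌋₊ ∧
      (estimate A δ k α σ / ENNReal.ofReal (k * τ) < setDist (σ i) (refSet A δ k α σ) ∨
        ((block σ ⌊2 * α * n⌋₊ i).filter (fun y =>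
          nearest (refSet A δ k α σ) y = nearest (refSet A δ k α σ) (σ i))).card < M ∨
        ¬ ∃ y ∈ chosen, nearest (refSet A δ k α σ) y = nearest (refSet A δ k α σ) (σ i) ∧
          setDist y (refSet A δ k α σ) ≤ estimate A δ k α σ / ENNReal.ofReal (k * τ)) := by
  have hl : ((List.ofFn σ).take i).length = i.val := by simp
  unfold selectProc
  simp only [hl]
  refine and_congr_right fun hi => and_congr_right fun _ => ?_
  rw [refClustering_take A δ k hα σ hi, psi_take A δ k hα σ hi, toFinset_drop_take]

/-- What is known about a point of the third phase that is not selected. -/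
theorem selectProc_not_mem_run (hα : 0 ≤ α) (σ : Fin n ≃ X) {i : Fin n}
    (hi : ⌊2 * α * n⌋₊ ≤ i.val) (hi' : i.val < ⌊(2 * α + γ) * n⌋₊)
    (hn : σ i ∉ (selectProc A δ k n α γ M τ).run (List.ofFn σ)) :
    setDist (σ i) (refSet A δ k α σ) ≤ estimate A δ k α σ / ENNReal.ofReal (k * τ) ∧
    M ≤ ((block σ ⌊2 * α * n⌋₊ i).filter (fun y =>
          nearest (refSet A δ k α σ) y = nearest (refSet A δ k α σ) (σ i))).card ∧
    ∃ y ∈ (selectProc A δ k n α γ M τ).run (List.ofFn σ),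
      nearest (refSet A δ k α σ) y = nearest (refSet A δ k α σ) (σ i) ∧
          setDist y (refSet A δ k α σ) ≤ estimate A δ k α σ / ENNReal.ofReal (k * τ) := by
  set S := selectProc A δ k n α γ M τ with hS
  have h1 : ¬ S.selects ((List.ofFn σ).take i) (S.run ((List.ofFn σ).take i)) (σ i) := by
    intro h
    exact hn ((S.mem_run_iff σ _).2 ⟨i, rfl, h⟩)
  rw [hS, selectProc_selects_iff hα, ← hS] at h1
  push Not at h1
  obtain ⟨h2, h3, y, hy, h4⟩ := h1 hi hi'
  refine ⟨h2, h3, y, ?_, h4⟩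
  obtain ⟨j, -, h5⟩ := (S.mem_run_take_iff σ _ y).1 hy
  exact (S.mem_run_iff σ y).2 ⟨j, h5⟩

/-- A copy selects few points besides those beyond the threshold: for each closest center, which may
also be `⊤` if there is none, at most `M` points by the second rule and one by the third. -/
theorem card_selectProc_run_le (hα : 0 ≤ α) (σ : Fin n ≃ X) :
    ((selectProc A δ k n α γ M τ).run (List.ofFn σ)).card ≤
      ((block σ ⌊2 * α * n⌋₊ ⌊(2 * α + γ) * n⌋₊).filter (fun x =>
        estimate A δ k α σ / ENNReal.ofReal (k * τ) < setDist x (refSet A δ k α σ))).card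
      + (M + 1) * ((refSet A δ k α σ).card + 1) := by
  classical
  set S := selectProc A δ k n α γ M τ with hS
  set T := refSet A δ k α σ with hT
  set θ := estimate A δ k α σ / ENNReal.ofReal (k * τ) with hθ
  set R := S.run (List.ofFn σ) with hR
  set P := block σ ⌊2 * α * n⌋₊ ⌊(2 * α + γ) * n⌋₊ with hP
  set R₁ := P.filter (fun x => θ < setDist x T) with hR₁
  set R₂ := P.filter (fun x => ((block σ ⌊2 * α * n⌋₊ (σ.symm x)).filter (fun y =>
          nearest T y = nearest T x)).card < M) with hR₂
  set R₃ := R.filter (fun x => setDist x T ≤ θ ∧ ¬ ∃ y ∈ S.run ((List.ofFn σ).take (σ.symm x)),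
      nearest T y = nearest T x ∧ setDist y T ≤ θ) with hR₃
  have hsub : R ⊆ (R₁ ∪ R₂) ∪ R₃ := by
    intro x hx
    obtain ⟨i, rfl, hsel⟩ := (S.mem_run_iff σ x).1 hx
    rw [hS, selectProc_selects_iff hα, ← hS, ← hT, ← hθ] at hsel
    obtain ⟨h1, h2, h3⟩ := hsel
    have hiP : σ i ∈ P := apply_mem_block.2 ⟨h1, h2⟩
    by_cases h4 : θ < setDist (σ i) T
    · exact mem_union_left _ (mem_union_left _ (mem_filter.2 ⟨hiP, h4⟩))
    rcases h3 with h3 | h3 | h3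
    · exact absurd h3 h4
    · refine mem_union_left _ (mem_union_right _ (mem_filter.2 ⟨hiP, ?_⟩))
      rwa [Equiv.symm_apply_apply]
    · refine mem_union_right _ (mem_filter.2 ⟨hx, not_lt.1 h4, ?_⟩)
      rwa [Equiv.symm_apply_apply]
  have himg : ∀ U : Finset X, (U.image (nearest T)).card ≤ T.card + 1 := by
    intro U
    refine (card_le_card (t := insert ⊤ (T.map ⟨((↑) : X → WithTop X), WithTop.coe_injective⟩))
      fun v hv => ?_).trans ((card_insert_le _ _).trans (by rw [card_map]))
    obtain ⟨x, -, rfl⟩ := mem_image.1 hv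
    exact nearest_mem T x
  have hR₂c : R₂.card ≤ M * (T.card + 1) := by
    refine (card_le_mul_card_image (f := nearest T) R₂ M fun v _ => ?_).trans
      (Nat.mul_le_mul_left _ (himg _))
    have := card_filter_rank_lt (P.filter (fun x => nearest T x = v))
      (fun y x => σ.symm y < σ.symm x) (fun x => lt_irrefl _) (fun x y z => lt_trans)
      (fun x y h => lt_or_gt_of_ne (fun h' => h (σ.symm.injective h'))) M
    refine le_trans (card_le_card fun x hx => ?_) (this.trans_le (min_le_left _ _))
    simp only [hR₂, mem_filter] at hx ⊢
    refine ⟨⟨hx.1.1, hx.2⟩, lt_of_le_of_lt (card_le_card fun y hy => ?_) hx.1.2⟩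
    simp only [mem_filter] at hy ⊢
    refine ⟨mem_block.2 ⟨(mem_block.1 hy.1.1).1, hy.2⟩, hy.1.2.trans hx.2.symm⟩
  have hR₃c : R₃.card ≤ 1 * (T.card + 1) := by
    refine (card_le_mul_card_image (f := nearest T) R₃ 1 fun v _ => ?_).trans
      (Nat.mul_le_mul_left _ (himg _))
    have key : ∀ x ∈ R₃, ∀ y ∈ R₃, nearest T x = nearest T y → ¬ σ.symm x < σ.symm y := by
      intro x hx y hy hxy hlt
      rw [hR₃, mem_filter] at hx hy
      refine hy.2.2 ⟨x, ?_, hxy, hx.2.1⟩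
      obtain ⟨i, rfl, hsel⟩ := (S.mem_run_iff σ x).1 hx.1
      rw [Equiv.symm_apply_apply] at hlt
      exact (S.mem_run_take_iff σ _ _).2 ⟨i, hlt, rfl, hsel⟩
    rw [card_le_one]
    intro x hx y hy
    rw [mem_filter] at hx hy
    have hxy := hx.2.trans hy.2.symm
    by_contra hne
    rcases lt_or_gt_of_ne (fun h' => hne (σ.symm.injective h')) with h | h
    · exact key x hx.1 y hy.1 hxy h
    · exact key y hy.1 x hx.1 hxy.symm h
  calc R.card ≤ ((R₁ ∪ R₂) ∪ R₃).card := card_le_card hsub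
    _ ≤ (R₁.card + R₂.card) + R₃.card :=
        (card_union_le _ _).trans (Nat.add_le_add_right (card_union_le _ _) _)
    _ ≤ R₁.card + (M + 1) * (T.card + 1) := by nlinarith

theorem mem_munsc_run_iff {A : Finset X → ℕ → Finset X} {δ : ℝ} {k : ℕ} (σ : Fin n ≃ X) (x : X) :
    x ∈ (munsc A δ k n).run (List.ofFn σ) ↔
      ∃ i ≤ lastIndex δ k, x ∈ (copy A δ k n i).run (List.ofFn σ) := by
  simp only [OnlineSelector.mem_run_iff]
  constructor
  · rintro ⟨j, rfl, i, hi, h⟩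
    exact ⟨i, hi, j, rfl, h⟩
  · rintro ⟨i, hi, j, rfl, h⟩
    exact ⟨j, rfl, i, hi, h⟩

end Stream

/-! ### Clusters -/

section Clusters

variable {X : Type*} [Fintype X] [LinearOrder X]

/-- The cluster of the center `o` for an assignment `g` of the points to centers. -/
def cluster (g : X → X) (o : X) : Finset X := univ.filter (fun x => g x = o)

open Classical in
/-- The union of the clusters that have at least `φ` points. -/
noncomputable def largePart (g : X → X) (φ : ℝ) : Finset X :=
  univ.filter (fun x => φ ≤ ((cluster g (g x)).card : ℝ))

theorem mem_cluster {g : X → X} {o x : X} : x ∈ cluster g o ↔ g x = o := by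
  simp [cluster]

theorem mem_largePart {g : X → X} {φ : ℝ} {x : X} :
    x ∈ largePart g φ ↔ φ ≤ ((cluster g (g x)).card : ℝ) := by
  simp [largePart]

theorem card_compl_largePart_le {g : X → X} {O : Finset X} (hg : ∀ x, g x ∈ O) {φ : ℝ}
    (hφ : 0 ≤ φ) {k : ℕ} (hk : O.card ≤ k) : (((largePart g φ)ᶜ).card : ℝ) ≤ k * φ := by
  have h1 : ((largePart g φ)ᶜ).card = ∑ o ∈ O, (((largePart g φ)ᶜ).filter (g · = o)).card :=
    card_eq_sum_card_fiberwise fun x _ => hg x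
  rw [h1]
  push_cast
  calc ∑ o ∈ O, ((((largePart g φ)ᶜ).filter (g · = o)).card : ℝ) ≤ ∑ o ∈ O, φ := by
        refine sum_le_sum fun o _ => ?_
        rcases (((largePart g φ)ᶜ).filter (g · = o)).eq_empty_or_nonempty with h | ⟨x, hx⟩
        · rw [h]; simpa using hφ
        · rw [mem_filter, mem_compl, mem_largePart, not_le] at hx
          rw [hx.2] at hx
          refine le_trans ?_ hx.1.le
          norm_cast
          refine card_le_card fun y hy => ?_
          rw [mem_filter] at hy
          exact mem_cluster.2 hy.2
    _ ≤ k * φ := by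
        rw [sum_const, nsmul_eq_mul]; gcongr

variable [MetricSpace X]

/-- If `P` contains a fraction `1 / κ` of every large cluster of `O`, then the risk of `T` on the
large clusters is controlled by its risk on `P`. -/
theorem risk_largePart_le {g : X → X} {O : Finset X}
    (hg : ∀ x, g x ∈ O ∧ setDist x O = edist x (g x)) {φ : ℝ} (P T : Finset X) {κ : ENNReal}
    (hκ : ∀ o ∈ O, φ ≤ ((cluster g o).card : ℝ) →
      ((cluster g o).card : ENNReal) ≤ κ * (P ∩ cluster g o).card) :
    risk (largePart g φ) T ≤ risk univ O + κ * (risk P O + risk (P ∩ largePart g φ) T) := by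
  classical
  set Λ := largePart g φ with hΛ
  set O' := O.filter (fun o => φ ≤ ((cluster g o).card : ℝ)) with hO'
  have hmaps : ∀ x ∈ Λ, g x ∈ O' := fun x hx =>
    mem_filter.2 ⟨(hg x).1, mem_largePart.1 hx⟩
  have hfib : ∀ o ∈ O', Λ.filter (g · = o) = cluster g o := by
    intro o ho
    ext x
    rw [mem_filter, mem_cluster, mem_largePart]
    constructor
    · exact fun h => h.2
    · rintro rfl; exact ⟨(mem_filter.1 ho).2, rfl⟩
  have hfib' : ∀ o ∈ O', (P ∩ Λ).filter (g · = o) = P ∩ cluster g o := by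
    intro o ho
    rw [← hfib o ho]
    ext x; simp only [mem_inter, mem_filter]; tauto
  have e1 : risk Λ T = ∑ o ∈ O', risk (cluster g o) T := by
    unfold risk
    rw [← sum_fiberwise_of_maps_to hmaps]
    exact sum_congr rfl fun o ho => by rw [hfib o ho]
  have e2 : ∀ f : X → ENNReal, ∑ o ∈ O', ∑ x ∈ P ∩ cluster g o, f x = ∑ x ∈ P ∩ Λ, f x := by
    intro f
    rw [← sum_fiberwise_of_maps_to (fun x hx => hmaps x (mem_inter.1 hx).2)]
    exact sum_congr rfl fun o ho => by rw [hfib' o ho]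
  have e3 : ∑ o ∈ O', ∑ x ∈ cluster g o, edist x o ≤ risk univ O := by
    have : ∑ o ∈ O', ∑ x ∈ cluster g o, edist x o = ∑ x ∈ Λ, setDist x O := by
      rw [← sum_fiberwise_of_maps_to hmaps]
      refine sum_congr rfl fun o ho => ?_
      rw [hfib o ho]
      refine sum_congr rfl fun x hx => ?_
      rw [(hg x).2, mem_cluster.1 hx]
    rw [this]
    exact risk_mono_left (subset_univ _)
  calc risk Λ T = ∑ o ∈ O', risk (cluster g o) T := e1
    _ ≤ ∑ o ∈ O', (∑ x ∈ cluster g o, edist x o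
          + κ * ∑ x ∈ P ∩ cluster g o, (setDist x O + setDist x T)) := by
        refine sum_le_sum fun o ho => ?_
        have := risk_cluster_le (cluster g o) (P ∩ cluster g o) T o
          (hκ o (mem_filter.1 ho).1 (mem_filter.1 ho).2)
        refine this.trans (le_of_eq ?_)
        congr 2
        refine sum_congr rfl fun x hx => ?_
        rw [(hg x).2, mem_cluster.1 (mem_inter.1 hx).2]
    _ = ∑ o ∈ O', ∑ x ∈ cluster g o, edist x o
          + κ * (∑ x ∈ P ∩ Λ, setDist x O + ∑ x ∈ P ∩ Λ, setDist x T) := by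
        rw [sum_add_distrib, ← mul_sum, e2, sum_add_distrib]
    _ ≤ risk univ O + κ * (risk P O + risk (P ∩ Λ) T) := by
        exact add_le_add e3 (mul_le_mul_right (add_le_add
          (risk_mono_left inter_subset_left) le_rfl) _)

end Clusters

section Offline

variable {X : Type*} [MetricSpace X]

theorem exists_isOptimal (S : Finset X) (k : ℕ) : ∃ O, IsOptimal S k O := by
  classical
  obtain ⟨O, hO, hmin⟩ := exists_min_image (S.powerset.filter (fun T => T.card ≤ k))
    (fun T => risk S T) ⟨∅, by simp⟩
  rw [mem_filter, mem_powerset] at hO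
  exact ⟨O, hO.1, hO.2, fun T hT hk => hmin T (by rw [mem_filter, mem_powerset]; exact ⟨hT, hk⟩)⟩

/-- The risk of the offline solution on a sample `P`: with `j` additional centers it can afford to
serve `j` outliers `F` for free, and the centers `O` can be moved into the sample at the price of a
factor of `2`. -/
theorem risk_offline_le [LinearOrder X] {A : Finset X → ℕ → Finset X} {β : ℝ}
    (hA : IsOfflineApprox A β)
    {O : Finset X} {k j : ℕ} (hk2 : 2 ≤ k) (hk : O.card ≤ k) {g : X → X}
    (hg : ∀ x, g x ∈ O ∧ setDist x O = edist x (g x)) {P F : Finset X} (hF : (P ∩ F).card ≤ j) :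
    risk P (A P (k + j)) ≤ ENNReal.ofReal β * (2 * risk (P \ F) O) := by
  classical
  obtain ⟨O', hO'⟩ := exists_isOptimal P (k + j)
  refine ((hA P (k + j) (by omega)).2.2 O' hO').trans ?_
  gcongr
  have hs : ∀ o : X, ∃ s : X, (∃ x ∈ P \ F, g x = o) →
      s ∈ P \ F ∧ ∀ x ∈ P \ F, g x = o → edist s o ≤ edist x o := by
    intro o
    by_cases h : ∃ x ∈ P \ F, g x = o
    · obtain ⟨x, hx, hxo⟩ := h
      obtain ⟨s, hs, hmin⟩ := exists_min_image ((P \ F).filter (g · = o)) (fun x => edist x o)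
        ⟨x, mem_filter.2 ⟨hx, hxo⟩⟩
      exact ⟨s, fun _ => ⟨(mem_filter.1 hs).1, fun y hy hyo => hmin y (mem_filter.2 ⟨hy, hyo⟩)⟩⟩
    · exact ⟨o, fun h' => absurd h' h⟩
  choose s hs using hs
  set S := (P ∩ F) ∪ ((P \ F).image g).image s with hS
  have hSP : S ⊆ P := by
    intro y hy
    rcases mem_union.1 hy with h | h
    · exact (mem_inter.1 h).1
    · obtain ⟨o, ho, rfl⟩ := mem_image.1 h
      obtain ⟨x, hx, rfl⟩ := mem_image.1 ho
      exact (mem_sdiff.1 (hs (g x) ⟨x, hx, rfl⟩).1).1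
  have hSc : S.card ≤ k + j := by
    have h1 : (((P \ F).image g).image s).card ≤ O.card :=
      card_image_le.trans (card_le_card (image_subset_iff.2 fun x _ => (hg x).1))
    have := card_union_le (P ∩ F) (((P \ F).image g).image s)
    rw [hS]
    omega
  refine (hO'.2.2 S hSP hSc).trans ?_
  have hsplit : risk P S = risk (P \ F) S + risk (P ∩ F) S := by
    unfold risk
    rw [← sum_union (disjoint_sdiff_inter P F), sdiff_union_inter]
  have hzero : risk (P ∩ F) S = 0 :=
    sum_eq_zero fun x hx => setDist_eq_zero_of_mem (mem_union_left _ hx)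
  rw [hsplit, hzero, add_zero]
  unfold risk
  rw [mul_sum]
  refine sum_le_sum fun x hx => ?_
  have hsx := hs (g x) ⟨x, hx, rfl⟩
  have hmem : s (g x) ∈ S :=
    mem_union_right _ (mem_image_of_mem _ (mem_image_of_mem _ hx))
  calc setDist x S ≤ edist x (s (g x)) := setDist_le hmem
    _ ≤ edist x (g x) + edist (g x) (s (g x)) := edist_triangle _ _ _
    _ ≤ edist x (g x) + edist x (g x) := by
        rw [edist_comm (g x)]
        gcongr
        exact hsx.2 x hx rfl
    _ = 2 * setDist x O := by rw [(hg x).2, two_mul]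

end Offline

section GoodPoints

variable {X : Type*} [MetricSpace X] [LinearOrder X]

open Classical in
/-- The points of `Q` whose distance from `T` is at most three times the average distance of the
points of `H` from `T`. -/
noncomputable def nearAverage (Q H T : Finset X) : Finset X :=
  Q.filter (fun x => (H.card : ENNReal) * setDist x T ≤ 3 * risk H T)

/-- Markov's inequality: at most a third of the points are further than three times the average. -/
theorem three_mul_card_sdiff_nearAverage_le {Q H : Finset X} (T : Finset X) (hHQ : H ⊆ Q)
    (hfin : risk H T ≠ ⊤) : 3 * (H \ nearAverage Q H T).card ≤ H.card := by
  classical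
  set D := H \ nearAverage Q H T with hD
  have hD' : ∀ x ∈ D, 3 * risk H T < (H.card : ENNReal) * setDist x T := by
    intro x hx
    rw [hD, mem_sdiff, nearAverage, mem_filter] at hx
    by_contra! h
    exact hx.2 ⟨hHQ hx.1, h⟩
  have h1 : (D.card : ENNReal) * (3 * risk H T) ≤ H.card * risk H T := by
    calc (D.card : ENNReal) * (3 * risk H T) ≤ ∑ x ∈ D, (H.card : ENNReal) * setDist x T := by
          rw [← nsmul_eq_mul]
          exact card_nsmul_le_sum _ _ _ fun x hx => (hD' x hx).le
      _ ≤ H.card * risk H T := by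
          rw [← mul_sum]
          gcongr
          exact sum_le_sum_of_subset sdiff_subset
  rcases D.eq_empty_or_nonempty with h | ⟨x, hx⟩
  · rw [h]; simp
  have hpos : risk H T ≠ 0 := by
    intro h0
    have h2 := hD' x hx
    have h3 : setDist x T ≤ risk H T :=
      single_le_sum (f := fun x => setDist x T) (fun _ _ => zero_le) (mem_sdiff.1 hx).1
    rw [h0] at h2 h3
    rw [le_antisymm h3 zero_le] at h2
    simp at h2
  have h4 : ((3 * D.card : ℕ) : ENNReal) * risk H T ≤ (H.card : ℕ) * risk H T := by
    refine le_trans (le_of_eq ?_) h1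
    push_cast; ring
  have h5 := (ENNReal.mul_le_mul_iff_left hpos hfin).1 h4
  exact_mod_cast h5

/-- The cost of the unselected points of a region `P` that belong to `Λ`. The region is divided
according to the closest center in `T`, and `M` points of a part are known to be selected if a
point of it is not. In a part in which most points are close, one of the selected points is close,
and in all other parts the points outside `Λ` are at least a third of those in `Λ`. -/
theorem risk_unselected_le {P Λ T R : Finset X} {θ : ENNReal} (hT : T.Nonempty)
    (hfin : risk Λ T ≠ ⊤)
    (hsel : ∀ x ∈ P, x ∉ R → ∃ y ∈ R, nearest T y = nearest T x ∧ setDist y T ≤ θ)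
    (hθ : ∀ x ∈ P, x ∉ R → setDist x T ≤ θ)
    (hgood : ∀ c ∈ T, ∀ Q, Q = P.filter (fun x => nearest T x = (c : WithTop X)) → ¬ Q ⊆ R →
      Q.card ≤ 2 * (Q ∩ nearAverage Q (Q ∩ Λ) T).card →
      ∃ y ∈ R, y ∈ nearAverage Q (Q ∩ Λ) T) :
    risk (P ∩ Λ) R ≤ 4 * risk Λ T + 6 * (((P \ Λ).card : ENNReal) * θ) := by
  classical
  have hν : ∀ x, ∃ c ∈ T, nearest T x = (c : WithTop X) := fun x => by
    obtain ⟨c, hc, h, -⟩ := exists_nearest_eq x hT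
    exact ⟨c, hc, h⟩
  choose ν hνT hν using hν
  have hνc : ∀ (x c : X), nearest T x = (c : WithTop X) ↔ ν x = c := by
    intro x c; rw [hν x]; exact WithTop.coe_inj
  set Q : X → Finset X := fun c => P.filter (fun x => nearest T x = (c : WithTop X)) with hQ
  have hpart : ∀ c ∈ T, risk (Q c ∩ Λ) R
      ≤ 4 * risk (Q c ∩ Λ) T + 6 * (((Q c \ Λ).card : ENNReal) * θ) := by
    intro c hc
    have hrisk : risk (Q c ∩ Λ) R = risk ((Q c ∩ Λ) \ R) R := by
      unfold risk
      rw [← sum_sdiff (inter_subset_left : (Q c ∩ Λ) ∩ R ⊆ Q c ∩ Λ), sdiff_inter_self_left]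
      rw [sum_eq_zero (s := (Q c ∩ Λ) ∩ R), add_zero]
      exact fun x hx => setDist_eq_zero_of_mem (mem_inter.1 hx).2
    by_cases hQR : Q c ⊆ R
    · rw [hrisk, sdiff_eq_empty_iff_subset.2 (inter_subset_left.trans hQR)]
      simp [risk]
    by_cases hhalf : (Q c).card ≤ 2 * (Q c ∩ nearAverage (Q c) (Q c ∩ Λ) T).card
    · obtain ⟨y, hyR, hy⟩ := hgood c hc (Q c) rfl hQR hhalf
      rw [nearAverage, mem_filter] at hy
      have h1 : ∀ x ∈ Q c ∩ Λ, setDist x R ≤ setDist x T + setDist y T := by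
        intro x hx
        refine (setDist_le hyR).trans (edist_le_of_nearest_eq ?_)
        rw [(mem_filter.1 (mem_inter.1 hx).1).2, (mem_filter.1 hy.1).2]
      calc risk (Q c ∩ Λ) R ≤ ∑ x ∈ Q c ∩ Λ, (setDist x T + setDist y T) := sum_le_sum h1
        _ = risk (Q c ∩ Λ) T + (Q c ∩ Λ).card * setDist y T := by
            rw [sum_add_distrib, sum_const, nsmul_eq_mul]; rfl
        _ ≤ risk (Q c ∩ Λ) T + 3 * risk (Q c ∩ Λ) T := add_le_add le_rfl hy.2
        _ = 4 * risk (Q c ∩ Λ) T := by ring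
        _ ≤ _ := le_self_add
    · have hm := three_mul_card_sdiff_nearAverage_le T
        (inter_subset_left : Q c ∩ Λ ⊆ Q c)
        (ne_top_of_le_ne_top hfin (risk_mono_left inter_subset_right))
      have h2 : ((Q c ∩ Λ) \ nearAverage (Q c) (Q c ∩ Λ) T).card
          + ((Q c ∩ Λ) ∩ nearAverage (Q c) (Q c ∩ Λ) T).card = (Q c ∩ Λ).card :=
        card_sdiff_add_card_inter _ _
      have h3 : ((Q c ∩ Λ) ∩ nearAverage (Q c) (Q c ∩ Λ) T).card
          ≤ (Q c ∩ nearAverage (Q c) (Q c ∩ Λ) T).card :=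
        card_le_card (inter_subset_inter_right inter_subset_left)
      have h4 : (Q c \ Λ).card + (Q c ∩ Λ).card = (Q c).card := card_sdiff_add_card_inter _ _
      have h5 : (Q c ∩ Λ).card ≤ 3 * (Q c \ Λ).card := by omega
      have h6 : ∀ x ∈ (Q c ∩ Λ) \ R, setDist x R ≤ 2 * θ := by
        intro x hx
        rw [mem_sdiff, mem_inter] at hx
        have hxP := (mem_filter.1 hx.1.1).1
        obtain ⟨y, hyR, hy, hyθ⟩ := hsel x hxP hx.2
        calc setDist x R ≤ edist x y := setDist_le hyR
          _ ≤ setDist x T + setDist y T := edist_le_of_nearest_eq hy.symm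
          _ ≤ θ + θ := add_le_add (hθ x hxP hx.2) hyθ
          _ = 2 * θ := (two_mul θ).symm
      calc risk (Q c ∩ Λ) R = risk ((Q c ∩ Λ) \ R) R := hrisk
        _ ≤ ((Q c ∩ Λ) \ R).card * (2 * θ) := by
            rw [← nsmul_eq_mul]; exact sum_le_card_nsmul _ _ _ h6
        _ ≤ ((3 * (Q c \ Λ).card : ℕ) : ENNReal) * (2 * θ) := by
            gcongr
            exact (card_le_card sdiff_subset).trans h5
        _ = 6 * (((Q c \ Λ).card : ENNReal) * θ) := by push_cast; ring
        _ ≤ _ := le_add_self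
  have hfibre : ∀ (Z : Finset X), Z ⊆ P → ∀ f : X → ENNReal,
      ∑ x ∈ Z, f x = ∑ c ∈ T, ∑ x ∈ Z.filter (fun x => nearest T x = (c : WithTop X)), f x := by
    intro Z _ f
    rw [← sum_fiberwise_of_maps_to (g := ν) (fun x _ => hνT x)]
    refine sum_congr rfl fun c _ => sum_congr ?_ fun _ _ => rfl
    ext x; simp only [mem_filter, hνc]
  have e1 : risk (P ∩ Λ) R = ∑ c ∈ T, risk (Q c ∩ Λ) R := by
    unfold risk
    rw [hfibre _ inter_subset_left]
    refine sum_congr rfl fun c _ => sum_congr ?_ fun _ _ => rfl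
    rw [hQ]; simp only [filter_inter]
  have e2 : risk (P ∩ Λ) T = ∑ c ∈ T, risk (Q c ∩ Λ) T := by
    unfold risk
    rw [hfibre _ inter_subset_left]
    refine sum_congr rfl fun c _ => sum_congr ?_ fun _ _ => rfl
    rw [hQ]; simp only [filter_inter]
  have e3 : ((P \ Λ).card : ENNReal) = ∑ c ∈ T, ((Q c \ Λ).card : ENNReal) := by
    have := hfibre (P \ Λ) sdiff_subset (fun _ => 1)
    simp only [sum_const, nsmul_eq_mul, mul_one] at this
    rw [this]
    refine sum_congr rfl fun c _ => ?_
    congr 2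
    ext x; simp only [hQ, mem_filter, mem_sdiff]; tauto
  calc risk (P ∩ Λ) R = ∑ c ∈ T, risk (Q c ∩ Λ) R := e1
    _ ≤ ∑ c ∈ T, (4 * risk (Q c ∩ Λ) T + 6 * (((Q c \ Λ).card : ENNReal) * θ)) :=
        sum_le_sum hpart
    _ = 4 * risk (P ∩ Λ) T + 6 * (((P \ Λ).card : ENNReal) * θ) := by
        rw [sum_add_distrib, ← mul_sum, ← mul_sum, ← sum_mul, e2, e3]
    _ ≤ _ := by
        gcongr
        exact risk_mono_left inter_subset_right

end GoodPoints

/-! ### The reference clustering and the risk estimate -/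

section Events

variable {X : Type*} [Fintype X] {n : ℕ}

theorem orderProb_le_of_card_upper_tail {a b c : ℕ} (hab : a ≤ b) (hbc : b ≤ c) (hc : c ≤ n)
    {E : (Fin n ≃ X) → Prop} {B : ℝ} [DecidableEq X]
    (H : ∀ σ₀ : Fin n ≃ X, ∃ (N : Finset X) (Y : ℝ),
      ((c : ℝ) - b) / ((n : ℝ) - a) * N.card - Y * Real.log 2 ≤ -B ∧
      ∀ σ : Fin n ≃ X, (∀ i : Fin n, i.val < a → σ i = σ₀ i) → E σ →
        Y ≤ (block σ b c ∩ N).card) :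
    orderProb n E ≤ Real.exp (-B) := by
  refine orderProb_le_of_upper_tail hab hbc hc fun σ₀ => ?_
  obtain ⟨N, Y, hB, hE⟩ := H σ₀
  refine ⟨fun x => if x ∈ N then 1 else 0, Y,
    fun x => by dsimp only; split_ifs <;> norm_num, ?_, ?_⟩
  · simpa using hB
  · intro σ hσ hEσ
    have := hE σ hσ hEσ
    simpa [sum_ite_mem] using this

theorem block_eq_compl [DecidableEq X] (σ : Fin n ≃ X) (a : ℕ) :
    block σ a n = (block σ 0 a)ᶜ := by
  ext x
  have := (σ.symm x).2
  rw [mem_compl, mem_block, mem_block]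
  omega

theorem four_le_log {k : ℕ} {δ : ℝ} (hk : 2 ≤ k) (hδ : 0 < δ) (hδ1 : δ < 1) :
    4 ≤ Real.log (32 * k / δ) := by
  have h1 : (2 : ℝ) ≤ k := by exact_mod_cast hk
  have h2 : (64 : ℝ) ≤ 32 * k / δ := by
    rw [le_div_iff₀ hδ]; nlinarith
  have h3 := Real.log_le_log (by norm_num) h2
  have h4 : Real.log 64 = 6 * Real.log 2 := by
    rw [show (64 : ℝ) = 2 ^ 6 by norm_num, Real.log_pow]; norm_num
  have := Real.log_two_gt_d9
  linarith

theorem mul_phi {k : ℕ} {δ α : ℝ} (hα : 0 < α) :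
    α * phi k δ α = 150 * Real.log (32 * k / δ) := by
  unfold phi; field_simp

theorem phi_pos {k : ℕ} {δ α : ℝ} (hα : 0 < α) (hk : 2 ≤ k) (hδ : 0 < δ) (hδ1 : δ < 1) :
    0 < phi k δ α := by
  have := four_le_log hk hδ hδ1
  unfold phi; positivity

theorem floor_le_mul {α : ℝ} (hα : 0 < α) (n : ℕ) : (⌊α * n⌋₊ : ℝ) ≤ α * n :=
  Nat.floor_le (by positivity)

theorem floor_mul_le {α : ℝ} (hα1 : α ≤ 1) (n : ℕ) : ⌊α * n⌋₊ ≤ n := by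
  refine Nat.floor_le_of_le ?_
  nlinarith [Nat.cast_nonneg (α := ℝ) n]

theorem floor_mul_le_floor_mul {α γ : ℝ} (h : α ≤ γ) (n : ℕ) : ⌊α * n⌋₊ ≤ ⌊γ * n⌋₊ :=
  Nat.floor_le_floor (mul_le_mul_of_nonneg_right h (Nat.cast_nonneg n))

section Outliers

variable [LinearOrder X] {k : ℕ} {δ α : ℝ}

/-- The first phase contains at most `38 log (32 k / δ)` points of a set of
`19 log (32 k / δ) / α` outliers. -/
theorem orderProb_outliers_le (hk : 2 ≤ k) (hδ : 0 < δ) (hδ1 : δ < 1) (hα : 0 < α)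
    (hα6 : α ≤ 1 / 6) {F : Finset X} (hF : α * F.card ≤ 19 * Real.log (32 * k / δ)) :
    orderProb n (fun σ => ⌊38 * Real.log (32 * k / δ)⌋₊ < (block σ 0 ⌊α * n⌋₊ ∩ F).card)
      ≤ Real.exp (-Real.log (32 * k / δ)) := by
  have hL := four_le_log hk hδ hδ1
  set L := Real.log (32 * k / δ)
  refine orderProb_le_of_card_upper_tail (a := 0) le_rfl (Nat.zero_le _)
    (floor_mul_le (α := α) (by linarith) n) fun σ₀ => ⟨F, 38 * L, ?_, fun σ _ h => ?_⟩
  · have hp : ((⌊α * n⌋₊ : ℝ) - (0 : ℕ)) / ((n : ℝ) - (0 : ℕ)) ≤ α := by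
      simp only [Nat.cast_zero, sub_zero]
      exact div_le_of_le_mul₀ (by positivity) hα.le (floor_le_mul hα n)
    have h1 := mul_le_mul_of_nonneg_right hp (Nat.cast_nonneg (α := ℝ) F.card)
    have := Real.log_two_gt_d9
    nlinarith
  · exact (Nat.lt_of_floor_lt h).le

/-- The first phase contains a proportional part of a large cluster, outliers excluded. -/
theorem orderProb_cluster_sample_le (hn : Fintype.card X = n) (hk : 2 ≤ k) (hδ : 0 < δ)
    (hδ1 : δ < 1) (hα : 0 < α) (hα6 : α ≤ 1 / 6) {F C : Finset X}
    (hF : α * F.card ≤ 19 * Real.log (32 * k / δ)) (hC : phi k δ α ≤ C.card) :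
    orderProb n (fun σ => ENNReal.ofReal (5 / α) * ((block σ 0 ⌊α * n⌋₊ \ F) ∩ C).card < C.card)
      ≤ Real.exp (-Real.log (32 * k / δ)) := by
  have hL := four_le_log hk hδ hδ1
  have hφ := mul_phi (k := k) (δ := δ) hα
  set L := Real.log (32 * k / δ)
  have hCn : (C.card : ℝ) ≤ n := by rw [← hn]; exact_mod_cast card_le_univ C
  have hαC : 150 * L ≤ α * C.card := by rw [← hφ]; gcongr
  have hαn : 150 * L ≤ α * n := hαC.trans (by gcongr)
  have hn0 : (0 : ℝ) < n := by
    by_contra! h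
    nlinarith
  have hp : 0.99 * α ≤ ((⌊α * n⌋₊ : ℝ) - (0 : ℕ)) / ((n : ℝ) - (0 : ℕ)) := by
    simp only [Nat.cast_zero, sub_zero]
    rw [le_div_iff₀ hn0]
    have : α * n < ⌊α * n⌋₊ + 1 := Nat.lt_floor_add_one _
    nlinarith
  refine orderProb_le_of_lower_tail (a := 0) le_rfl (Nat.zero_le _)
    (floor_mul_le (α := α) (by linarith) n) fun σ₀ =>
      ⟨C \ F, α * C.card / 5, ?_, ?_, fun σ _ h => ?_⟩
  · rw [disjoint_left]; intro x _ hx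
    rw [mem_block] at hx; omega
  · have h1 : (C.card : ℝ) ≤ (C \ F).card + F.card := by
      have := le_card_sdiff F C
      have : C.card ≤ (C \ F).card + F.card := by omega
      exact_mod_cast this
    have h2 : α * C.card - 19 * L ≤ α * (C \ F).card := by nlinarith
    have h3 := mul_le_mul_of_nonneg_right hp (Nat.cast_nonneg (α := ℝ) (C \ F).card)
    have h4 := Real.log_two_lt_d9
    have h5 : α * C.card * Real.log 2 ≤ α * C.card * 0.7 := by gcongr; linarith
    nlinarith
  · have e : (block σ 0 ⌊α * n⌋₊ \ F) ∩ C = block σ 0 ⌊α * n⌋₊ ∩ (C \ F) := by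
      ext x; simp only [mem_inter, mem_sdiff]; tauto
    rw [e] at h
    set m := (block σ 0 ⌊α * n⌋₊ ∩ (C \ F)).card
    rw [← ENNReal.ofReal_natCast m, ← ENNReal.ofReal_mul (by positivity),
      ← ENNReal.ofReal_natCast, ENNReal.ofReal_lt_ofReal_iff_of_nonneg (by positivity)] at h
    rw [div_mul_eq_mul_div, div_lt_iff₀ hα] at h
    linarith

variable [MetricSpace X]

/-- Without the outliers, the risk of the sample is at most twice its expected value. -/
theorem orderProb_sample_risk_le (hk : 2 ≤ k) (hδ : 0 < δ) (hδ1 : δ < 1) (hα : 0 < α)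
    (hα6 : α ≤ 1 / 6) (O : Finset X) :
    orderProb n (fun σ => ENNReal.ofReal (2 * α) * risk univ O <
      risk (block σ 0 ⌊α * n⌋₊ \ far ⌊19 * Real.log (32 * k / δ) / α⌋₊ univ O) O)
      ≤ Real.exp (-Real.log (32 * k / δ)) := by
  have hL := four_le_log hk hδ hδ1
  set L := Real.log (32 * k / δ)
  set f := ⌊19 * L / α⌋₊ with hf
  set F := far f univ O with hF
  have hp : ((⌊α * n⌋₊ : ℝ) - (0 : ℕ)) / ((n : ℝ) - (0 : ℕ)) ≤ α := by
    simp only [Nat.cast_zero, sub_zero]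
    exact div_le_of_le_mul₀ (by positivity) hα.le (floor_le_mul hα n)
  have hp0 : 0 ≤ ((⌊α * n⌋₊ : ℝ) - (0 : ℕ)) / ((n : ℝ) - (0 : ℕ)) := by
    simp only [Nat.cast_zero, sub_zero]; positivity
  have hfα : 19 * L - α ≤ α * f := by
    have h1 : 19 * L / α < f + 1 := Nat.lt_floor_add_one _
    rw [div_lt_iff₀ hα] at h1
    linarith
  have h2 := Real.log_two_gt_d9
  obtain ⟨w, Y, hw, hB, hP⟩ := exists_truncated_weights (fun x => setDist x O)
    (S := univ) (F := F) (f := f) (subset_univ _)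
    (by
      rw [hF, card_far]
      rcases le_total f (univ : Finset X).card with h | h
      · exact Or.inl (min_eq_left h)
      · exact Or.inr (far_eq_of_card_le _ h))
    (fun x hx y hy => setDist_le_of_mem_far hx (mem_univ y) (mem_sdiff.1 hy).2)
    (κ := 2 * α) (B := L) hp0 (by positivity) (by
      have h3 : 0.38 * α ≤ 2 * α * Real.log 2 -
          ((⌊α * n⌋₊ : ℝ) - (0 : ℕ)) / ((n : ℝ) - (0 : ℕ)) := by
        nlinarith
      have h4 := mul_le_mul_of_nonneg_right h3 (Nat.cast_nonneg (α := ℝ) f)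
      linarith)
  refine orderProb_le_of_upper_tail (a := 0) le_rfl (Nat.zero_le _)
    (floor_mul_le (α := α) (by linarith) n) fun σ₀ => ⟨w, Y, hw, hB, fun σ _ h => hP _ ?_⟩
  have : block σ 0 ⌊α * n⌋₊ ∩ (univ \ F) = block σ 0 ⌊α * n⌋₊ \ F := by
    ext x; simp
  rw [this]
  exact h

variable {A : Finset X → ℕ → Finset X} {β : ℝ} {O : Finset X} {g : X → X}

/-- The reference clustering is a good clustering of all large clusters. -/
theorem orderProb_risk_largePart_le (hn : Fintype.card X = n) (hk : 2 ≤ k) (hδ : 0 < δ)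
    (hδ1 : δ < 1) (hα : 0 < α) (hα6 : α ≤ 1 / 6) (hβ : 1 ≤ β) (hA : IsOfflineApprox A β)
    (hO : O.card ≤ k) (hg : ∀ x, g x ∈ O ∧ setDist x O = edist x (g x)) :
    orderProb n (fun σ => ENNReal.ofReal (31 * β) * risk univ O <
      risk (largePart g (phi k δ α)) (refSet A δ k α σ))
      ≤ (k + 2) * Real.exp (-Real.log (32 * k / δ)) := by
  classical
  have hL := four_le_log hk hδ hδ1
  have hout := orderProb_sample_risk_le (n := n) hk hδ hδ1 hα hα6 O
  set F := far ⌊19 * Real.log (32 * k / δ) / α⌋₊ univ O with hF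
  have hFc : α * F.card ≤ 19 * Real.log (32 * k / δ) := by
    have h1 : (F.card : ℝ) ≤ 19 * Real.log (32 * k / δ) / α :=
      (Nat.cast_le.2 (card_far_le _ _ _)).trans (Nat.floor_le (by positivity))
    rw [le_div_iff₀ hα] at h1
    linarith
  have hE1 := orderProb_outliers_le (n := n) hk hδ hδ1 hα hα6 hFc
  set E3 : X → (Fin n ≃ X) → Prop := fun o σ => phi k δ α ≤ ((cluster g o).card : ℝ) ∧
    ENNReal.ofReal (5 / α) * ((block σ 0 ⌊α * n⌋₊ \ F) ∩ cluster g o).card < (cluster g o).card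
  have hE3 : ∀ o ∈ O, orderProb n (E3 o) ≤ Real.exp (-Real.log (32 * k / δ)) := by
    intro o _
    by_cases h : phi k δ α ≤ ((cluster g o).card : ℝ)
    · exact (orderProb_mono fun σ hσ => hσ.2).trans
        (orderProb_cluster_sample_le hn hk hδ hδ1 hα hα6 hFc h)
    · rw [orderProb_eq_zero fun σ hσ => h hσ.1]
      exact (Real.exp_pos _).le
  have hsum : ∑ o ∈ O, orderProb n (E3 o) ≤ k * Real.exp (-Real.log (32 * k / δ)) := by
    refine (sum_le_sum hE3).trans ?_
    rw [sum_const, nsmul_eq_mul]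
    gcongr
  refine (orderProb_mono (E' := fun σ =>
    (⌊38 * Real.log (32 * k / δ)⌋₊ < (block σ 0 ⌊α * n⌋₊ ∩ F).card) ∨
    (ENNReal.ofReal (2 * α) * risk univ O < risk (block σ 0 ⌊α * n⌋₊ \ F) O ∨
      ∃ o ∈ O, E3 o σ)) ?_).trans ?_
  · intro σ hσ
    by_contra! hcon
    obtain ⟨h1, h2, h3⟩ := hcon
    refine hσ.not_ge ?_
    set P := block σ 0 ⌊α * n⌋₊ with hP
    set T := refSet A δ k α σ with hT
    have hPT : risk P T ≤ ENNReal.ofReal β * (2 * risk (P \ F) O) :=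
      risk_offline_le hA hk hO hg h1
    have hκ : ∀ o ∈ O, phi k δ α ≤ ((cluster g o).card : ℝ) →
        ((cluster g o).card : ENNReal) ≤ ENNReal.ofReal (5 / α) * ((P \ F) ∩ cluster g o).card := by
      intro o ho h
      by_contra! h'
      exact h3 o ho ⟨h, h'⟩
    have hb : (0 : ℝ) ≤ β := by linarith
    calc risk (largePart g (phi k δ α)) T
        ≤ risk univ O + ENNReal.ofReal (5 / α) *
          (risk (P \ F) O + risk ((P \ F) ∩ largePart g (phi k δ α)) T) :=
          risk_largePart_le hg (P \ F) T hκ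
      _ ≤ risk univ O + ENNReal.ofReal (5 / α) *
          (ENNReal.ofReal (2 * α) * risk univ O +
            ENNReal.ofReal β * (2 * (ENNReal.ofReal (2 * α) * risk univ O))) := by
          gcongr
          refine (risk_mono_left (inter_subset_left.trans sdiff_subset)).trans (hPT.trans ?_)
          gcongr
      _ = ENNReal.ofReal (11 + 20 * β) * risk univ O := by
          have e2 : (2 : ENNReal) = ENNReal.ofReal 2 := by simp
          have e1 : ENNReal.ofReal (11 + 20 * β) = 1 + ENNReal.ofReal (5 / α) *
              (ENNReal.ofReal (2 * α) + ENNReal.ofReal β * (2 * ENNReal.ofReal (2 * α))) := by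
            rw [e2, ← ENNReal.ofReal_mul (by norm_num), ← ENNReal.ofReal_mul hb,
              ← ENNReal.ofReal_add (by positivity) (by positivity),
              ← ENNReal.ofReal_mul (by positivity), ← ENNReal.ofReal_one,
              ← ENNReal.ofReal_add (by norm_num) (by positivity)]
            congr 1
            field_simp
            ring
          rw [e1]; ring
      _ ≤ ENNReal.ofReal (31 * β) * risk univ O := by
          gcongr
          linarith
  · refine (orderProb_or_le _ _).trans ?_
    have h1 := (orderProb_or_le (n := n) (fun σ =>
      ENNReal.ofReal (2 * α) * risk univ O < risk (block σ 0 ⌊α * n⌋₊ \ F) O)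
      (fun σ => ∃ o ∈ O, E3 o σ))
    have h2 := orderProb_exists_le O E3
    linarith

/-- The risk estimate does not exceed the risk of the reference clustering on the large
clusters: the discarded points of the second phase include those of the small clusters and the
outliers of the large ones. -/
theorem orderProb_estimate_le (hk : 2 ≤ k) (hδ : 0 < δ)
    (hδ1 : δ < 1) (hα : 0 < α) (hα6 : α ≤ 1 / 6) (hO : O.card ≤ k) (hg : ∀ x, g x ∈ O) :
    orderProb n (fun σ => risk (largePart g (phi k δ α)) (refSet A δ k α σ) <
      estimate A δ k α σ) ≤ 2 * Real.exp (-Real.log (32 * k / δ)) := by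
  classical
  have hL := four_le_log hk hδ hδ1
  have hφ := mul_phi (k := k) (δ := δ) hα
  have hφ0 := phi_pos hα hk hδ hδ1
  set L := Real.log (32 * k / δ)
  set φ := phi k δ α with hφd
  set Λ := largePart g φ with hΛ
  set a := ⌊α * n⌋₊ with ha
  set b := ⌊2 * α * n⌋₊ with hb
  set r := numOutliers δ k α with hr
  set f := ⌊φ⌋₊ with hf
  have hk2 : (2 : ℝ) ≤ k := by exact_mod_cast hk
  have hab : a ≤ b := floor_mul_le_floor_mul (by linarith) n
  have hbn : b ≤ n := floor_mul_le (by linarith) n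
  by_cases hbr : b - a ≤ r
  · rw [orderProb_eq_zero]
    · positivity
    intro σ hσ
    refine absurd hσ (not_lt_of_ge ?_)
    unfold estimate
    rw [truncRisk_eq_zero]
    · simp
    · exact (card_block_le _ _ _).trans hbr
  push Not at hbr
  have hrφ : 2 * α * (k + 1) * φ < r + 1 := Nat.lt_floor_add_one _
  have hbig : 900 * L < b - a := by
    have h1 : ((r : ℝ) + 1) ≤ b - a := by
      rw [← Nat.cast_sub hab]; exact_mod_cast hbr
    have h2 : 2 * α * (k + 1) * φ = 300 * (k + 1) * L := by
      calc 2 * α * (k + 1) * φ = 2 * (k + 1) * (α * φ) := by ring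
        _ = _ := by rw [hφ]; ring
    nlinarith
  have ha1 : (a : ℝ) ≤ α * n := floor_le_mul hα n
  have ha2 : α * n < a + 1 := Nat.lt_floor_add_one _
  have hb1 : (b : ℝ) ≤ 2 * α * n := Nat.floor_le (by positivity)
  have hαn : 899 * L ≤ α * n := by linarith
  have hn0 : (0 : ℝ) < n := by
    by_contra! h
    nlinarith
  have hna : 5 / 6 * (n : ℝ) ≤ n - a := by nlinarith
  have hna0 : (0 : ℝ) < n - a := by linarith
  set p : ℝ := ((b : ℝ) - a) / ((n : ℝ) - a) with hp
  have hp0 : 0 ≤ p := div_nonneg (by linarith) hna0.le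
  have hp1 : p ≤ 1.25 * α := by
    rw [hp, div_le_iff₀ hna0]
    nlinarith
  have hlog := Real.log_two_gt_d9
  have hαφ : 0 < α * φ := by positivity
  set G : Finset X → Finset X := fun T => Λᶜ ∪ far f Λ T with hG
  have hGc : ∀ T, ((G T).card : ℝ) ≤ (k + 1) * φ := by
    intro T
    have h1 : ((G T).card : ℝ) ≤ (Λᶜ).card + (far f Λ T).card := by
      exact_mod_cast card_union_le _ _
    have h2 : ((Λᶜ).card : ℝ) ≤ k * φ := card_compl_largePart_le hg hφ0.le hO
    have h3 : ((far f Λ T).card : ℝ) ≤ φ :=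
      (Nat.cast_le.2 (card_far_le _ _ _)).trans (Nat.floor_le hφ0.le)
    linarith
  have hE4 : orderProb n (fun σ => r < (block σ a b ∩ G (refSet A δ k α σ)).card)
      ≤ Real.exp (-L) := by
    refine orderProb_le_of_card_upper_tail le_rfl hab hbn fun σ₀ =>
      ⟨G (refSet A δ k α σ₀), 2 * α * (k + 1) * φ, ?_, fun σ hσ h => ?_⟩
    · have h1 := mul_le_mul_of_nonneg_left (hGc (refSet A δ k α σ₀)) hp0
      have h2 : p * ((k + 1) * φ) ≤ 1.25 * α * ((k + 1) * φ) := by gcongr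
      have h3 : 2 * α * (k + 1) * φ * 0.69 ≤ 2 * α * (k + 1) * φ * Real.log 2 := by
        gcongr; linarith
      have h4 : α * ((k + 1) * φ) = (k + 1) * (150 * L) := by rw [← hφ]; ring
      nlinarith
    · rw [refSet_congr hσ] at h
      exact (Nat.lt_of_floor_lt h).le
  have hE5 : orderProb n (fun σ => ENNReal.ofReal (2 * α) * risk Λ (refSet A δ k α σ) <
      risk (block σ a b \ G (refSet A δ k α σ)) (refSet A δ k α σ)) ≤ Real.exp (-L) := by
    refine orderProb_le_of_upper_tail le_rfl hab hbn fun σ₀ => ?_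
    set T := refSet A δ k α σ₀ with hT
    obtain ⟨w, Y, hw, hB, hP⟩ := exists_truncated_weights (fun x => setDist x T)
      (S := Λ) (F := far f Λ T) (f := f) (far_subset _ _ _)
      (by
        rw [card_far]
        rcases le_total f Λ.card with h | h
        · exact Or.inl (min_eq_left h)
        · exact Or.inr (far_eq_of_card_le _ h))
      (fun x hx y hy => setDist_le_of_mem_far hx (mem_sdiff.1 hy).1 (mem_sdiff.1 hy).2)
      (κ := 2 * α) (B := L) hp0 (by positivity) (by
        have h3 : 0.1 * α ≤ 2 * α * Real.log 2 - p := by nlinarith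
        have h4 := mul_le_mul_of_nonneg_right h3 (Nat.cast_nonneg (α := ℝ) f)
        have h5 : φ < f + 1 := Nat.lt_floor_add_one _
        nlinarith)
    refine ⟨w, Y, hw, hB, fun σ hσ h => hP _ ?_⟩
    rw [refSet_congr hσ] at h
    have : block σ a b ∩ (Λ \ far f Λ T) = block σ a b \ G T := by
      ext x; simp only [hG, mem_inter, mem_sdiff, mem_union, mem_compl]; tauto
    rw [this]
    exact h
  refine (orderProb_mono (E' := fun σ => (r < (block σ a b ∩ G (refSet A δ k α σ)).card) ∨
    (ENNReal.ofReal (2 * α) * risk Λ (refSet A δ k α σ) <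
      risk (block σ a b \ G (refSet A δ k α σ)) (refSet A δ k α σ))) ?_).trans
    ((orderProb_or_le _ _).trans (by linarith))
  intro σ hσ
  by_contra! hcon
  refine hσ.not_ge ?_
  unfold estimate
  refine ENNReal.div_le_of_le_mul ?_
  refine (truncRisk_le _ hcon.1).trans (hcon.2.trans ?_)
  rw [mul_comm]
  gcongr
  linarith

end Outliers
end Events

/-! ### Points beyond the threshold, and the cells of the last copy -/

section Counts

variable {X : Type*} [Fintype X] [MetricSpace X] [LinearOrder X] {n k : ℕ} {δ α τ : ℝ}
  {A : Finset X → ℕ → Finset X}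

/-- The points between the end of the second phase and the position `b` whose distance from the
reference clustering exceeds the selection threshold `ψ / (k τ)`. -/
noncomputable def beyond (A : Finset X → ℕ → Finset X) (δ : ℝ) (k : ℕ) (α τ : ℝ) (b : ℕ)
    (σ : Fin n ≃ X) : Finset X :=
  (block σ ⌊2 * α * n⌋₊ b).filter (fun x =>
    estimate A δ k α σ / ENNReal.ofReal (k * τ) < setDist x (refSet A δ k α σ))

/-- The furthest points from the reference clustering among those that come after the first
phase. Their number is of the order of `k φ`. -/
noncomputable def furthest (A : Finset X → ℕ → Finset X) (δ : ℝ) (k : ℕ) (α : ℝ)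
    (σ : Fin n ≃ X) : Finset X :=
  far ⌈30 * (k * phi k δ α)⌉₊ (block σ 0 ⌊α * n⌋₊)ᶜ (refSet A δ k α σ)

theorem furthest_congr {σ σ' : Fin n ≃ X} (h : ∀ i : Fin n, i.val < ⌊α * n⌋₊ → σ i = σ' i) :
    furthest A δ k α σ = furthest A δ k α σ' := by
  unfold furthest
  rw [refSet_congr h, block_congr le_rfl h]

theorem card_furthest_le (hk : 2 ≤ k) (hδ : 0 < δ) (hδ1 : δ < 1) (hα : 0 < α) (hα6 : α ≤ 1 / 6)
    (σ : Fin n ≃ X) : ((furthest A δ k α σ).card : ℝ) ≤ 31 * (k * phi k δ α) := by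
  have hφ0 := phi_pos hα hk hδ hδ1
  have hL := four_le_log hk hδ hδ1
  have hφ := mul_phi (k := k) (δ := δ) hα
  have hk2 : (2 : ℝ) ≤ k := by exact_mod_cast hk
  have h1 : ((furthest A δ k α σ).card : ℝ) ≤ ⌈30 * (k * phi k δ α)⌉₊ :=
    Nat.cast_le.2 (card_far_le _ _ _)
  have h2 := Nat.ceil_lt_add_one (a := 30 * (k * phi k δ α)) (by positivity)
  have h3 : 1 ≤ phi k δ α := by nlinarith
  nlinarith

theorem card_furthest (hn : Fintype.card X = n) (hk : 2 ≤ k) (hδ : 0 < δ) (hδ1 : δ < 1)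
    (hα : 0 < α) (hα6 : α ≤ 1 / 6) (hbig : 40 * (k * phi k δ α) ≤ n) (σ : Fin n ≃ X) :
    30 * (k * phi k δ α) ≤ ((furthest A δ k α σ).card : ℝ) := by
  have hφ0 := phi_pos hα hk hδ hδ1
  have hL := four_le_log hk hδ hδ1
  have hφ := mul_phi (k := k) (δ := δ) hα
  have hk2 : (2 : ℝ) ≤ k := by exact_mod_cast hk
  have h3 : 1 ≤ phi k δ α := by nlinarith
  have han : ⌊α * n⌋₊ ≤ n := floor_mul_le (by linarith) n
  have ha1 : (⌊α * n⌋₊ : ℝ) ≤ α * n := floor_le_mul hα n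
  have hc : ((block σ 0 ⌊α * n⌋₊)ᶜ).card = n - ⌊α * n⌋₊ := by
    rw [card_compl, card_block σ han, hn, Nat.sub_zero]
  unfold furthest
  rw [card_far, min_eq_left]
  · exact Nat.le_ceil _
  · rw [hc]
    have h2 := Nat.ceil_lt_add_one (a := 30 * (k * phi k δ α)) (by positivity)
    have : (⌈30 * (k * phi k δ α)⌉₊ : ℝ) ≤ ((n - ⌊α * n⌋₊ : ℕ) : ℝ) := by
      rw [Nat.cast_sub han]
      nlinarith
    exact_mod_cast this

/-- The second phase contains many of the furthest points. Hence the risk estimate is large, and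
only the furthest points are beyond the threshold. -/
theorem orderProb_beyond_subset (hn : Fintype.card X = n) (hk : 2 ≤ k) (hδ : 0 < δ)
    (hδ1 : δ < 1) (hα : 0 < α) (hα6 : α ≤ 1 / 6) (hτ : 0 < τ) (hτφ : τ ≤ phi k δ α)
    (hbig : 40 * (k * phi k δ α) ≤ n) (b : ℕ) :
    orderProb n (fun σ : Fin n ≃ X => ¬ beyond A δ k α τ b σ ⊆ furthest A δ k α σ)
      ≤ Real.exp (-Real.log (32 * k / δ)) := by
  have hL := four_le_log hk hδ hδ1
  have hφ := mul_phi (k := k) (δ := δ) hα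
  have hφ0 := phi_pos hα hk hδ hδ1
  have hcardF := fun σ : Fin n ≃ X => card_furthest (A := A) hn hk hδ hδ1 hα hα6 hbig σ
  set L := Real.log (32 * k / δ)
  set φ := phi k δ α with hφd
  set a := ⌊α * n⌋₊ with ha
  set c := ⌊2 * α * n⌋₊ with hc
  have hk2 : (2 : ℝ) ≤ k := by exact_mod_cast hk
  have hac : a ≤ c := floor_mul_le_floor_mul (by linarith) n
  have hcn : c ≤ n := floor_mul_le (by linarith) n
  have ha1 : (a : ℝ) ≤ α * n := floor_le_mul hα n
  have hc1 : 2 * α * n < c + 1 := Nat.lt_floor_add_one _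
  have hkφ : α * (k * φ) = 150 * (k * L) := by rw [← mul_assoc, mul_comm α, mul_assoc, hφ]; ring
  have hkL : 8 ≤ k * L := by nlinarith
  have hαn : 6000 * (k * L) ≤ α * n := by nlinarith
  have hn0 : (0 : ℝ) < n := by
    by_contra! h
    nlinarith
  have hna0 : (0 : ℝ) < n - a := by nlinarith
  have hp : 0.99 * α ≤ ((c : ℝ) - a) / ((n : ℝ) - a) := by
    rw [le_div_iff₀ hna0]
    have : 0.99 * α * (n - a) ≤ 0.99 * α * n := by
      gcongr; linarith [Nat.cast_nonneg (α := ℝ) a]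
    nlinarith
  refine orderProb_le_of_lower_tail le_rfl hac hcn fun σ₀ =>
    ⟨furthest A δ k α σ₀, 6 * (α * (k * φ)), ?_, ?_, fun σ hσ h => ?_⟩
  · exact disjoint_of_subset_left (far_subset _ _ _) disjoint_compl_left
  · have h1 : 0.99 * α * (30 * (k * φ)) ≤
        ((c : ℝ) - a) / ((n : ℝ) - a) * (furthest A δ k α σ₀).card :=
      mul_le_mul hp (hcardF σ₀) (by positivity) (le_trans (by positivity) hp)
    have h2 := Real.log_two_lt_d9
    nlinarith
  · by_contra! hlt
    refine h fun x hx => ?_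
    by_contra hxF
    rw [← furthest_congr hσ] at hlt
    simp only [beyond, mem_filter] at hx
    refine hx.2.not_ge ?_
    set T := refSet A δ k α σ with hT
    set N := block σ a c ∩ furthest A δ k α σ with hN
    have hxc : x ∈ (block σ 0 a)ᶜ := by
      rw [mem_compl, mem_block]
      have := (mem_block.1 hx.1).1
      omega
    have hd : ∀ y ∈ N, setDist x T ≤ setDist y T := fun y hy =>
      setDist_le_of_mem_far (mem_inter.1 hy).2 hxc hxF
    have h1 := le_truncRisk (r := numOutliers δ k α) (S := block σ a c) inter_subset_left hd
    have hr : (numOutliers δ k α : ℝ) ≤ 2 * α * (k + 1) * φ := Nat.floor_le (by positivity)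
    have h2 : 3 * α * (k * τ) ≤ ((N.card - numOutliers δ k α : ℕ) : ℝ) := by
      have h3 : (N.card : ℝ) - numOutliers δ k α ≤ ((N.card - numOutliers δ k α : ℕ) : ℝ) := by
        rw [sub_le_iff_le_add]
        norm_cast
        omega
      have h4 : α * (k * τ) ≤ α * (k * φ) := by gcongr
      have h5 : 2 * α * (k + 1) * φ ≤ 3 * (α * (k * φ)) := by nlinarith [mul_pos hα hφ0]
      nlinarith
    have hkτ : 0 < k * τ := by positivity
    rw [ENNReal.le_div_iff_mul_le (Or.inl (ENNReal.ofReal_pos.2 hkτ).ne')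
      (Or.inl ENNReal.ofReal_ne_top)]
    unfold estimate
    rw [ENNReal.le_div_iff_mul_le (Or.inl (by simpa using hα)) (Or.inl ENNReal.ofReal_ne_top)]
    refine le_trans ?_ h1
    rw [mul_assoc, ← ENNReal.ofReal_mul hkτ.le, mul_comm, ← ENNReal.ofReal_natCast]
    gcongr
    linarith

/-- In a copy with a short third phase, few points are beyond the threshold. If `n` is less than
`40 k φ`, this holds because the whole phase is short. -/
theorem orderProb_card_beyond_le (hn : Fintype.card X = n) (hk : 2 ≤ k) (hδ : 0 < δ)
    (hδ1 : δ < 1) (hα : 0 < α) (hα6 : α ≤ 1 / 6) (hτ : 0 < τ) (hτφ : τ ≤ phi k δ α) :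
    orderProb n (fun σ : Fin n ≃ X => 18600 * (k * Real.log (32 * k / δ)) <
      (beyond A δ k α τ ⌊(2 * α + 2 * α) * n⌋₊ σ).card)
      ≤ 2 * Real.exp (-Real.log (32 * k / δ)) := by
  have hL := four_le_log hk hδ hδ1
  have hφ := mul_phi (k := k) (δ := δ) hα
  have hφ0 := phi_pos hα hk hδ hδ1
  have hcardF := fun (hbig : 40 * (k * phi k δ α) ≤ n) (σ : Fin n ≃ X) =>
    card_furthest (A := A) hn hk hδ hδ1 hα hα6 hbig σ
  have hcardF' := fun (σ : Fin n ≃ X) => card_furthest_le (A := A) hk hδ hδ1 hα hα6 σ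
  have hsubset := fun hbig => orderProb_beyond_subset (A := A) hn hk hδ hδ1 hα hα6 hτ hτφ hbig
    ⌊(2 * α + 2 * α) * n⌋₊
  set L := Real.log (32 * k / δ)
  set φ := phi k δ α with hφd
  set a := ⌊α * n⌋₊ with ha
  set b := ⌊2 * α * n⌋₊ with hb
  set c := ⌊(2 * α + 2 * α) * n⌋₊ with hc
  have hk2 : (2 : ℝ) ≤ k := by exact_mod_cast hk
  have hab : a ≤ b := floor_mul_le_floor_mul (by linarith) n
  have hbc : b ≤ c := floor_mul_le_floor_mul (by linarith) n
  have hcn : c ≤ n := floor_mul_le (by linarith) n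
  have ha1 : (a : ℝ) ≤ α * n := floor_le_mul hα n
  have hb1 : 2 * α * n < b + 1 := Nat.lt_floor_add_one _
  have hc1 : (c : ℝ) ≤ (2 * α + 2 * α) * n := Nat.floor_le (by positivity)
  have hkφ : α * (k * φ) = 150 * (k * L) := by rw [← mul_assoc, mul_comm α, mul_assoc, hφ]; ring
  have hkL : 8 ≤ k * L := by nlinarith
  by_cases hbig : 40 * (k * φ) ≤ n
  · have hαn : 6000 * (k * L) ≤ α * n := by nlinarith
    have hn0 : (0 : ℝ) < n := by
      by_contra! h
      nlinarith
    have hna : 5 / 6 * (n : ℝ) ≤ n - a := by nlinarith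
    have hna0 : (0 : ℝ) < n - a := by linarith
    have hp : ((c : ℝ) - b) / ((n : ℝ) - a) ≤ 2.41 * α := by
      rw [div_le_iff₀ hna0]
      have : 2.41 * α * (5 / 6 * n) ≤ 2.41 * α * (n - a) := by gcongr
      nlinarith
    have hE7 : orderProb n (fun σ : Fin n ≃ X =>
        4 * (α * (furthest A δ k α σ).card) < (block σ b c ∩ furthest A δ k α σ).card)
        ≤ Real.exp (-L) := by
      refine orderProb_le_of_card_upper_tail hab hbc hcn fun σ₀ =>
        ⟨furthest A δ k α σ₀, 4 * (α * (furthest A δ k α σ₀).card), ?_, fun σ hσ h => ?_⟩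
      · have h1 := mul_le_mul_of_nonneg_right hp
          (Nat.cast_nonneg (α := ℝ) (furthest A δ k α σ₀).card)
        have h2 : α * (30 * (k * φ)) ≤ α * (furthest A δ k α σ₀).card := by
          gcongr; exact hcardF hbig σ₀
        have h3 := Real.log_two_gt_d9
        have h4 : 4 * (α * (furthest A δ k α σ₀).card) * 0.69
            ≤ 4 * (α * (furthest A δ k α σ₀).card) * Real.log 2 := by gcongr; linarith
        nlinarith
      · rw [furthest_congr hσ] at h
        exact h.le
    refine (orderProb_mono (E' := fun σ : Fin n ≃ X =>
      (¬ beyond A δ k α τ c σ ⊆ furthest A δ k α σ) ∨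
      4 * (α * (furthest A δ k α σ).card) < (block σ b c ∩ furthest A δ k α σ).card)
      fun σ hσ => ?_).trans ((orderProb_or_le _ _).trans (by linarith [hsubset hbig]))
    by_contra! hcon
    refine hσ.not_ge ?_
    have h1 : (beyond A δ k α τ c σ).card ≤ (block σ b c ∩ furthest A δ k α σ).card :=
      card_le_card (subset_inter (filter_subset _ _) hcon.1)
    have h2 : ((beyond A δ k α τ c σ).card : ℝ) ≤ 4 * (α * (furthest A δ k α σ).card) :=
      (Nat.cast_le.2 h1).trans hcon.2
    have h3 : α * (furthest A δ k α σ).card ≤ α * (31 * (k * φ)) := by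
      gcongr; exact hcardF' σ
    linarith
  · rw [orderProb_eq_zero]
    · positivity
    intro σ hσ
    refine absurd hσ (not_lt_of_ge ?_)
    have h1 : (beyond A δ k α τ c σ).card ≤ c - b :=
      (card_le_card (filter_subset _ _)).trans (card_block_le _ _ _)
    have h2 : ((beyond A δ k α τ c σ).card : ℝ) ≤ c - b := by
      rw [← Nat.cast_sub hbc]; exact_mod_cast h1
    nlinarith

/-- In a copy whose third phase may be long, but in which `α` is bounded from below, few points
are beyond the threshold. -/
theorem orderProb_card_beyond_last_le (hn : Fintype.card X = n) (hk : 2 ≤ k) (hδ : 0 < δ)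
    (hδ1 : δ < 1) (hα12 : 1 / 12 ≤ α) (hα6 : α ≤ 1 / 6) (hτ : 0 < τ) (hτφ : τ ≤ phi k δ α)
    (b : ℕ) :
    orderProb n (fun σ : Fin n ≃ X => 72000 * (k * Real.log (32 * k / δ)) <
      (beyond A δ k α τ b σ).card)
      ≤ 2 * Real.exp (-Real.log (32 * k / δ)) := by
  have hα : 0 < α := by linarith
  have hL := four_le_log hk hδ hδ1
  have hφ := mul_phi (k := k) (δ := δ) hα
  have hφ0 := phi_pos hα hk hδ hδ1
  have hcardF' := fun (σ : Fin n ≃ X) => card_furthest_le (A := A) hk hδ hδ1 hα hα6 σ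
  have hsubset := fun hbig => orderProb_beyond_subset (A := A) hn hk hδ hδ1 hα hα6 hτ hτφ hbig b
  set L := Real.log (32 * k / δ)
  set φ := phi k δ α with hφd
  have hk2 : (2 : ℝ) ≤ k := by exact_mod_cast hk
  have hφL : φ ≤ 1800 * L := by nlinarith
  have hkφ : k * φ ≤ 1800 * (k * L) := by nlinarith
  have hkL : 8 ≤ k * L := by nlinarith
  by_cases hbig : 40 * (k * φ) ≤ n
  · refine (orderProb_mono fun σ hσ hcon => ?_).trans ((hsubset hbig).trans
      (by linarith [Real.exp_pos (-L)]))
    refine hσ.not_ge ((Nat.cast_le.2 (card_le_card hcon)).trans ?_)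
    linarith [hcardF' σ]
  · rw [orderProb_eq_zero]
    · positivity
    intro σ hσ
    refine absurd hσ (not_lt_of_ge ?_)
    have h1 : ((beyond A δ k α τ b σ).card : ℝ) ≤ n := by
      have := card_le_univ (beyond A δ k α τ b σ)
      rw [hn] at this
      exact_mod_cast this
    linarith

end Counts

section LastCopy

variable {X : Type*} [Fintype X] [LinearOrder X] {n k : ℕ} {δ α : ℝ}

/-- The third phase of the last copy contains a fixed fraction of every large cluster. -/
theorem orderProb_cluster_last_le (hk : 2 ≤ k) (hδ : 0 < δ) (hδ1 : δ < 1) (hα : 0 < α)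
    (hα6 : α ≤ 1 / 6) (hn : Fintype.card X = n) {C : Finset X} (hC : phi k δ α ≤ C.card) :
    orderProb n (fun σ => 5 * (block σ ⌊2 * α * n⌋₊ n ∩ C).card < C.card)
      ≤ Real.exp (-Real.log (32 * k / δ)) := by
  have hL := four_le_log hk hδ hδ1
  have hφ := mul_phi (k := k) (δ := δ) hα
  set L := Real.log (32 * k / δ)
  have hCn : (C.card : ℝ) ≤ n := by rw [← hn]; exact_mod_cast card_le_univ C
  have hαC : 150 * L ≤ α * C.card := by rw [← hφ]; gcongr
  have hC0 : (0 : ℝ) ≤ C.card := Nat.cast_nonneg _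
  have hC1 : 900 * L ≤ C.card := by nlinarith
  have hn0 : (0 : ℝ) < n := by linarith
  have hb1 : (⌊2 * α * n⌋₊ : ℝ) ≤ 2 * α * n := Nat.floor_le (by positivity)
  have hp : 2 / 3 ≤ ((n : ℝ) - ⌊2 * α * n⌋₊) / ((n : ℝ) - (0 : ℕ)) := by
    simp only [Nat.cast_zero, sub_zero]
    rw [le_div_iff₀ hn0]
    nlinarith
  refine orderProb_le_of_lower_tail (a := 0) (Nat.zero_le _)
    (floor_mul_le (α := 2 * α) (by linarith) n) le_rfl fun σ₀ =>
      ⟨C, C.card / 5, ?_, ?_, fun σ _ h => ?_⟩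
  · rw [disjoint_left]; intro x _ hx
    rw [mem_block] at hx; omega
  · have h3 := mul_le_mul_of_nonneg_right hp hC0
    have h4 := Real.log_two_lt_d9
    nlinarith
  · have : (5 : ℝ) * (block σ ⌊2 * α * n⌋₊ n ∩ C).card < C.card := by exact_mod_cast h
    linarith

variable [MetricSpace X] {A : Finset X → ℕ → Finset X} {β : ℝ}

/-- The points of the third phase of the last copy whose closest center is `c`. -/
noncomputable def cell (A : Finset X → ℕ → Finset X) (δ : ℝ) (k : ℕ) (α : ℝ) (σ : Fin n ≃ X)
    (c : X) : Finset X :=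
  (block σ ⌊2 * α * n⌋₊ n).filter (fun x => nearest (refSet A δ k α σ) x = (c : WithTop X))

/-- It is unlikely that in some cell at least half of the points are close to the center, on the scale
of the average distance of its points in `Λ`, and yet none of the first `M` points is. -/
theorem orderProb_cell_le (hk : 2 ≤ k) (hα : 0 < α)
    (hA : IsOfflineApprox A β) (Λ : Finset X) (M : ℕ) :
    orderProb n (fun σ => ∃ c ∈ refSet A δ k α σ, M ≤ (cell A δ k α σ c).card ∧
      (cell A δ k α σ c).card ≤ 2 * (cell A δ k α σ c ∩ nearAverage (cell A δ k α σ c)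
        (cell A δ k α σ c ∩ Λ) (refSet A δ k α σ)).card ∧
      ∀ t : Fin n, σ t ∈ cell A δ k α σ c →
        (block σ ⌊2 * α * n⌋₊ t ∩ cell A δ k α σ c).card < M →
        σ t ∉ nearAverage (cell A δ k α σ c) (cell A δ k α σ c ∩ Λ) (refSet A δ k α σ))
      ≤ kPlus k δ * (1 / 2) ^ M := by
  classical
  have hab : ⌊α * n⌋₊ ≤ ⌊2 * α * n⌋₊ := floor_mul_le_floor_mul (by linarith) n
  refine orderProb_le_of_first_hits (a := ⌊2 * α * n⌋₊) (kPlus k δ) M fun σ₀ =>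
    ⟨(refSet A δ k α σ₀).filter (fun c =>
    (cell A δ k α σ₀ c).card ≤ 2 * (cell A δ k α σ₀ c ∩ nearAverage (cell A δ k α σ₀ c)
        (cell A δ k α σ₀ c ∩ Λ) (refSet A δ k α σ₀)).card), cell A δ k α σ₀,
    fun c => nearAverage (cell A δ k α σ₀ c)
        (cell A δ k α σ₀ c ∩ Λ) (refSet A δ k α σ₀), ?_, ?_, ?_⟩
  · refine (card_filter_le _ _).trans ?_
    exact (hA _ (kPlus k δ) (hk.trans (Nat.le_add_right _ _))).2.1
  · intro c hc
    refine ⟨?_, (mem_filter.1 hc).2⟩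
    exact disjoint_of_subset_left (filter_subset _ _) (block_disjoint σ₀ le_rfl).symm
  · intro σ hσ hE
    have e1 : refSet A δ k α σ = refSet A δ k α σ₀ :=
      refSet_congr fun i hi => hσ i (hi.trans_le hab)
    have e2 : ∀ c, cell A δ k α σ c = cell A δ k α σ₀ c := by
      intro c
      unfold cell
      rw [e1, block_eq_compl, block_eq_compl, block_congr le_rfl hσ]
    simp only [e1, e2] at hE
    obtain ⟨c, hc, hM, hhalf, h⟩ := hE
    exact ⟨c, mem_filter.2 ⟨hc, hhalf⟩, hM, h⟩

end LastCopy

/-! ### Parameters, good orders and the conclusion -/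

section Parameters

variable {k : ℕ} {δ : ℝ}

theorem scale_pos (hk : 2 ≤ k) (hδ : 0 < δ) (i : ℕ) : 0 < scale δ k i := by
  have : (0 : ℝ) < k := by exact_mod_cast (by omega : 0 < k)
  unfold scale; positivity

theorem scale_mono (hk : 2 ≤ k) (hδ : 0 < δ) {i j : ℕ} (h : i ≤ j) :
    scale δ k i ≤ scale δ k j := by
  have : (0 : ℝ) < k := by exact_mod_cast (by omega : 0 < k)
  unfold scale
  gcongr
  norm_num

theorem scale_succ (δ : ℝ) (k i : ℕ) : scale δ k (i + 1) = 2 * scale δ k i := by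
  unfold scale; ring

theorem scale_zero (δ : ℝ) (k : ℕ) : scale δ k 0 = δ / (4 * k) := by
  unfold scale; ring

theorem one_le_inv_scale_zero (hk : 2 ≤ k) (hδ : 0 < δ) (hδ1 : δ < 1) :
    1 ≤ 1 / (6 * scale δ k 0) := by
  have h2 : (2 : ℝ) ≤ k := by exact_mod_cast hk
  have h0 := scale_pos hk hδ 0
  rw [le_div_iff₀ (by positivity), scale_zero, one_mul, mul_div_assoc', div_le_one (by positivity)]
  linarith

theorem lastIndex_le (hk : 2 ≤ k) (hδ : 0 < δ) (hδ1 : δ < 1) :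
    (lastIndex δ k : ℝ) ≤ Real.logb 2 (1 / (6 * scale δ k 0)) :=
  Nat.floor_le (Real.logb_nonneg (by norm_num) (one_le_inv_scale_zero hk hδ hδ1))

theorem scale_lastIndex_le (hk : 2 ≤ k) (hδ : 0 < δ) (hδ1 : δ < 1) :
    scale δ k (lastIndex δ k) ≤ 1 / 6 := by
  have h0 := scale_pos hk hδ 0
  have h1 := lastIndex_le hk hδ hδ1
  rw [Real.le_logb_iff_rpow_le (by norm_num) (by positivity), Real.rpow_natCast,
    le_div_iff₀ (by positivity)] at h1
  have : scale δ k (lastIndex δ k) = 2 ^ lastIndex δ k * scale δ k 0 := by unfold scale; ring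
  rw [this]
  linarith

theorem le_scale_lastIndex (hk : 2 ≤ k) (hδ : 0 < δ) :
    1 / 12 ≤ scale δ k (lastIndex δ k) := by
  have h0 := scale_pos hk hδ 0
  have h1 : Real.logb 2 (1 / (6 * scale δ k 0)) < ((lastIndex δ k + 1 : ℕ) : ℝ) := by
    push_cast; exact Nat.lt_floor_add_one _
  rw [Real.logb_lt_iff_lt_rpow (by norm_num) (by positivity), Real.rpow_natCast,
    div_lt_iff₀ (by positivity), pow_succ] at h1
  have : scale δ k (lastIndex δ k) = 2 ^ lastIndex δ k * scale δ k 0 := by unfold scale; ring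
  rw [this]
  linarith

theorem scale_le (hk : 2 ≤ k) (hδ : 0 < δ) (hδ1 : δ < 1) {i : ℕ} (hi : i ≤ lastIndex δ k) :
    scale δ k i ≤ 1 / 6 :=
  (scale_mono hk hδ hi).trans (scale_lastIndex_le hk hδ hδ1)

theorem confidence_pos (hδ : 0 < δ) : 0 < confidence δ k := by
  unfold confidence; positivity

theorem confidence_le (hδ : 0 < δ) : confidence δ k ≤ δ := by
  unfold confidence
  exact div_le_self hδ.le (by linarith [Nat.cast_nonneg (α := ℝ) (lastIndex δ k)])

theorem log_two_le (hk : 2 ≤ k) (hδ : 0 < δ) (hδ1 : δ < 1) : Real.log 2 ≤ Real.log (k / δ) := by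
  have h2 : (2 : ℝ) ≤ k := by exact_mod_cast hk
  refine Real.log_le_log (by norm_num) ?_
  rw [le_div_iff₀ hδ]
  nlinarith

theorem lastIndex_add_one_le (hk : 2 ≤ k) (hδ : 0 < δ) (hδ1 : δ < 1) :
    (lastIndex δ k : ℝ) + 1 ≤ 3 * Real.log (k / δ) := by
  have hk0 : (0 : ℝ) < k := by exact_mod_cast (by omega : 0 < k)
  have h0 := scale_pos hk hδ 0
  have h1 := lastIndex_le hk hδ hδ1
  have hl := Real.log_two_gt_d9
  have h2 : 1 / (6 * scale δ k 0) ≤ k / δ := by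
    rw [scale_zero, div_le_div_iff₀ (by positivity) hδ]
    field_simp
    norm_num
  have h3 : Real.logb 2 (1 / (6 * scale δ k 0)) ≤ Real.log (k / δ) / Real.log 2 := by
    unfold Real.logb
    gcongr
  have h4 : Real.log (k / δ) / Real.log 2 ≤ 1.45 * Real.log (k / δ) := by
    rw [div_le_iff₀ (by linarith)]
    nlinarith [log_two_le hk hδ hδ1]
  linarith [log_two_le hk hδ hδ1]

theorem log_confidence_le (hk : 2 ≤ k) (hδ : 0 < δ) (hδ1 : δ < 1) :
    Real.log (32 * k / confidence δ k) ≤ 9 * Real.log (k / δ) := by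
  have hk0 : (0 : ℝ) < k := by exact_mod_cast (by omega : 0 < k)
  have e : 32 * k / confidence δ k = 2 ^ 5 * (k / δ) * (lastIndex δ k + 1) := by
    unfold confidence
    field_simp
    norm_num
  rw [e, Real.log_mul (by positivity) (by positivity), Real.log_mul (by norm_num) (by positivity),
    Real.log_pow]
  have h1 : Real.log (lastIndex δ k + 1) ≤ lastIndex δ k + 1 - 1 :=
    Real.log_le_sub_one_of_pos (by positivity)
  have h2 := lastIndex_add_one_le hk hδ hδ1
  have h3 := log_two_le hk hδ hδ1
  push_cast
  linarith

/-- The number `M` of points that the last copy selects for each center. -/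
noncomputable def lastM (k : ℕ) (δ' : ℝ) : ℕ := ⌈Real.logb 2 (8 * kPlus k δ' / δ')⌉₊

theorem kPlus_add_one_le {δ' : ℝ} (hk : 2 ≤ k) (hδ : 0 < δ') (hδ1 : δ' < 1) :
    (kPlus k δ' : ℝ) + 1 ≤ 20 * (k * Real.log (32 * k / δ')) := by
  have hL := four_le_log hk hδ hδ1
  have h2 : (2 : ℝ) ≤ k := by exact_mod_cast hk
  unfold kPlus
  set L := Real.log (32 * k / δ')
  have h1 : (⌊38 * L⌋₊ : ℝ) ≤ 38 * L := Nat.floor_le (by positivity)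
  push_cast
  nlinarith

theorem lastM_add_one_le {δ' : ℝ} (hk : 2 ≤ k) (hδ : 0 < δ') (hδ1 : δ' < 1) :
    (lastM k δ' : ℝ) + 1 ≤ 6 * Real.log (32 * k / δ') := by
  have hL := four_le_log hk hδ hδ1
  have h2 : (2 : ℝ) ≤ k := by exact_mod_cast hk
  set x := 32 * k / δ' with hx
  have hx64 : 64 / δ' ≤ x := by rw [hx]; gcongr; linarith
  have hx1 : 32 * (k : ℝ) ≤ x := by
    rw [hx, le_div_iff₀ hδ]; nlinarith
  have hinv : 1 ≤ 1 / δ' := by rw [le_div_iff₀ hδ]; linarith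
  have hx64' : 64 * (1 / δ') ≤ x := by rw [← mul_div_assoc, mul_one]; exact hx64
  have hkp : (kPlus k δ' : ℝ) ≤ 39 * x := by
    have h1 : (⌊38 * Real.log x⌋₊ : ℝ) ≤ 38 * Real.log x := Nat.floor_le (by positivity)
    have h3 : Real.log x ≤ x - 1 := Real.log_le_sub_one_of_pos (by linarith)
    unfold kPlus
    push_cast
    linarith
  have hkp0 : (0 : ℝ) < kPlus k δ' := by
    have : 0 < kPlus k δ' := by unfold kPlus; omega
    exact_mod_cast this
  have h4 : 8 * kPlus k δ' / δ' ≤ x ^ 3 := by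
    have h5 : 8 * (kPlus k δ' : ℝ) / δ' = 8 * kPlus k δ' * (1 / δ') := by ring
    rw [h5]
    have hinv2 : 1 / δ' ≤ x / 64 := by linarith
    calc 8 * (kPlus k δ' : ℝ) * (1 / δ') ≤ 8 * (39 * x) * (x / 64) :=
          mul_le_mul (by linarith) hinv2 (by positivity) (by positivity)
      _ = 39 / 8 * x ^ 2 := by ring
      _ ≤ x * x ^ 2 := by gcongr; linarith
      _ = x ^ 3 := by ring
  have h5 : Real.log (8 * kPlus k δ' / δ') ≤ 3 * Real.log x := by
    have := Real.log_le_log (by positivity) h4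
    rwa [Real.log_pow] at this
  have hl := Real.log_two_gt_d9
  have h6 : Real.logb 2 (8 * kPlus k δ' / δ') ≤ 4.4 * Real.log x := by
    unfold Real.logb
    rw [div_le_iff₀ (by linarith)]
    nlinarith
  have h7 : (lastM k δ' : ℝ) ≤ max (Real.logb 2 (8 * kPlus k δ' / δ')) 0 + 1 := by
    unfold lastM
    rcases le_total (Real.logb 2 (8 * kPlus k δ' / δ')) 0 with h | h
    · rw [Nat.ceil_eq_zero.2 h, Nat.cast_zero]
      positivity
    · exact (Nat.ceil_lt_add_one h).le.trans (by gcongr; exact le_max_left _ _)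
  have h8 : max (Real.logb 2 (8 * kPlus k δ' / δ')) 0 ≤ 4.4 * Real.log x :=
    max_le h6 (by positivity)
  linarith

theorem kPlus_mul_pow_lastM_le {δ' : ℝ} (hk : 2 ≤ k) (hδ : 0 < δ') :
    (kPlus k δ' : ℝ) * (1 / 2) ^ lastM k δ' ≤ δ' / 8 := by
  have hkp0 : (0 : ℝ) < kPlus k δ' := by
    have : 0 < kPlus k δ' := by unfold kPlus; omega
    exact_mod_cast this
  have h1 : Real.logb 2 (8 * kPlus k δ' / δ') ≤ lastM k δ' := Nat.le_ceil _
  rw [Real.logb_le_iff_le_rpow (by norm_num) (by positivity), Real.rpow_natCast,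
    div_le_iff₀ hδ] at h1
  rw [one_div, inv_pow, ← div_eq_mul_inv, div_le_div_iff₀ (by positivity) (by norm_num)]
  linarith

theorem exp_neg_log {δ' : ℝ} (hk : 2 ≤ k) (hδ : 0 < δ') :
    Real.exp (-Real.log (32 * k / δ')) = δ' / (32 * k) := by
  have hk0 : (0 : ℝ) < k := by exact_mod_cast (by omega : 0 < k)
  rw [Real.exp_neg, Real.exp_log (by positivity), inv_div]

end Parameters

section Copies

variable {X : Type*} [MetricSpace X] [LinearOrder X]

theorem copy_of_ne (A : Finset X → ℕ → Finset X) (δ : ℝ) (k n : ℕ) {i : ℕ}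
    (h : i ≠ lastIndex δ k) : copy A δ k n i =
      selectProc A (confidence δ k) k n (scale δ k i) (2 * scale δ k i) 1
        (phi k (confidence δ k) (scale δ k (lastIndex δ k))) := by
  unfold copy
  simp only [if_neg h]

theorem copy_last (A : Finset X → ℕ → Finset X) (δ : ℝ) (k n : ℕ) :
    copy A δ k n (lastIndex δ k) =
      selectProc A (confidence δ k) k n (scale δ k (lastIndex δ k))
        (1 - 2 * scale δ k (lastIndex δ k)) (lastM k (confidence δ k))
        (phi k (confidence δ k) (scale δ k (lastIndex δ k))) := by
  unfold copy lastM
  simp only [if_true]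

theorem floor_last (α : ℝ) (n : ℕ) : ⌊(2 * α + (1 - 2 * α)) * (n : ℝ)⌋₊ = n := by
  have : (2 * α + (1 - 2 * α)) * (n : ℝ) = n := by ring
  rw [this, Nat.floor_natCast]

/-- The third phases of the copies cover the stream from the position `2 α₁ n` on. -/
theorem exists_copy_active (A : Finset X → ℕ → Finset X) (δ : ℝ) (k : ℕ) {n t : ℕ}
    (ht : ⌊2 * scale δ k 0 * n⌋₊ ≤ t) (htn : t < n) :
    ∃ i ≤ lastIndex δ k, ∃ γ M, ⌊2 * scale δ k i * n⌋₊ ≤ t ∧ t < ⌊(2 * scale δ k i + γ) * n⌋₊ ∧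
      copy A δ k n i = selectProc A (confidence δ k) k n (scale δ k i) γ M
        (phi k (confidence δ k) (scale δ k (lastIndex δ k))) := by
  by_cases hlast : ⌊2 * scale δ k (lastIndex δ k) * n⌋₊ ≤ t
  · exact ⟨_, le_rfl, _, _, hlast, by rw [floor_last]; exact htn, copy_last A δ k n⟩
  · classical
    have hex : ∃ j, ¬ ⌊2 * scale δ k j * n⌋₊ ≤ t := ⟨_, hlast⟩
    have hmin := fun j => Nat.find_min hex (m := j)
    have hle : Nat.find hex ≤ lastIndex δ k := Nat.find_min' hex hlast
    have hspec := Nat.find_spec hex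
    obtain ⟨i, hi⟩ : ∃ i, Nat.find hex = i + 1 := by
      refine Nat.exists_eq_succ_of_ne_zero fun h0 => ?_
      rw [h0] at hspec
      exact hspec ht
    rw [hi] at hle hspec hmin
    refine ⟨i, by omega, _, _, not_not.1 (hmin i (Nat.lt_succ_self i)), ?_,
      copy_of_ne A δ k n (by omega)⟩
    rw [scale_succ] at hspec
    push Not at hspec
    have e : (2 * scale δ k i + 2 * scale δ k i) * (n : ℝ) = 2 * (2 * scale δ k i) * n := by ring
    rw [e]
    exact hspec

end Copies

section Conclusion

variable {X : Type*} [Fintype X] [MetricSpace X] [LinearOrder X] {n k : ℕ} {δ β : ℝ}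
  {A : Finset X → ℕ → Finset X} {O : Finset X} {g : X → X}

/-- What is required of the copy with index `i`: its reference clustering is good on the large
clusters, its risk estimate is not too large, and few points of its third phase, which ends at
position `n` for the last copy, are beyond the threshold. -/
def CopyGood (A : Finset X → ℕ → Finset X) (β δ : ℝ) (k : ℕ) (O : Finset X) (g : X → X) (i : ℕ)
    (σ : Fin n ≃ X) : Prop :=
  let δ' := confidence δ k
  let α := scale δ k i
  let I := lastIndex δ k
  risk (largePart g (phi k δ' α)) (refSet A δ' k α σ) ≤ ENNReal.ofReal (31 * β) * risk univ O ∧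
  estimate A δ' k α σ ≤ risk (largePart g (phi k δ' α)) (refSet A δ' k α σ) ∧
  ((beyond A δ' k α (phi k δ' (scale δ k I))
    (if i = I then n else ⌊(2 * α + 2 * α) * n⌋₊) σ).card : ℝ)
      ≤ 72000 * (k * Real.log (32 * k / δ'))

theorem orderProb_not_copyGood_le (hn : Fintype.card X = n) (hk : 2 ≤ k) (hδ : 0 < δ)
    (hδ1 : δ < 1) (hβ : 1 ≤ β) (hA : IsOfflineApprox A β) (hO : O.card ≤ k)
    (hg : ∀ x, g x ∈ O ∧ setDist x O = edist x (g x)) {i : ℕ} (hi : i ≤ lastIndex δ k) :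
    orderProb n (fun σ : Fin n ≃ X => ¬ CopyGood A β δ k O g i σ)
      ≤ (k + 6) * Real.exp (-Real.log (32 * k / confidence δ k)) := by
  have hδ' := confidence_pos (k := k) hδ
  have hδ1' := (confidence_le (k := k) hδ).trans_lt hδ1
  have hα := scale_pos hk hδ i
  have hα6 := scale_le hk hδ hδ1 hi
  have hτ : 0 < phi k (confidence δ k) (scale δ k (lastIndex δ k)) :=
    phi_pos (scale_pos hk hδ _) hk hδ' hδ1'
  have hτφ : phi k (confidence δ k) (scale δ k (lastIndex δ k))
      ≤ phi k (confidence δ k) (scale δ k i) := by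
    have := four_le_log hk hδ' hδ1'
    unfold phi
    exact div_le_div_of_nonneg_left (by linarith) hα (scale_mono hk hδ hi)
  have h1 := orderProb_risk_largePart_le hn hk hδ' hδ1' hα hα6 hβ hA hO hg
  have h2 := orderProb_estimate_le (n := n) (A := A) hk hδ' hδ1' hα hα6 hO (fun x => (hg x).1)
  have hkL : (0 : ℝ) ≤ k * Real.log (32 * k / confidence δ k) := by
    have := four_le_log hk hδ' hδ1'
    positivity
  have h3 : orderProb n (fun σ : Fin n ≃ X => 72000 * (k * Real.log (32 * k / confidence δ k)) <
      (beyond A (confidence δ k) k (scale δ k i)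
        (phi k (confidence δ k) (scale δ k (lastIndex δ k)))
        (if i = lastIndex δ k then n else ⌊(2 * scale δ k i + 2 * scale δ k i) * n⌋₊) σ).card)
      ≤ 2 * Real.exp (-Real.log (32 * k / confidence δ k)) := by
    by_cases h : i = lastIndex δ k
    · simp only [if_pos h]
      exact orderProb_card_beyond_last_le hn hk hδ' hδ1' (h ▸ le_scale_lastIndex hk hδ) hα6 hτ
        hτφ n
    · simp only [if_neg h]
      refine (orderProb_mono fun σ hσ => ?_).trans
        (orderProb_card_beyond_le (A := A) hn hk hδ' hδ1' hα hα6 hτ hτφ)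
      exact lt_of_le_of_lt (by linarith) hσ
  refine (orderProb_mono (E' := fun σ : Fin n ≃ X => _ ∨ (_ ∨ _)) fun σ hσ => ?_).trans
    (((orderProb_or_le _ _).trans (add_le_add h1 ((orderProb_or_le _ _).trans
      (add_le_add h2 h3)))).trans (by linarith))
  by_contra hcon
  push Not at hcon
  exact hσ hcon

/-- The requirements on the order of the points that together imply both bounds. -/
structure GoodOrder (A : Finset X → ℕ → Finset X) (β δ : ℝ) (k : ℕ) (O : Finset X) (g : X → X)
    (σ : Fin n ≃ X) : Prop where
  /-- No optimal center comes before the third phase of the first copy. -/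
  centers : ∀ o ∈ O, o ∉ block σ 0 ⌊2 * scale δ k 0 * n⌋₊
  copies : ∀ i ∈ range (lastIndex δ k + 1), CopyGood A β δ k O g i σ
  /-- The last copy sees a fixed fraction of each large cluster in its third phase. -/
  clusters : ∀ o ∈ O, phi k (confidence δ k) (scale δ k (lastIndex δ k)) ≤ (cluster g o).card →
    (cluster g o).card ≤
      5 * (block σ ⌊2 * scale δ k (lastIndex δ k) * n⌋₊ n ∩ cluster g o).card
  /-- If at least half of a cell of the last copy is close to its center, then so is one of its
  first points. -/
  cells : ∀ c ∈ refSet A (confidence δ k) k (scale δ k (lastIndex δ k)) σ,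
    lastM k (confidence δ k)
      ≤ (cell A (confidence δ k) k (scale δ k (lastIndex δ k)) σ c).card →
    (cell A (confidence δ k) k (scale δ k (lastIndex δ k)) σ c).card ≤
      2 * (cell A (confidence δ k) k (scale δ k (lastIndex δ k)) σ c ∩
        nearAverage (cell A (confidence δ k) k (scale δ k (lastIndex δ k)) σ c)
        (cell A (confidence δ k) k (scale δ k (lastIndex δ k)) σ c ∩
          largePart g (phi k (confidence δ k) (scale δ k (lastIndex δ k))))
        (refSet A (confidence δ k) k (scale δ k (lastIndex δ k)) σ)).card →
    ∃ t : Fin n, σ t ∈ cell A (confidence δ k) k (scale δ k (lastIndex δ k)) σ c ∧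
      (block σ ⌊2 * scale δ k (lastIndex δ k) * n⌋₊ t ∩
        cell A (confidence δ k) k (scale δ k (lastIndex δ k)) σ c).card
          < lastM k (confidence δ k) ∧
      σ t ∈ nearAverage (cell A (confidence δ k) k (scale δ k (lastIndex δ k)) σ c)
        (cell A (confidence δ k) k (scale δ k (lastIndex δ k)) σ c ∩
          largePart g (phi k (confidence δ k) (scale δ k (lastIndex δ k))))
        (refSet A (confidence δ k) k (scale δ k (lastIndex δ k)) σ)

theorem orderProb_not_goodOrder_le (hn : Fintype.card X = n) (hk : 2 ≤ k) (hδ : 0 < δ)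
    (hδ1 : δ < 1) (hβ : 1 ≤ β) (hA : IsOfflineApprox A β) (hO : O.card ≤ k)
    (hg : ∀ x, g x ∈ O ∧ setDist x O = edist x (g x)) :
    orderProb n (fun σ : Fin n ≃ X => ¬ GoodOrder A β δ k O g σ) ≤ δ := by
  have hδ' := confidence_pos (k := k) hδ
  have hδ1' := (confidence_le (k := k) hδ).trans_lt hδ1
  have hk2 : (2 : ℝ) ≤ k := by exact_mod_cast hk
  have hα := scale_pos hk hδ (lastIndex δ k)
  have hα6 := scale_lastIndex_le hk hδ hδ1
  have hexp := exp_neg_log hk hδ'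
  have hb : ⌊2 * scale δ k 0 * n⌋₊ ≤ n := by
    have := scale_le hk hδ hδ1 (Nat.zero_le _)
    exact floor_mul_le (by linarith) n
  have h1 : orderProb n (fun σ : Fin n ≃ X => ∃ o ∈ O, o ∈ block σ 0 ⌊2 * scale δ k 0 * n⌋₊)
      ≤ δ / 2 := by
    have h2 : (⌊2 * scale δ k 0 * n⌋₊ : ℝ) / n ≤ 2 * scale δ k 0 :=
      div_le_of_le_mul₀ (by positivity) (by linarith [scale_pos hk hδ 0])
        (Nat.floor_le (by have := scale_pos hk hδ 0; positivity))
    calc _ ≤ ∑ o ∈ O, orderProb n (fun σ : Fin n ≃ X => o ∈ block σ 0 ⌊2 * scale δ k 0 * n⌋₊) :=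
          orderProb_exists_le O _
      _ ≤ ∑ o ∈ O, 2 * scale δ k 0 :=
          sum_le_sum fun o _ => (orderProb_mem_prefix_le hn hb o).trans h2
      _ = O.card * (2 * scale δ k 0) := by rw [sum_const, nsmul_eq_mul]
      _ ≤ k * (2 * scale δ k 0) := by have := scale_pos hk hδ 0; gcongr
      _ = δ / 2 := by rw [scale_zero]; field_simp; norm_num
  have h2 : orderProb n (fun σ : Fin n ≃ X => ∃ i ∈ range (lastIndex δ k + 1),
      ¬ CopyGood A β δ k O g i σ) ≤ δ / 8 := by
    refine (orderProb_exists_le _ _).trans ((sum_le_sum fun i hi =>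
      orderProb_not_copyGood_le hn hk hδ hδ1 hβ hA hO hg
        (Nat.lt_succ_iff.1 (mem_range.1 hi))).trans ?_)
    rw [sum_const, card_range, nsmul_eq_mul, hexp]
    have e : ((lastIndex δ k + 1 : ℕ) : ℝ) * ((k + 6) * (confidence δ k / (32 * k)))
        = δ * ((k + 6) / (32 * k)) := by
      unfold confidence; push_cast; field_simp
    have h3 : ((k : ℝ) + 6) / (32 * k) ≤ 1 / 8 := by
      rw [div_le_div_iff₀ (by positivity) (by norm_num)]; linarith
    rw [e]
    nlinarith
  have h3 : orderProb n (fun σ : Fin n ≃ X => ∃ o ∈ O,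
      phi k (confidence δ k) (scale δ k (lastIndex δ k)) ≤ (cluster g o).card ∧
      5 * (block σ ⌊2 * scale δ k (lastIndex δ k) * n⌋₊ n ∩ cluster g o).card
        < (cluster g o).card) ≤ δ / 8 := by
    have h4 : ∀ o ∈ O, orderProb n (fun σ : Fin n ≃ X =>
        phi k (confidence δ k) (scale δ k (lastIndex δ k)) ≤ (cluster g o).card ∧
        5 * (block σ ⌊2 * scale δ k (lastIndex δ k) * n⌋₊ n ∩ cluster g o).card
        < (cluster g o).card) ≤ confidence δ k / (32 * k) := by
      intro o _
      rw [← hexp]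
      by_cases h : phi k (confidence δ k) (scale δ k (lastIndex δ k)) ≤ (cluster g o).card
      · exact (orderProb_mono fun σ hσ => hσ.2).trans
          (orderProb_cluster_last_le hk hδ' hδ1' hα hα6 hn h)
      · rw [orderProb_eq_zero fun σ hσ => h hσ.1]
        exact (Real.exp_pos _).le
    refine (orderProb_exists_le _ _).trans ((sum_le_sum h4).trans ?_)
    rw [sum_const, nsmul_eq_mul]
    have h5 : (O.card : ℝ) * (confidence δ k / (32 * k)) ≤ k * (confidence δ k / (32 * k)) := by
      gcongr
    have h6 : (k : ℝ) * (confidence δ k / (32 * k)) = confidence δ k / 32 := by field_simp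
    linarith [confidence_le (k := k) hδ]
  have h4 := (orderProb_cell_le (n := n) (A := A) (δ := confidence δ k) hk hα hA
    (largePart g (phi k (confidence δ k) (scale δ k (lastIndex δ k))))
    (lastM k (confidence δ k))).trans (kPlus_mul_pow_lastM_le hk hδ')
  refine (orderProb_mono (E' := fun σ : Fin n ≃ X => _ ∨ (_ ∨ (_ ∨ _))) fun σ hσ => ?_).trans
    (((orderProb_or_le _ _).trans (add_le_add h1 ((orderProb_or_le _ _).trans
      (add_le_add h2 ((orderProb_or_le _ _).trans (add_le_add h3 h4)))))).trans
      (by linarith [confidence_le (k := k) hδ]))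
  by_contra hcon
  push Not at hcon
  exact hσ ⟨hcon.1, hcon.2.1, hcon.2.2.1, hcon.2.2.2⟩

/-- The number of copies and `log (32 k / δ')` are both `O(log (k / δ))`. -/
theorem card_run_le (hk : 2 ≤ k) (hδ : 0 < δ) (hδ1 : δ < 1) (hA : IsOfflineApprox A β)
    {σ : Fin n ≃ X} (hσ : GoodOrder A β δ k O g σ) :
    (((munsc A δ k n).run (List.ofFn σ)).card : ℝ)
      ≤ 2000000 * (k * Real.log (k / δ) ^ 2) := by
  classical
  have hδ' := confidence_pos (k := k) hδ
  have hδ1' := (confidence_le (k := k) hδ).trans_lt hδ1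
  have hk2 : (2 : ℝ) ≤ k := by exact_mod_cast hk
  have hI := lastIndex_add_one_le hk hδ hδ1
  have hLlam := log_confidence_le hk hδ hδ1
  have hL := four_le_log hk hδ' hδ1'
  have hKp := kPlus_add_one_le hk hδ' hδ1'
  have hM := lastM_add_one_le hk hδ' hδ1'
  have hcardT : ∀ i, (refSet A (confidence δ k) k (scale δ k i) σ).card
      ≤ kPlus k (confidence δ k) := fun i =>
    (hA _ (kPlus k (confidence δ k)) (hk.trans (Nat.le_add_right _ _))).2.1
  set L := Real.log (32 * k / confidence δ k) with hLdef
  set lam := Real.log (k / δ) with hlam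
  set I := lastIndex δ k with hIdef
  set K := kPlus k (confidence δ k) with hK
  set M := lastM k (confidence δ k) with hMdef
  have hlt : ∀ i ∈ range I, (((copy A δ k n i).run (List.ofFn σ)).card : ℝ)
      ≤ 72000 * (k * L) + 2 * (K + 1) := by
    intro i hi
    have hiI := mem_range.1 hi
    rw [copy_of_ne A δ k n hiI.ne]
    have h1 := card_selectProc_run_le (A := A) (δ := confidence δ k) (k := k)
      (γ := 2 * scale δ k i) (M := 1) (τ := phi k (confidence δ k) (scale δ k (lastIndex δ k)))
      (scale_pos hk hδ i).le σ
    have h2 := (hσ.copies i (mem_range.2 (by omega))).2.2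
    rw [if_neg hiI.ne] at h2
    refine (Nat.cast_le.2 h1).trans ?_
    push_cast
    have h3 : ((refSet A (confidence δ k) k (scale δ k i) σ).card : ℝ) ≤ K := by
      exact_mod_cast hcardT i
    refine add_le_add h2 ?_
    linarith
  have hlast : (((copy A δ k n I).run (List.ofFn σ)).card : ℝ)
      ≤ 72000 * (k * L) + (M + 1) * (K + 1) := by
    rw [hIdef, copy_last A δ k n]
    have h1 := card_selectProc_run_le (A := A) (δ := confidence δ k) (k := k)
      (γ := 1 - 2 * scale δ k I) (M := M) (τ := phi k (confidence δ k) (scale δ k (lastIndex δ k)))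
      (scale_pos hk hδ I).le σ
    rw [floor_last] at h1
    have h2 := (hσ.copies I (mem_range.2 (by omega))).2.2
    rw [if_pos rfl] at h2
    refine (Nat.cast_le.2 h1).trans ?_
    push_cast
    have h3 : ((refSet A (confidence δ k) k (scale δ k I) σ).card : ℝ) ≤ K := by
      exact_mod_cast hcardT I
    exact add_le_add h2 (by gcongr)
  have hsub : (munsc A δ k n).run (List.ofFn σ) ⊆
      (range (I + 1)).biUnion (fun i => (copy A δ k n i).run (List.ofFn σ)) := by
    intro x hx
    obtain ⟨i, hi, h⟩ := (mem_munsc_run_iff σ x).1 hx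
    exact mem_biUnion.2 ⟨i, mem_range.2 (by omega), h⟩
  have htot : (((munsc A δ k n).run (List.ofFn σ)).card : ℝ)
      ≤ ∑ i ∈ range (I + 1), (((copy A δ k n i).run (List.ofFn σ)).card : ℝ) := by
    exact_mod_cast (card_le_card hsub).trans card_biUnion_le
  rw [sum_range_succ] at htot
  have hsum := sum_le_sum hlt
  rw [sum_const, card_range, nsmul_eq_mul] at hsum
  have hI0 : (0 : ℝ) ≤ I := Nat.cast_nonneg _
  have hK0 : (0 : ℝ) ≤ K := Nat.cast_nonneg _
  have hlam0 : 0 < lam := by linarith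
  have hkL0 : 0 < k * L := by positivity
  have hLsq : k * (lam * L) ≤ 9 * (k * lam ^ 2) := by
    have : lam * L ≤ lam * (9 * lam) := by gcongr
    have := mul_le_mul_of_nonneg_left this (by linarith : (0 : ℝ) ≤ k)
    nlinarith
  have hLsq' : k * (L * L) ≤ 81 * (k * lam ^ 2) := by
    have : L * L ≤ (9 * lam) * (9 * lam) := by gcongr
    have := mul_le_mul_of_nonneg_left this (by linarith : (0 : ℝ) ≤ k)
    nlinarith
  have hMK : ((M : ℝ) + 1) * (K + 1) ≤ 120 * (k * (L * L)) := by
    calc ((M : ℝ) + 1) * (K + 1) ≤ (6 * L) * (20 * (k * L)) := by gcongr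
      _ = 120 * (k * (L * L)) := by ring
  have hcopies : (I : ℝ) * (72000 * (k * L) + 2 * (K + 1)) + 72000 * (k * L)
      ≤ (I + 1) * (72040 * (k * L)) := by nlinarith
  have hIL : ((I : ℝ) + 1) * (72040 * (k * L)) ≤ (3 * lam) * (72040 * (k * L)) := by gcongr
  have : (3 * lam) * (72040 * (k * L)) = 216120 * (k * (lam * L)) := by ring
  have hkl : 0 ≤ k * lam ^ 2 := by positivity
  linarith

/-- Small clusters are served through their centers, and large ones through the last copy. -/
theorem risk_run_le (hk : 2 ≤ k) (hδ : 0 < δ) (hδ1 : δ < 1) (hβ : 1 ≤ β)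
    (hO : O.card ≤ k) (hfin : risk univ O ≠ ⊤)
    (hg : ∀ x, g x ∈ O ∧ setDist x O = edist x (g x))
    {σ : Fin n ≃ X} (hσ : GoodOrder A β δ k O g σ) :
    risk univ ((munsc A δ k n).run (List.ofFn σ))
      ≤ ENNReal.ofReal (1619 * β) * risk univ O := by
  classical
  have hδ' := confidence_pos (k := k) hδ
  have hδ1' := (confidence_le (k := k) hδ).trans_lt hδ1
  have hk2 : (2 : ℝ) ≤ k := by exact_mod_cast hk
  have hα := scale_pos hk hδ (lastIndex δ k)
  have hτ : 0 < phi k (confidence δ k) (scale δ k (lastIndex δ k)) :=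
    phi_pos hα hk hδ' hδ1'
  have hcells := hσ.cells
  have hclusters := hσ.clusters
  have hlastGood := hσ.copies (lastIndex δ k) (mem_range.2 (Nat.lt_succ_self _))
  have hcopylast := copy_last A δ k n
  have hnotmem := fun {i : ℕ} {γ : ℝ} {M : ℕ} {t : Fin n} => selectProc_not_mem_run (A := A)
    (δ := confidence δ k) (k := k) (γ := γ) (M := M)
    (τ := phi k (confidence δ k) (scale δ k (lastIndex δ k)))
    (scale_pos hk hδ i).le σ (i := t)
  set τ := phi k (confidence δ k) (scale δ k (lastIndex δ k)) with hτdef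
  set I := lastIndex δ k with hI
  set R := (munsc A δ k n).run (List.ofFn σ) with hR
  set Λ := largePart g τ with hΛ
  set Ψ := ENNReal.ofReal (31 * β) * risk univ O with hΨ
  have hΨfin : Ψ ≠ ⊤ := ENNReal.mul_ne_top ENNReal.ofReal_ne_top hfin
  have hkτ : 0 < k * τ := by positivity
  have hest : ∀ i ≤ I, estimate A (confidence δ k) k (scale δ k i) σ ≤ Ψ := fun i hi =>
    (hσ.copies i (mem_range.2 (by omega))).2.1.trans (hσ.copies i (mem_range.2 (by omega))).1
  have hsubR : ∀ i ≤ I, (copy A δ k n i).run (List.ofFn σ) ⊆ R := fun i hi x hx =>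
    (mem_munsc_run_iff σ x).2 ⟨i, hi, hx⟩
  have hsmallcard : ((Λᶜ).card : ENNReal) ≤ ENNReal.ofReal (k * τ) := by
    rw [← ENNReal.ofReal_natCast]
    exact ENNReal.ofReal_le_ofReal (card_compl_largePart_le (fun x => (hg x).1) hτ.le hO)
  -- every optimal center is close to a selected point
  have hcenter : ∀ o ∈ O, setDist o R ≤ 2 * (Ψ / ENNReal.ofReal (k * τ)) := by
    intro o ho
    have h1 := hσ.centers o ho
    rw [mem_block] at h1
    obtain ⟨i, hi, γ, M, hlow, hhigh, hcopy⟩ := exists_copy_active A δ k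
      (t := (σ.symm o).val) (by omega) (σ.symm o).2
    by_cases hsel : o ∈ (copy A δ k n i).run (List.ofFn σ)
    · rw [setDist_eq_zero_of_mem (hsubR i hi hsel)]
      exact zero_le
    · have h2 := hnotmem (i := i) (γ := γ) (M := M) (t := σ.symm o) hlow hhigh
      rw [Equiv.apply_symm_apply, ← hcopy] at h2
      obtain ⟨hd, -, y, hy, hyn, hyd⟩ := h2 hsel
      have hle : estimate A (confidence δ k) k (scale δ k i) σ / ENNReal.ofReal (k * τ)
          ≤ Ψ / ENNReal.ofReal (k * τ) := ENNReal.div_le_div_right (hest i hi) _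
      calc setDist o R ≤ edist o y := setDist_le (hsubR i hi hy)
        _ ≤ _ := edist_le_of_nearest_eq hyn.symm
        _ ≤ Ψ / ENNReal.ofReal (k * τ) + Ψ / ENNReal.ofReal (k * τ) :=
            add_le_add (hd.trans hle) (hyd.trans hle)
        _ = _ := (two_mul _).symm
  have hsmall : risk Λᶜ R ≤ risk univ O + 2 * Ψ := by
    calc risk Λᶜ R ≤ ∑ x ∈ Λᶜ, (setDist x O + 2 * (Ψ / ENNReal.ofReal (k * τ))) := by
          refine sum_le_sum fun x _ => ?_
          rw [(hg x).2]
          exact (setDist_le_edist_add x (g x) R).trans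
            (add_le_add le_rfl (hcenter (g x) (hg x).1))
      _ = risk Λᶜ O + (Λᶜ).card * (2 * (Ψ / ENNReal.ofReal (k * τ))) := by
          rw [sum_add_distrib, sum_const, nsmul_eq_mul]; rfl
      _ ≤ risk univ O + ENNReal.ofReal (k * τ) * (2 * (Ψ / ENNReal.ofReal (k * τ))) := by
          gcongr
          exact risk_mono_left (subset_univ _)
      _ = risk univ O + 2 * (ENNReal.ofReal (k * τ) * (Ψ / ENNReal.ofReal (k * τ))) := by ring
      _ ≤ risk univ O + 2 * Ψ := by gcongr; exact ENNReal.mul_div_le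
  -- the large clusters are served by the last copy
  set T := refSet A (confidence δ k) k (scale δ k I) σ with hT
  set P := block σ ⌊2 * scale δ k I * n⌋₊ n with hP
  set R' := (copy A δ k n I).run (List.ofFn σ) with hR'
  set θ := estimate A (confidence δ k) k (scale δ k I) σ / ENNReal.ofReal (k * τ) with hθ
  have hθfin : θ ≠ ⊤ := ne_top_of_le_ne_top
    (ENNReal.div_ne_top hΨfin (ENNReal.ofReal_pos.2 hkτ).ne')
    (ENNReal.div_le_div_right (hest I le_rfl) _)
  have hunsel : ∀ t : Fin n, σ t ∈ P → σ t ∉ R' → setDist (σ t) T ≤ θ ∧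
      lastM k (confidence δ k) ≤ ((block σ ⌊2 * scale δ k I * n⌋₊ t).filter (fun y =>
          nearest T y = nearest T (σ t))).card ∧
      ∃ y ∈ R', nearest T y = nearest T (σ t) ∧ setDist y T ≤ θ := by
    intro t ht ht'
    have h1 := apply_mem_block.1 ht
    have h2 := hnotmem (i := I) (γ := 1 - 2 * scale δ k I) (M := lastM k (confidence δ k))
      (t := t) h1.1 (by rw [floor_last]; exact h1.2)
    rw [← hcopylast] at h2
    exact h2 ht'
  have hTΨ : risk Λ T ≤ Ψ := hlastGood.1
  have hPΛ : risk (P ∩ Λ) R' ≤ 10 * Ψ := by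
    rcases T.eq_empty_or_nonempty with hTe | hTne
    · have hall : ∀ x ∈ P, x ∈ R' := by
        intro x hx
        by_contra hx'
        have h1 := (hunsel (σ.symm x) (by simpa using hx) (by simpa using hx')).1
        rw [hTe, setDist_empty, top_le_iff] at h1
        exact hθfin h1
      have : risk (P ∩ Λ) R' = 0 :=
        sum_eq_zero fun x hx => setDist_eq_zero_of_mem (hall x (mem_inter.1 hx).1)
      rw [this]
      exact zero_le
    · have hmain := risk_unselected_le (P := P) (Λ := Λ) (R := R') (θ := θ) hTne
        (ne_top_of_le_ne_top hΨfin hTΨ)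
        (fun x hx hx' => by
          have h1 := (hunsel (σ.symm x) (by simpa using hx) (by simpa using hx')).2.2
          simpa using h1)
        (fun x hx hx' => by
          have h1 := (hunsel (σ.symm x) (by simpa using hx) (by simpa using hx')).1
          simpa using h1)
        (fun c hc Q hQ hQR hhalf => by
          have hQcell : Q = cell A (confidence δ k) k (scale δ k I) σ c := hQ
          have hcell : ∀ t : Fin n, σ t ∈ Q → (block σ ⌊2 * scale δ k I * n⌋₊ t).filter
              (fun y => nearest T y = nearest T (σ t))
              = block σ ⌊2 * scale δ k I * n⌋₊ t ∩ Q := by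
            intro t ht
            rw [hQ, mem_filter] at ht
            ext y
            rw [hQ, ht.2]
            simp only [mem_filter, mem_inter, mem_block]
            have hP' : y ∈ P ↔ _ := mem_block
            rw [hP']
            have := t.2
            constructor
            · rintro ⟨h1, h2⟩; exact ⟨h1, ⟨h1.1, by omega⟩, h2⟩
            · rintro ⟨h1, -, h2⟩; exact ⟨h1, h2⟩
          obtain ⟨x, hxQ, hxR⟩ := not_subset.1 hQR
          obtain ⟨t₀, rfl⟩ := σ.surjective x
          have hM : lastM k (confidence δ k) ≤ Q.card := by
            have h1 := (hunsel t₀ (by rw [hQ, mem_filter] at hxQ; exact hxQ.1) hxR).2.1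
            rw [hcell t₀ hxQ] at h1
            exact h1.trans (card_le_card inter_subset_right)
          rw [hQcell] at hM hhalf
          obtain ⟨t, ht, htM, htA⟩ := hcells c hc hM hhalf
          rw [← hQcell] at ht htM htA
          refine ⟨σ t, ?_, htA⟩
          by_contra htR
          have h1 := (hunsel t (by rw [hQ, mem_filter] at ht; exact ht.1) htR).2.1
          rw [hcell t ht] at h1
          omega)
      have h1 : ((P \ Λ).card : ENNReal) * θ ≤ Ψ := by
        calc ((P \ Λ).card : ENNReal) * θ ≤ ENNReal.ofReal (k * τ) * θ := by
              gcongr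
              refine le_trans ?_ hsmallcard
              gcongr
              intro x hx
              exact mem_compl.2 (mem_sdiff.1 hx).2
          _ ≤ estimate A (confidence δ k) k (scale δ k I) σ := ENNReal.mul_div_le
          _ ≤ Ψ := hest I le_rfl
      calc risk (P ∩ Λ) R' ≤ 4 * risk Λ T + 6 * (((P \ Λ).card : ENNReal) * θ) := hmain
        _ ≤ 4 * Ψ + 6 * Ψ := by gcongr
        _ = 10 * Ψ := by ring
  have hlarge : risk Λ R ≤ risk univ O + 5 * (risk univ O + 10 * Ψ) := by
    refine (risk_largePart_le hg P R (κ := 5) fun o ho h => ?_).trans ?_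
    · exact_mod_cast hclusters o ho h
    · exact add_le_add le_rfl (mul_le_mul_right (add_le_add (risk_mono_left (subset_univ _))
        ((risk_anti_right _ (hsubR I le_rfl)).trans hPΛ)) 5)
  have hsplit : risk univ R = risk Λ R + risk Λᶜ R := (sum_add_sum_compl _ _).symm
  have hb : (0 : ℝ) ≤ β := by linarith
  calc risk univ R ≤ (risk univ O + 5 * (risk univ O + 10 * Ψ)) + (risk univ O + 2 * Ψ) := by
        rw [hsplit]; exact add_le_add hlarge hsmall
    _ = ENNReal.ofReal (7 + 1612 * β) * risk univ O := by
        have e : ENNReal.ofReal (7 + 1612 * β) = 7 + 52 * ENNReal.ofReal (31 * β) := by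
          rw [ENNReal.ofReal_add (by norm_num) (by positivity),
            show (1612 : ℝ) * β = 52 * (31 * β) by ring, ENNReal.ofReal_mul (by norm_num)]
          simp
        rw [e, hΨ]; ring
    _ ≤ ENNReal.ofReal (1619 * β) * risk univ O := by
        gcongr
        linarith

end Conclusion

end MUNSC

theorem theorem1 :
    ∃ C₁ C₂ : ℝ, 0 < C₁ ∧ 0 < C₂ ∧
      ∀ (X : Type*) [Fintype X] [MetricSpace X] [LinearOrder X]
        (k n : ℕ) (δ β : ℝ) (A : Finset X → ℕ → Finset X) (OPT : Finset X),
        2 ≤ k → Fintype.card X = n → 0 < δ → δ < 1 → 1 ≤ β →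
        MUNSC.IsOfflineApprox A β →
        MUNSC.IsOptimal Finset.univ k OPT →
        (MUNSC.munsc A δ k n).NoSubstitution ∧
        1 - δ ≤ MUNSC.orderProb n (fun σ : Fin n ≃ X =>
          (((MUNSC.munsc A δ k n).run (List.ofFn σ)).card : ℝ)
              ≤ C₁ * (k * Real.log (k / δ) ^ 2) ∧
            MUNSC.risk Finset.univ ((MUNSC.munsc A δ k n).run (List.ofFn σ))
              ≤ ENNReal.ofReal (C₂ * β) * MUNSC.risk Finset.univ OPT) := by
  refine ⟨2000000, 1619, by norm_num, by norm_num, ?_⟩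
  intro X _ _ _ k n δ β A OPT hk hn hδ hδ1 hβ hA hOPT
  refine ⟨MUNSC.OnlineSelector.noSubstitution _, MUNSC.one_sub_le_orderProb hn _ ?_⟩
  -- an optimal solution of a nonempty space is nonempty and has finite risk
  have hne : ∀ x : X, OPT.Nonempty := by
    intro x
    rw [Finset.nonempty_iff_ne_empty]
    rintro rfl
    have h1 := hOPT.2.2 {x} (Finset.subset_univ _) (by rw [Finset.card_singleton]; omega)
    have h2 : MUNSC.risk Finset.univ (∅ : Finset X) = ⊤ := by
      refine top_le_iff.1 ?_
      rw [← MUNSC.setDist_empty x]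
      exact Finset.single_le_sum (f := fun y => MUNSC.setDist y (∅ : Finset X))
        (fun _ _ => zero_le) (Finset.mem_univ x)
    rw [h2, top_le_iff] at h1
    refine ENNReal.sum_ne_top.2 (fun y _ => ?_) h1
    exact ne_top_of_le_ne_top (edist_ne_top y x) (MUNSC.setDist_le (Finset.mem_singleton_self x))
  choose g hg using fun x : X => MUNSC.exists_setDist_eq x (hne x)
  have hfin : MUNSC.risk Finset.univ OPT ≠ ⊤ :=
    ENNReal.sum_ne_top.2 fun x _ => by rw [(hg x).2]; exact edist_ne_top _ _
  refine (MUNSC.orderProb_mono fun σ hσ => ?_).trans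
    (MUNSC.orderProb_not_goodOrder_le hn hk hδ hδ1 hβ hA hOPT.2.1 hg)
  intro hgood
  exact hσ ⟨MUNSC.card_run_le hk hδ hδ1 hA hgood,
    MUNSC.risk_run_le hk hδ hδ1 hβ hOPT.2.1 hfin hg hgood⟩
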